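/- **Setting.** Let $G$ be an $n$-vertex maximal plane graph, i.e. a simple planar graph to which no edge can be added without losing planarity or simplicity, with a fixed planar embedding (given by the counter-clockwise circular order of the edges around each vertex) and a designated outer face, delimited by a cycle $(u_1,u_2,u_3)$ in this counter-clockwise order (so $n\ge 3$). Vertices and edges not incident to the outer face are internal. A *Schnyder wood* $\mathcal W=(\mathcal T_1,\mathcal T_2,\mathcal T_3)$ of $G$ is an assignment of a direction and of a color in $\{1,2,3\}$ (indices cyclic) to each internal edge such that: (S-1) each internal vertex $x$ has, for each $i$, exactly one outgoing edge $e_i$ of color $i$; the edges $e_1,e_2,e_3$ appear in this counter-clockwise order at $x$; and all incoming edges of color $i$ at $x$ lie in the sector that is swept counter-clockwise from $e_{i+1}$ to $e_{i-1}$; (S-2) at the outer vertex $u_i$ all internal edges are incoming and of color $i$. *Schnyder's algorithm* maps a Schnyder wood $\mathcal W$ of $G$ to the following straight-line grid drawing $s(\mathcal W)$: the vertices $u_1,u_2,u_3$ are placed at $(0,0)$, $(2n-5,0)$, $(0,2n-5)$. For an internal vertex $w$ let $\mathcal P_i(w)$ be the directed path of color $i$ from $w$ to $u_i$, let $\mathcal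 C_x(w)$ be the cycle formed by $\mathcal P_1(w)$, $\mathcal P_3(w)$ and the edge $u_1u_3$, and let $\mathcal C_y(w)$ be the cycle formed by $\mathcal P_1(w)$, $\mathcal P_2(w)$ and the edge $u_1u_2$; then $w$ is placed at $(\#_f(\mathcal C_x(w)),\#_f(\mathcal C_y(w)))$, where $\#_f(\mathcal C)$ is the number of internal faces of $G$ in the interior of the cycle $\mathcal C$. The *Schnyder drawings* of $G$ are the drawings $s(\mathcal W)$, for the Schnyder woods $\mathcal W$ of $G$; two of them are equal if every vertex has the same position in both. **Theorem.** Schnyder's algorithm is well defined (the paths and cycles above exist and the drawing $s(\mathcal W)$ is uniquely determined by $\mathcal W$), and $\mathcal W\mapsto s(\mathcal W)$ is a bijection from the Schnyder woods of $G$ to the Schnyder drawings of $G$. Moreover, the slopes of the edges in the drawing determine the wood: an edge $ab$ of $G$ is, in $\mathcal W$, directed from $a$ to $b$ and of color $1$, $2$, $3$ if and only if the vector from $a$ to $b$ in $s(\mathcal W)$ has its angle in $(180^\circ,270^\circ)$, $(315^\circ,360^\circ)$, $(90^\circ,135^\circ)$, respectively. Finally, there is an algorithm that, given $G$ and a Schnyder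 wood $\mathcal W$ of $G$, constructs $s(\mathcal W)$ in $O(n)$ time, on a random access machine with unit-cost operations on integers of size $O(n)$, the constants not depending on $G$ and $\mathcal W$. -/

import Mathlib

namespace Schnyder

/-! ### Planar embeddings of simple graphs -/

/-- A rotation system: `next d` is the edge that follows `d` in counter-clockwise order around the
tail of `d` (edges are seen as darts, i.e. from one of their end-vertices), and the edges around a
vertex form one single cycle. -/
structure RotationSystem {V : Type*} (G : SimpleGraph V) where
  next : Equiv.Perm G.Dart
  next_fst : ∀ d, (next d).fst = d.fst
  cyclic : ∀ d d' : G.Dart, d.fst = d'.fst → next.SameCycle d d'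

namespace RotationSystem

variable {V : Type*} {G : SimpleGraph V} (R : RotationSystem G)

/-- The successor of a dart along the boundary of the face on its left: reverse the dart and take the
clockwise next one. -/
def facePerm : Equiv.Perm G.Dart :=
  (SimpleGraph.Dart.symm_involutive (G := G)).toPerm.trans R.next.symm

/-- Faces are the orbits of `facePerm`. -/
def Face : Type _ := Quotient (Equiv.Perm.SameCycle.setoid R.facePerm)

/-- The face on the left of a dart. -/
def leftFace (d : G.Dart) : R.Face := Quotient.mk _ d

/-- Euler's formula `v - e + f = 2` for every connected component, summed up: the rotation system is
one of a drawing in the plane (genus zero). An isolated vertex carries no dart, so that its face is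
counted separately. -/
def GenusZero : Prop :=
  Nat.card V + (Nat.card R.Face + Nat.card {v : V // ∀ w, ¬ G.Adj v w}) =
    Nat.card G.edgeSet + 2 * Nat.card G.ConnectedComponent

/-- In the counter-clockwise order around a vertex, starting at `a`, the dart `c` comes strictly
after `a` and strictly before (the first occurrence of) `b`. -/
def CcwBetween (a c b : G.Dart) : Prop :=
  ∃ k m : ℕ, 0 < k ∧ k < m ∧ (R.next ^ k) a = c ∧ (R.next ^ m) a = b ∧
    ∀ j, 0 < j → j < m → (R.next ^ j) a ≠ b

end RotationSystem

/-- A simple graph is planar if it has a planar embedding. -/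
def IsPlanar {V : Type*} (G : SimpleGraph V) : Prop := ∃ R : RotationSystem G, R.GenusZero

/-- A planar simple graph to which no edge can be added without losing planarity or simplicity. -/
def IsMaximalPlanar {V : Type*} (G : SimpleGraph V) : Prop :=
  IsPlanar G ∧ ∀ a b : V, a ≠ b → ¬ G.Adj a b → ¬ IsPlanar (G ⊔ SimpleGraph.edge a b)

/-- A maximal plane graph: a maximal planar graph with a planar embedding and a designated outer face,
delimited by a cycle `outer 0, outer 1, outer 2` in this counter-clockwise order. -/
structure MaximalPlaneGraph (V : Type*) where
  graph : SimpleGraph V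
  maximal : IsMaximalPlanar graph
  rot : RotationSystem graph
  genusZero : rot.GenusZero
  outer : Fin 3 → V
  outer_adj : ∀ i, graph.Adj (outer i) (outer (i + 1))
  /-- Walking along the cycle clockwise one has the outer face on the left. -/
  outer_face : ∀ i, (rot.facePerm ⟨(outer (i + 1), outer i), (outer_adj i).symm⟩).toProd =
    (outer i, outer (i + 2))

namespace MaximalPlaneGraph

variable {V : Type*} (G : MaximalPlaneGraph V)

def outerFace : G.rot.Face := G.rot.leftFace ⟨(G.outer 1, G.outer 0), (G.outer_adj 0).symm⟩

def IsInternalVertex (x : V) : Prop := ∀ i, x ≠ G.outer i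

def IsInternalEdge (e : Sym2 V) : Prop := e ∈ G.graph.edgeSet ∧ ∀ i, e ≠ s(G.outer i, G.outer (i + 1))

/-- Two faces share an edge that is not in `C`. -/
def DualAdj (C : Set (Sym2 V)) (f g : G.rot.Face) : Prop :=
  ∃ d : G.graph.Dart, d.edge ∉ C ∧ G.rot.leftFace d = f ∧ G.rot.leftFace d.symm = g

/-- The number of internal faces in the interior of a cycle: those that cannot be reached from the
outer face without crossing the cycle. -/
noncomputable def facesInside {a : V} (C : G.graph.Walk a a) : ℕ :=
  {f : G.rot.Face | ¬ Relation.ReflTransGen (G.DualAdj {e | e ∈ C.edges}) G.outerFace f}.ncard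

end MaximalPlaneGraph

/-! ### Schnyder woods -/

/-- A Schnyder wood. Colors are `0, 1, 2` with cyclic arithmetic; `lab d = some i` says that the edge
of `d` has color `i` and is directed from `d.fst` to `d.snd`. -/
@[ext]
structure SchnyderWood {V : Type*} (G : MaximalPlaneGraph V) where
  lab : G.graph.Dart → Option (Fin 3)
  /-- Outer edges get no direction and no color. -/
  lab_outer : ∀ d : G.graph.Dart, ¬ G.IsInternalEdge d.edge → lab d = none
  /-- Every internal edge gets exactly one direction, and a color. -/
  lab_internal : ∀ d : G.graph.Dart, G.IsInternalEdge d.edge → ((lab d).isSome ↔ lab d.symm = none)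
  /-- An internal vertex has exactly one outgoing edge of each color. -/
  out_unique : ∀ x, G.IsInternalVertex x → ∀ i, ∃! d : G.graph.Dart, d.fst = x ∧ lab d = some i
  /-- The outgoing edges of colors `0, 1, 2` are in this counter-clockwise order. -/
  out_ccw : ∀ e : Fin 3 → G.graph.Dart, G.IsInternalVertex (e 0).fst →
    (∀ i, (e i).fst = (e 0).fst ∧ lab (e i) = some i) → G.rot.CcwBetween (e 0) (e 1) (e 2)
  /-- The incoming edges of color `i` lie, counter-clockwise, after the outgoing edge of color `i + 1`
  and before the outgoing edge of color `i - 1`. -/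
  in_sector : ∀ (i : Fin 3) (a b c : G.graph.Dart), G.IsInternalVertex c.fst →
    a.fst = c.fst → b.fst = c.fst → lab a = some (i + 1) → lab b = some (i - 1) →
    lab c.symm = some i → G.rot.CcwBetween a c b
  /-- At the outer vertex `i` all the internal edges are incoming and of color `i`. -/
  at_outer : ∀ (i : Fin 3) (d : G.graph.Dart), d.fst = G.outer i → G.IsInternalEdge d.edge →
    lab d.symm = some i

/-! ### Schnyder drawings -/

/-- A straight-line grid drawing is given by the points of the vertices. -/
abbrev GridDrawing (V : Type*) : Type _ := V → ℤ × ℤ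

namespace SchnyderWood

variable {V : Type*} {G : MaximalPlaneGraph V} (W : SchnyderWood G)

/-- `P` is a directed path in the tree of color `i`. -/
def IsTreePath (i : Fin 3) {a b : V} (P : G.graph.Walk a b) : Prop :=
  P.IsPath ∧ ∀ d ∈ P.darts, W.lab d = some i

/-- The closed walk made of a walk from `w` to `outer 0`, a walk from `w` to `outer 2`, and the edge
between `outer 0` and `outer 2`. -/
def cycleX {w : V} (P₁ : G.graph.Walk w (G.outer 0)) (P₃ : G.graph.Walk w (G.outer 2)) :
    G.graph.Walk (G.outer 2) (G.outer 2) :=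
  .cons (G.outer_adj 2) (P₁.reverse.append P₃)

/-- The closed walk made of a walk from `w` to `outer 0`, a walk from `w` to `outer 1`, and the edge
between `outer 0` and `outer 1`. -/
def cycleY {w : V} (P₁ : G.graph.Walk w (G.outer 0)) (P₂ : G.graph.Walk w (G.outer 1)) :
    G.graph.Walk (G.outer 1) (G.outer 1) :=
  .cons (G.outer_adj 0).symm (P₁.reverse.append P₂)

/-- `Γ` is the outcome of Schnyder's algorithm for the Schnyder wood `W`. -/
structure Draws (Γ : GridDrawing V) : Prop where
  outer₁ : Γ (G.outer 0) = (0, 0)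
  outer₂ : Γ (G.outer 1) = (2 * (Nat.card V : ℤ) - 5, 0)
  outer₃ : Γ (G.outer 2) = (0, 2 * (Nat.card V : ℤ) - 5)
  internal : ∀ w, G.IsInternalVertex w →
    ∃ P : (i : Fin 3) → G.graph.Walk w (G.outer i),
      (∀ i, W.IsTreePath i (P i)) ∧
      (cycleX (P 0) (P 2)).IsCycle ∧ (cycleY (P 0) (P 1)).IsCycle ∧
      Γ w = ((G.facesInside (cycleX (P 0) (P 2)) : ℤ), (G.facesInside (cycleY (P 0) (P 1)) : ℤ))

end SchnyderWood

/-- The Schnyder drawings of `G` are the outcomes of Schnyder's algorithm for the Schnyder woods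
of `G`. -/
def SchnyderDrawing {V : Type*} (G : MaximalPlaneGraph V) : Type _ :=
  {Γ : GridDrawing V // ∃ W : SchnyderWood G, W.Draws Γ}

/-- The vector `(x, y)` has its angle in `(180°, 270°)`, `(315°, 360°)` or `(90°, 135°)` for the color
`0`, `1` or `2`, respectively. -/
def InSector : Fin 3 → ℤ × ℤ → Prop
  | 0, (x, y) => x < 0 ∧ y < 0
  | 1, (x, y) => 0 < x ∧ y < 0 ∧ 0 < x + y
  | 2, (x, y) => x < 0 ∧ 0 < y ∧ 0 < x + y

/-! ### Random access machines -/

/-- Instructions of a random access machine with registers and a memory, both holding natural numbers.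
* `const r c`: register `r` gets the value `c`;
* `add r a b`, `sub r a b`: register `r` gets the sum (the truncated difference) of registers `a`, `b`;
* `load r a`: register `r` gets the memory cell whose address is in register `a`;
* `store a b`: the memory cell whose address is in register `a` gets the value of register `b`;
* `jumpLt a b l`: if register `a` is smaller than register `b`, go to line `l`. -/
inductive Instr : Type
  | const (r c : ℕ)
  | add (r a b : ℕ)
  | sub (r a b : ℕ)
  | load (r a : ℕ)
  | store (a b : ℕ)
  | jumpLt (a b l : ℕ)

abbrev Program : Type := List Instr

structure State : Type where
  pc : ℕ
  reg : ℕ → ℕ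
  mem : ℕ → ℕ

/-- Execution of one instruction. -/
def Instr.exec : Instr → State → State
  | .const r c, s => ⟨s.pc + 1, Function.update s.reg r c, s.mem⟩
  | .add r a b, s => ⟨s.pc + 1, Function.update s.reg r (s.reg a + s.reg b), s.mem⟩
  | .sub r a b, s => ⟨s.pc + 1, Function.update s.reg r (s.reg a - s.reg b), s.mem⟩
  | .load r a, s => ⟨s.pc + 1, Function.update s.reg r (s.mem (s.reg a)), s.mem⟩
  | .store a b, s => ⟨s.pc + 1, s.reg, Function.update s.mem (s.reg a) (s.reg b)⟩
  | .jumpLt a b l, s => ⟨if s.reg a < s.reg b then l else s.pc + 1, s.reg, s.mem⟩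

namespace Program

variable (p : Program)

/-- The machine halts when it leaves the program. -/
def Halted (s : State) : Prop := p.length ≤ s.pc

def step (s : State) : State :=
  match p[s.pc]? with
  | none => s
  | some ins => ins.exec s

/-- The input stands at the beginning of the memory; everything else is zero. -/
def init (input : List ℕ) : State := ⟨0, fun _ => 0, fun a => input.getD a 0⟩

/-- The state after `t` steps. -/
def run (input : List ℕ) (t : ℕ) : State := p.step^[t] (init input)

/-- On the given input the program halts after at most `T` steps with a memory that satisfies `out`,
and no number ever held in a register or in a memory cell exceeds `B`. -/
def Computes (input : List ℕ) (T B : ℕ) (out : (ℕ → ℕ) → Prop) : Prop :=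
  ∃ t ≤ T, p.Halted (p.run input t) ∧ out (p.run input t).mem ∧
    ∀ t' ≤ t, ∀ a, (p.run input t').reg a ≤ B ∧ (p.run input t').mem a ≤ B

end Program

/-- `0` for an edge that is outer or not directed this way, `i + 1` for one directed this way with
color `i`. -/
def labelCode : Option (Fin 3) → ℕ
  | none => 0
  | some i => (i : ℕ) + 1

/-- The input of the algorithm, for a numbering `ν` of the vertices and a numbering `δ` of the darts:
the number of vertices, the number of darts, the three outer vertices, and for each dart a record with
its tail, its reverse, its counter-clockwise successor around its tail, and its label. -/
def encode {V : Type*} {G : MaximalPlaneGraph V} (W : SchnyderWood G) {n m : ℕ}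
    (ν : V ≃ Fin n) (δ : G.graph.Dart ≃ Fin m) : List ℕ :=
  [n, m, (ν (G.outer 0) : ℕ), (ν (G.outer 1) : ℕ), (ν (G.outer 2) : ℕ)] ++
    (List.ofFn fun k : Fin m =>
      [(ν (δ.symm k).fst : ℕ), (δ (δ.symm k).symm : ℕ), (δ (G.rot.next (δ.symm k)) : ℕ),
        labelCode (W.lab (δ.symm k))]).flatten

/-- The memory holds the drawing `Γ`: vertex number `k` has its coordinates in cells `2k`, `2k + 1`. -/
def Holds {V : Type*} {n : ℕ} (ν : V ≃ Fin n) (Γ : GridDrawing V) (mem : ℕ → ℕ) : Prop :=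
  ∀ w, Γ w = ((mem (2 * (ν w : ℕ)) : ℤ), (mem (2 * (ν w : ℕ) + 1) : ℤ))

end Schnyder

set_option linter.unusedSectionVars false

namespace Schnyder

/-! ### Darts and faces -/

/-! The proof rests on the angle labelling `ang`. By the sector rule the labels of the corners of a
face increase by one modulo 3 along its boundary (`ang_facePerm`), so every face has a corner of
every label. A wood forces exactly 6n - 12 darts (`card_dart_add`), and Euler's formula then leaves
no slack: the graph is connected, it has 2n - 4 faces, and every face has exactly one corner of each
label (`bijective_leftFace_ang`).

Homology replaces the Jordan curve theorem: in a connected graph of genus zero a divergence-free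
flow is the jump, across edges, of a function on the faces (`RotationSystem.exists_potential`, a
dimension count). For a color i keep the edges of color i and reverse all other internal edges. A
directed cycle of this orientation has a nonzero potential, and at a vertex of an extremal face one
can leave along an outgoing edge of color i + 1 (maximum) or i + 2 (minimum) without leaving the
extremal value. So there is a cycle of one single color. Such a cycle in turn yields one of another
color that encloses fewer faces, which is impossible forever (`no_tree_cycle`, `ascends_acyclic`).
Hence there are three partial orders `Le i`. The colored paths end at their outer vertices, and two
such paths from the same vertex meet nowhere else.

The regions are defined by these orders: `region i v` consists of the internal faces whose corner
labelled i is below v. It is the set of faces enclosed by the two other paths. From a face that is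
not in it, the path of color i escapes without touching the boundary, so that the potential of the
boundary vanishes there; on a face in it, the potential is at least 1, since this bound is inherited
downwards from v. The three potentials add up to 1 on the internal faces, so the three regions
partition these faces (`region_cases`). Along an edge the regions are nested by transitivity, and
the two faces at the edge make the inclusions strict (`ncard_region_lt`). As the sizes add up to 2n
- 5, this is the statement on slopes (`lab_iff_inSector`), which recovers the wood from the drawing
and so gives injectivity.

For linear time, `region i w` is the union of the faces hanging, in the tree of color i, from the
two other paths of w; these two sets overlap in the faces below w. So a coordinate is obtained from
one subtree sum and two path sums (`treeQ_add_treeQ`). These sums are computed by loops without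
nesting over an order with children before parents, in a small language compiled to the machine
(`Cmd.runs_compile`, `Program.exists_computes`). -/

instance instFiniteDart {V : Type*} [Finite V] (G : SimpleGraph V) : Finite G.Dart :=
  Finite.of_injective _ SimpleGraph.Dart.toProd_injective

namespace RotationSystem

variable {V : Type*} {G : SimpleGraph V} (R : RotationSystem G)

lemma next_facePerm (d : G.Dart) : R.next (R.facePerm d) = d.symm :=
  R.next.apply_symm_apply d.symm

lemma facePerm_symm_next (d : G.Dart) : R.facePerm (R.next d).symm = d := by
  apply R.next.injective
  rw [next_facePerm, SimpleGraph.Dart.symm_symm]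

lemma leftFace_facePerm (d : G.Dart) : R.leftFace (R.facePerm d) = R.leftFace d :=
  Quotient.sound ((Equiv.Perm.sameCycle_apply_left).2 (Equiv.Perm.SameCycle.refl _ _))

/-- A corner lies between two consecutive darts, on the left of the first and on the right of the
second. So turning counter-clockwise past a dart leads from its right face to its left face; all
monotonicity arguments around a vertex use this. -/
lemma leftFace_symm_next (d : G.Dart) : R.leftFace (R.next d).symm = R.leftFace d := by
  rw [← R.leftFace_facePerm (R.next d).symm, facePerm_symm_next]

lemma leftFace_next_symm (d : G.Dart) : R.leftFace (R.next.symm d) = R.leftFace d.symm := by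
  rw [← R.leftFace_symm_next, Equiv.apply_symm_apply]

lemma leftFace_surjective : Function.Surjective R.leftFace := Quotient.mk_surjective

lemma facePerm_fst (d : G.Dart) : (R.facePerm d).fst = d.snd := by
  rw [← R.next_fst, next_facePerm]; rfl

lemma next_symm_fst (d : G.Dart) : (R.next.symm d).fst = d.fst := by
  rw [← R.next_fst, Equiv.apply_symm_apply]

lemma next_pow_fst (k : ℕ) (d : G.Dart) : ((R.next ^ k) d).fst = d.fst := by
  induction k with
  | zero => rfl
  | succ k ih => rw [pow_succ', Equiv.Perm.mul_apply, R.next_fst, ih]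

lemma exists_next_pow [Finite V] {a b : G.Dart} (h : a.fst = b.fst) :
    ∃ k : ℕ, (R.next ^ k) a = b := by
  obtain ⟨k, -, hk⟩ := (R.cyclic a b h).exists_pow_eq'
  exact ⟨k, hk⟩

end RotationSystem

namespace MaximalPlaneGraph

variable {V : Type*} (G : MaximalPlaneGraph V)

/-- The outer edge from `outer i` to `outer (i + 1)`, which has an internal face on its left. -/
def outerDart (i : Fin 3) : G.graph.Dart := ⟨(G.outer i, G.outer (i + 1)), G.outer_adj i⟩

lemma outer_injective : Function.Injective G.outer := by
  have h0 := (G.outer_adj 0).ne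
  have h1 := (G.outer_adj 1).ne
  have h2 := (G.outer_adj 2).ne
  intro i j hij
  fin_cases i <;> fin_cases j <;> simp_all

lemma facePerm_outerDart_symm (i : Fin 3) :
    G.rot.facePerm (G.outerDart i).symm = (G.outerDart (i + 2)).symm := by
  apply SimpleGraph.Dart.ext
  refine (G.outer_face i).trans ?_
  have : i + 2 + 1 = i := by fin_cases i <;> rfl
  simp [outerDart, this]

/-- At an outer vertex the outer face fills precisely this one corner. It is where the cyclic order
of the darts is cut open into a linear one. -/
lemma next_outerDart_symm (i : Fin 3) :
    G.rot.next (G.outerDart (i + 2)).symm = G.outerDart i := by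
  rw [← G.facePerm_outerDart_symm, G.rot.next_facePerm, SimpleGraph.Dart.symm_symm]

lemma leftFace_outerDart_symm (i : Fin 3) :
    G.rot.leftFace (G.outerDart i).symm = G.outerFace := by
  have h (i : Fin 3) : G.rot.leftFace (G.outerDart (i + 2)).symm =
      G.rot.leftFace (G.outerDart i).symm := by
    rw [← G.facePerm_outerDart_symm, G.rot.leftFace_facePerm]
  have h0 : G.rot.leftFace (G.outerDart 0).symm = G.outerFace := rfl
  have h1 := h 0
  have h2 := h 2
  fin_cases i
  · exact h0
  · exact h2.trans (h1.trans h0)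
  · exact h1.trans h0

lemma isInternalEdge_iff (d : G.graph.Dart) :
    G.IsInternalEdge d.edge ↔ ∀ i, d ≠ G.outerDart i ∧ d ≠ (G.outerDart i).symm := by
  have h (i : Fin 3) : d.edge = s(G.outer i, G.outer (i + 1)) ↔
      d = G.outerDart i ∨ d = (G.outerDart i).symm :=
    SimpleGraph.dart_edge_eq_iff d (G.outerDart i)
  simp only [IsInternalEdge, SimpleGraph.Dart.edge_mem, true_and, Ne, h, not_or]

lemma isInternalEdge_symm {d : G.graph.Dart} :
    G.IsInternalEdge d.symm.edge ↔ G.IsInternalEdge d.edge := by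
  rw [SimpleGraph.Dart.edge_symm]

lemma not_isInternalVertex {x : V} : ¬ G.IsInternalVertex x ↔ ∃ i, x = G.outer i := by
  simp [IsInternalVertex]

end MaximalPlaneGraph

namespace SchnyderWood

variable {V : Type*} {G : MaximalPlaneGraph V} (W : SchnyderWood G)

lemma isInternalEdge_of_lab {d : G.graph.Dart} {i : Fin 3} (h : W.lab d = some i) :
    G.IsInternalEdge d.edge := by
  by_contra hd
  simp [W.lab_outer d hd] at h

lemma lab_symm_of_lab {d : G.graph.Dart} {i : Fin 3} (h : W.lab d = some i) :
    W.lab d.symm = none :=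
  (W.lab_internal d (W.isInternalEdge_of_lab h)).1 (by simp [h])

lemma fst_internal {d : G.graph.Dart} {i : Fin 3} (h : W.lab d = some i) :
    G.IsInternalVertex d.fst := by
  intro j hj
  have := W.at_outer j d hj (W.isInternalEdge_of_lab h)
  simp [W.lab_symm_of_lab h] at this

lemma lab_of_snd_outer {d : G.graph.Dart} {i j : Fin 3} (h : W.lab d = some i)
    (hj : d.snd = G.outer j) : i = j := by
  have := W.at_outer j d.symm hj (G.isInternalEdge_symm.2 (W.isInternalEdge_of_lab h))
  rw [SimpleGraph.Dart.symm_symm, h] at this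
  exact Option.some.inj this

/-- Every dart is outgoing, incoming, or one of the six outer darts. -/
lemma dart_cases (d : G.graph.Dart) :
    (∃ i, W.lab d = some i) ∨ (∃ i, W.lab d.symm = some i) ∨ (∃ i, d = G.outerDart i) ∨
      ∃ i, d = (G.outerDart i).symm := by
  by_cases hd : G.IsInternalEdge d.edge
  · cases h : W.lab d with
    | some i => exact .inl ⟨i, rfl⟩
    | none =>
      have := (W.lab_internal d hd).not
      simp only [h, Option.isSome_none, Bool.false_eq_true, not_false_eq_true, true_iff] at this
      obtain ⟨i, hi⟩ := Option.ne_none_iff_exists'.1 this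
      exact .inr (.inl ⟨i, hi⟩)
  · rw [G.isInternalEdge_iff] at hd
    push Not at hd
    obtain ⟨i, hi⟩ := hd
    by_cases h : d = G.outerDart i
    · exact .inr (.inr (.inl ⟨i, h⟩))
    · exact .inr (.inr (.inr ⟨i, hi h⟩))

lemma dart_cases_internal {d : G.graph.Dart} (h : G.IsInternalVertex d.fst) :
    (∃ i, W.lab d = some i) ∨ ∃ i, W.lab d.symm = some i := by
  rcases W.dart_cases d with h' | h' | ⟨i, rfl⟩ | ⟨i, rfl⟩
  · exact .inl h'
  · exact .inr h'
  · exact absurd rfl (h i)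
  · exact absurd rfl (h (i + 1))

lemma dart_cases_outer {d : G.graph.Dart} {i : Fin 3} (h : d.fst = G.outer i) :
    W.lab d.symm = some i ∨ d = G.outerDart i ∨ d = (G.outerDart (i + 2)).symm := by
  rcases W.dart_cases d with ⟨j, hj⟩ | ⟨j, hj⟩ | ⟨j, rfl⟩ | ⟨j, rfl⟩
  · exact absurd h (W.fst_internal hj i)
  · have := W.lab_of_snd_outer hj h
    exact .inl (this ▸ hj)
  · have : j = i := G.outer_injective h
    exact .inr (.inl (by rw [this]))
  · have : j + 1 = i := G.outer_injective h
    have : j = i + 2 := by subst this; fin_cases j <;> rfl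
    exact .inr (.inr (by rw [this]))

/-- The outgoing dart of color `i` at the internal vertex `x`. -/
noncomputable def out {x : V} (hx : G.IsInternalVertex x) (i : Fin 3) : G.graph.Dart :=
  (W.out_unique x hx i).choose

variable {x : V} (hx : G.IsInternalVertex x)

lemma out_fst (i : Fin 3) : (W.out hx i).fst = x := (W.out_unique x hx i).choose_spec.1.1

lemma lab_out (i : Fin 3) : W.lab (W.out hx i) = some i := (W.out_unique x hx i).choose_spec.1.2

lemma eq_out {d : G.graph.Dart} {i : Fin 3} (hd : d.fst = x) (h : W.lab d = some i) :
    d = W.out hx i :=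
  (W.out_unique x hx i).unique ⟨hd, h⟩ ⟨W.out_fst hx i, W.lab_out hx i⟩

lemma eq_of_lab {d d' : G.graph.Dart} {i : Fin 3} (h : W.lab d = some i) (hl' : W.lab d' = some i)
    (hd : d.fst = d'.fst) : d = d' :=
  (W.out_unique _ (W.fst_internal hl') i).unique ⟨hd, h⟩ ⟨rfl, hl'⟩

/-! ### Sectors around a vertex -/

/-- Positions of the darts around an internal vertex, counted from the outgoing dart of color `0`. -/
lemma exists_positions [Finite V] : ∃ (p q N : ℕ) (t : G.graph.Dart → ℕ), 0 < p ∧ p < q ∧ q < N ∧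
    (∀ d, d.fst = x → t d < N ∧ (t (G.rot.next d) = t d + 1 ∨
      t (G.rot.next d) = 0 ∧ t d + 1 = N)) ∧
    t (W.out hx 0) = 0 ∧ t (W.out hx 1) = p ∧ t (W.out hx 2) = q ∧
    (∀ d, d.fst = x → W.lab d.symm = some 0 → p < t d ∧ t d < q) ∧
    (∀ d, d.fst = x → W.lab d.symm = some 1 → q < t d) ∧
    (∀ d, d.fst = x → W.lab d.symm = some 2 → 0 < t d ∧ t d < p) := by
  classical
  have hfst := W.out_fst hx
  have hlab := W.lab_out hx
  have hinj : ∀ i j, W.out hx i = W.out hx j → i = j := by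
    intro i j h
    have := hlab i
    rw [h, hlab j] at this
    exact (Option.some.inj this).symm
  set c := G.rot.next with hc
  have hex : ∀ d : G.graph.Dart, d.fst = x → ∃ k, (c ^ k) (W.out hx 0) = d := fun d hd =>
    G.rot.exists_next_pow ((hfst 0).trans hd.symm)
  -- The darts at `x` form one orbit of the rotation, so the minimal period is the degree of `x`,
  -- and every dart has a unique position below it.
  set N := Function.minimalPeriod c (W.out hx 0) with hN
  have hper : (c ^ N) (W.out hx 0) = W.out hx 0 := by
    rw [← Equiv.Perm.iterate_eq_pow]
    exact Function.iterate_minimalPeriod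
  have hNpos : 0 < N := by
    apply Function.minimalPeriod_pos_of_mem_periodicPts
    exact ((Function.Injective.mem_periodicPts c.injective) _)
  have hlt : ∀ k l, k < N → l < N → (c ^ k) (W.out hx 0) = (c ^ l) (W.out hx 0) → k = l := by
    intro k l hk hl h
    rw [← Equiv.Perm.iterate_eq_pow, ← Equiv.Perm.iterate_eq_pow] at h
    exact (Function.iterate_eq_iterate_iff_of_lt_minimalPeriod hk hl).1 h
  have hmod : ∀ k, (c ^ (k % N)) (W.out hx 0) = (c ^ k) (W.out hx 0) := by
    intro k
    rw [← Equiv.Perm.iterate_eq_pow, ← Equiv.Perm.iterate_eq_pow, Function.iterate_mod_minimalPeriod_eq]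
  let t : G.graph.Dart → ℕ := fun d => if h : ∃ k, (c ^ k) (W.out hx 0) = d then h.choose % N else 0
  have ht : ∀ d, d.fst = x → t d < N ∧ (c ^ t d) (W.out hx 0) = d := by
    intro d hd
    have h := hex d hd
    have : t d = h.choose % N := dif_pos h
    rw [this]
    exact ⟨Nat.mod_lt _ hNpos, (hmod _).trans h.choose_spec⟩
  have htu : ∀ d k, d.fst = x → k < N → (c ^ k) (W.out hx 0) = d → t d = k := by
    intro d k hd hk h
    exact hlt _ _ (ht d hd).1 hk ((ht d hd).2.trans h.symm)
  have hccw := W.out_ccw (W.out hx) (by rw [hfst]; exact hx)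
    (fun i => ⟨(hfst i).trans (hfst 0).symm, hlab i⟩)
  have t0 : t (W.out hx 0) = 0 := htu _ 0 (hfst 0) hNpos rfl
  -- a dart strictly between `a` and `b`
  have key : ∀ a d b : G.graph.Dart, a.fst = x → d.fst = x → b.fst = x → a ≠ b →
      G.rot.CcwBetween a d b →
      (t a < t b → t a < t d ∧ t d < t b) ∧ (t b = 0 → t a < t d) := by
    rintro a d b ha hd hb hab ⟨k, m, hk, hkm, hkd, hmb, hfirst⟩
    have hpow : ∀ j, (c ^ j) a = (c ^ (j + t a)) (W.out hx 0) := by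
      intro j
      rw [pow_add, Equiv.Perm.mul_apply, (ht a ha).2]
    have hNa : (c ^ N) a = a := by
      rw [hpow, add_comm, pow_add, Equiv.Perm.mul_apply, hper, (ht a ha).2]
    constructor
    · intro hlt'
      have hm : m ≤ t b - t a := by
        by_contra hcon
        refine hfirst (t b - t a) (by omega) (by omega) ?_
        rw [hpow, Nat.sub_add_cancel hlt'.le, (ht b hb).2]
      have hbN := (ht b hb).1
      have := htu d (k + t a) hd (by omega) (by rw [← hpow]; exact hkd)
      omega
    -- If the arc ends at the dart in position 0, it runs through the top of the cycle, and this end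
    -- acts as position `N`.
    · intro hb0
      have hbe : b = W.out hx 0 := by
        have := (ht b hb).2; rw [hb0] at this; exact this.symm
      have htaN := (ht a ha).1
      have hm : m ≤ N - t a := by
        by_contra hcon
        refine hfirst (N - t a) (by omega) (by omega) ?_
        rw [hpow, Nat.sub_add_cancel (by omega), hper, hbe]
      have := htu d (k + t a) hd (by omega) (by rw [← hpow]; exact hkd)
      omega
  have hpq : 0 < t (W.out hx 1) ∧ t (W.out hx 1) < t (W.out hx 2) := by
    have h2 : 0 < t (W.out hx 2) := by
      by_contra h
      have h' := (ht _ (hfst 2)).2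
      rw [show t (W.out hx 2) = 0 by omega] at h'
      have := hinj 0 2 h'
      simp at this
    have := (key _ _ _ (hfst 0) (hfst 1) (hfst 2) (fun h => by have := hinj _ _ h; simp at this)
      hccw).1 (by rw [t0]; exact h2)
    rwa [t0] at this
  refine ⟨t (W.out hx 1), t (W.out hx 2), N, t, hpq.1, hpq.2, (ht _ (hfst 2)).1, ?_, t0, rfl, rfl,
    ?_, ?_, ?_⟩
  · intro d hd
    refine ⟨(ht d hd).1, ?_⟩
    have hn : (c ^ (t d + 1)) (W.out hx 0) = c d := by
      rw [pow_succ', Equiv.Perm.mul_apply, (ht d hd).2]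
    have hd' : (c d).fst = x := (G.rot.next_fst d).trans hd
    rcases Nat.lt_or_ge (t d + 1) N with h | h
    · exact .inl (htu _ _ hd' h hn)
    · have : t d + 1 = N := by have := (ht d hd).1; omega
      refine .inr ⟨htu _ 0 hd' hNpos ?_, this⟩
      rw [← hn, this, hper]; rfl
  · intro d hd hl
    exact (key _ _ _ (hfst 1) hd (hfst 2) (fun h => by have := hinj _ _ h; simp at this)
      (W.in_sector 0 _ _ d (hd ▸ hx) ((hfst 1).trans hd.symm) ((hfst 2).trans hd.symm) (hlab 1)
        (hlab 2) hl)).1 hpq.2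
  · intro d hd hl
    exact (key _ _ _ (hfst 2) hd (hfst 0) (fun h => by have := hinj _ _ h; simp at this)
      (W.in_sector 1 _ _ d (hd ▸ hx) ((hfst 2).trans hd.symm) ((hfst 0).trans hd.symm) (hlab 2)
        (hlab 0) hl)).2 t0
  · intro d hd hl
    have := (key _ _ _ (hfst 0) hd (hfst 1) (fun h => by have := hinj _ _ h; simp at this)
      (W.in_sector 2 _ _ d (hd ▸ hx) ((hfst 0).trans hd.symm) ((hfst 1).trans hd.symm) (hlab 0)
        (hlab 1) hl)).1 (by rw [t0]; exact hpq.1)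
    rwa [t0] at this

end SchnyderWood


namespace SchnyderWood

variable {V : Type*} {G : MaximalPlaneGraph V} (W : SchnyderWood G)

/-- The dart following one that is outgoing of color `j`, or incoming of color `j + 2`, is outgoing of
color `j + 1` or incoming of color `j + 2`. -/
lemma lab_next [Finite V] {d : G.graph.Dart} {j : Fin 3} (hx : G.IsInternalVertex d.fst)
    (h : W.lab d = some j ∨ W.lab d.symm = some (j + 2)) :
    W.lab (G.rot.next d) = some (j + 1) ∨ W.lab (G.rot.next d).symm = some (j + 2) := by
  obtain ⟨p, q, N, t, hp, hpq, hq, hnext, t0, t1, t2, i0, i1, i2⟩ := W.exists_positions hx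
  have hout : ∀ e : G.graph.Dart, e.fst = d.fst → ∀ i, W.lab e = some i →
      t e = if i = 0 then 0 else if i = 1 then p else q := by
    intro e he i hi
    rw [W.eq_out hx he hi]
    fin_cases i
    · simpa using t0
    · simpa using t1
    · simpa using t2
  have hn := hnext d rfl
  have hnf := G.rot.next_fst d
  have hn' := (hnext _ hnf).1
  -- Outgoing darts sit at 0, p, q and incoming ones in the open intervals between them. Consecutive
  -- positions differ by one, up to the return to 0, so all transitions but the two claimed ones
  -- contradict the order of these numbers.
  rcases W.dart_cases_internal (d := G.rot.next d) (hnf ▸ hx) with ⟨k, hk⟩ | ⟨k, hk⟩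
  · have hke := hout _ hnf k hk
    rcases h with h | h
    · have hje := hout d rfl j h
      fin_cases j <;> fin_cases k <;> simp at hke hje hk ⊢ <;> first
        | exact .inl hk
        | (exfalso; omega)
    · fin_cases j <;> fin_cases k <;> simp at hke hk h ⊢ <;> first
        | exact .inl hk
        | (exfalso; have := i0 d rfl h; omega)
        | (exfalso; have := i1 d rfl h; omega)
        | (exfalso; have := i2 d rfl h; omega)
  · have hke : (k = 0 → p < t (G.rot.next d) ∧ t (G.rot.next d) < q) ∧
        (k = 1 → q < t (G.rot.next d)) ∧
        (k = 2 → 0 < t (G.rot.next d) ∧ t (G.rot.next d) < p) := by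
      refine ⟨?_, ?_, ?_⟩ <;> rintro rfl
      · exact i0 _ hnf hk
      · exact i1 _ hnf hk
      · exact i2 _ hnf hk
    rcases h with h | h
    · have hje := hout d rfl j h
      fin_cases j <;> fin_cases k <;> simp at hke hje hk ⊢ <;> first
        | exact .inr hk
        | (exfalso; omega)
    · fin_cases j <;> fin_cases k <;> simp at hke hk h ⊢ <;> first
        | exact .inr hk
        | (exfalso; have := i0 d rfl h; omega)
        | (exfalso; have := i1 d rfl h; omega)
        | (exfalso; have := i2 d rfl h; omega)

lemma lab_next_outer {d : G.graph.Dart} {i : Fin 3} (hd : d.fst = G.outer i)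
    (h : d ≠ (G.outerDart (i + 2)).symm) :
    W.lab (G.rot.next d).symm = some i ∨ G.rot.next d = (G.outerDart (i + 2)).symm := by
  rcases W.dart_cases_outer ((G.rot.next_fst d).trans hd) with h' | h' | h'
  · exact .inl h'
  · rw [← G.next_outerDart_symm] at h'
    exact absurd (G.rot.next.injective h') h
  · exact .inr h'

open Classical in
/-- The label of the angle between a dart and the counter-clockwise next one. In the outer face the
labels are chosen such that they grow along `facePerm`, as they do in the internal faces. -/
noncomputable def ang (d : G.graph.Dart) : Fin 3 :=
  match W.lab d with
  | some i => i + 2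
  | none => match W.lab d.symm with
    | some i => i
    | none => if h : ∃ i, d = G.outerDart i then h.choose else
        if h : ∃ i, d = (G.outerDart i).symm then h.choose + h.choose else 0

lemma ang_of_lab {d : G.graph.Dart} {i : Fin 3} (h : W.lab d = some i) : W.ang d = i + 2 := by
  simp [ang, h]

lemma ang_of_lab_symm {d : G.graph.Dart} {i : Fin 3} (h : W.lab d.symm = some i) :
    W.ang d = i := by
  have := W.lab_symm_of_lab h
  rw [SimpleGraph.Dart.symm_symm] at this
  simp [ang, h, this]

lemma lab_outerDart (i : Fin 3) : W.lab (G.outerDart i) = none :=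
  W.lab_outer _ fun h => ((G.isInternalEdge_iff _).1 h i).1 rfl

lemma lab_outerDart_symm (i : Fin 3) : W.lab (G.outerDart i).symm = none :=
  W.lab_outer _ fun h => ((G.isInternalEdge_iff _).1 h i).2 rfl

lemma outerDart_injective : Function.Injective G.outerDart := fun _ _ h =>
  G.outer_injective (congrArg (fun d : G.graph.Dart => d.fst) h)

lemma outerDart_ne_symm (i j : Fin 3) : G.outerDart i ≠ (G.outerDart j).symm := by
  intro h
  have h1 : i = j + 1 := G.outer_injective (congrArg (fun d : G.graph.Dart => d.fst) h)
  have h2 : i + 1 = j := G.outer_injective (congrArg (fun d : G.graph.Dart => d.snd) h)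
  subst h1
  fin_cases j <;> simp at h2

lemma ang_outerDart (i : Fin 3) : W.ang (G.outerDart i) = i := by
  have h : ∃ j, G.outerDart i = G.outerDart j := ⟨i, rfl⟩
  simp only [ang, lab_outerDart, lab_outerDart_symm, dif_pos h]
  exact (outerDart_injective h.choose_spec).symm

lemma ang_outerDart_symm (i : Fin 3) : W.ang (G.outerDart i).symm = i + i := by
  have h : ∃ j, (G.outerDart i).symm = (G.outerDart j).symm := ⟨i, rfl⟩
  have h' : ¬ ∃ j, (G.outerDart i).symm = G.outerDart j := fun ⟨j, hj⟩ =>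
    outerDart_ne_symm j i hj.symm
  simp only [ang, lab_outerDart, lab_outerDart_symm, dif_neg h', SimpleGraph.Dart.symm_symm]
  rw [dif_pos h]
  have := outerDart_injective (SimpleGraph.Dart.symm_involutive.injective h.choose_spec)
  rw [← this]

/-- The label of the angle on the right of a dart, read off from the dart. -/
lemma ang_eq_of_next {d : G.graph.Dart} [Finite V] :
    W.ang d = W.ang (G.rot.next d).symm + 1 := by
  have e3 (j : Fin 3) : j + 2 + 1 = j := by fin_cases j <;> rfl
  have e2 (j : Fin 3) : j + 1 + 1 = j + 2 := by fin_cases j <;> rfl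
  by_cases hx : G.IsInternalVertex d.fst
  · have hj : ∃ j, W.lab d = some j ∨ W.lab d.symm = some (j + 2) := by
      rcases W.dart_cases_internal hx with ⟨i, h⟩ | ⟨i, h⟩
      · exact ⟨i, .inl h⟩
      · exact ⟨i + 1, .inr (by rw [h]; congr 1; fin_cases i <;> rfl)⟩
    obtain ⟨j, hj⟩ := hj
    have h1 : W.ang d = j + 2 := by
      rcases hj with h | h
      · exact W.ang_of_lab h
      · exact W.ang_of_lab_symm h
    rw [h1]
    rcases W.lab_next hx hj with h | h
    · rw [W.ang_of_lab_symm (d := (G.rot.next d).symm) (by rw [SimpleGraph.Dart.symm_symm]; exact h),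
        e2]
    · rw [W.ang_of_lab h, e3]
  · obtain ⟨i, hi⟩ := G.not_isInternalVertex.1 hx
    by_cases h : d = (G.outerDart (i + 2)).symm
    -- The corner in the outer face: the doubled label makes the rule hold here too, as 2(i + 2) =
    -- 2i + 1 modulo 3.
    · rw [h, G.next_outerDart_symm, ang_outerDart_symm, ang_outerDart_symm]
      fin_cases i <;> rfl
    · have h1 : W.ang d = i := by
        rcases W.dart_cases_outer hi with h' | rfl | h'
        · exact W.ang_of_lab_symm h'
        · exact W.ang_outerDart i
        · exact absurd h' h
      rw [h1]
      rcases W.lab_next_outer hi h with h' | h'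
      · rw [W.ang_of_lab h', e3]
      · rw [h', SimpleGraph.Dart.symm_symm, ang_outerDart, e3]

/-- The local rule at the vertices becomes a rule for the faces: the length of a facial walk is a
multiple of 3, and all labels occur on it. -/
lemma ang_facePerm [Finite V] (d : G.graph.Dart) : W.ang (G.rot.facePerm d) = W.ang d + 1 := by
  rw [ang_eq_of_next, G.rot.next_facePerm, SimpleGraph.Dart.symm_symm]

/-! ### Counting darts and faces -/

lemma exists_leftFace_ang [Finite V] (f : G.rot.Face) (i : Fin 3) :
    ∃ d, G.rot.leftFace d = f ∧ W.ang d = i := by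
  obtain ⟨d, rfl⟩ := G.rot.leftFace_surjective f
  have h1 := W.ang_facePerm d
  have h2 := W.ang_facePerm (G.rot.facePerm d)
  have : i = W.ang d ∨ i = W.ang d + 1 ∨ i = W.ang d + 1 + 1 := by
    generalize W.ang d = a
    fin_cases i <;> fin_cases a <;> simp
  rcases this with h | h | h
  · exact ⟨d, rfl, h.symm⟩
  · exact ⟨_, G.rot.leftFace_facePerm d, by rw [h1, h]⟩
  · exact ⟨_, (G.rot.leftFace_facePerm _).trans (G.rot.leftFace_facePerm d), by rw [h2, h1, h]⟩

end SchnyderWood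


instance instFiniteFace {V : Type*} [Finite V] {G : SimpleGraph V} (R : RotationSystem G) :
    Finite R.Face := Finite.of_surjective _ R.leftFace_surjective

lemma card_dart_eq {V : Type*} [Finite V] (G : SimpleGraph V) :
    Nat.card G.Dart = 2 * Nat.card G.edgeSet := by
  classical
  have := Fintype.ofFinite V
  rw [Nat.card_eq_fintype_card, SimpleGraph.dart_card_eq_twice_card_edges,
    SimpleGraph.edgeFinset, Set.toFinset_card, Nat.card_eq_fintype_card]

namespace MaximalPlaneGraph

variable {V : Type*} (G : MaximalPlaneGraph V)

lemma card_eq_card_internal_add [Finite V] :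
    Nat.card V = Nat.card {x // G.IsInternalVertex x} + 3 := by
  let g : {x // G.IsInternalVertex x} ⊕ Fin 3 → V := Sum.elim (fun x => x.1) G.outer
  have hg : Function.Bijective g := by
    constructor
    · rintro (x | i) (y | j) h
      · exact congrArg _ (Subtype.ext h)
      · exact absurd h (x.2 j)
      · exact absurd h.symm (y.2 i)
      · exact congrArg _ (G.outer_injective h)
    · intro x
      by_cases hx : G.IsInternalVertex x
      · exact ⟨.inl ⟨x, hx⟩, rfl⟩
      · obtain ⟨i, rfl⟩ := G.not_isInternalVertex.1 hx
        exact ⟨.inr i, rfl⟩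
  rw [← Nat.card_congr (Equiv.ofBijective g hg), Nat.card_sum]
  simp

end MaximalPlaneGraph

namespace SchnyderWood

variable {V : Type*} {G : MaximalPlaneGraph V} (W : SchnyderWood G)

lemma isEmpty_isolated (W : SchnyderWood G) : IsEmpty {v : V // ∀ w, ¬ G.graph.Adj v w} := by
  constructor
  rintro ⟨v, hv⟩
  by_cases hx : G.IsInternalVertex v
  · have h := (W.out hx 0).adj
    have h' := W.out_fst hx 0
    exact hv _ (h' ▸ h)
  · obtain ⟨i, rfl⟩ := G.not_isInternalVertex.1 hx
    exact hv _ (G.outer_adj i)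

variable [Finite V]

/-- Three outgoing edges at each of the n - 3 internal vertices, each seen from both ends, and the
six outer darts: 6(n - 3) + 6. -/
lemma card_dart_add (W : SchnyderWood G) : Nat.card G.graph.Dart + 12 = 6 * Nat.card V := by
  let I := {x // G.IsInternalVertex x}
  let g : ((I × Fin 3) ⊕ (I × Fin 3)) ⊕ (Fin 3 ⊕ Fin 3) → G.graph.Dart :=
    Sum.elim (Sum.elim (fun p => W.out p.1.2 p.2) (fun p => (W.out p.1.2 p.2).symm))
      (Sum.elim G.outerDart fun i => (G.outerDart i).symm)
  have hout : ∀ p q : I × Fin 3, W.out p.1.2 p.2 = W.out q.1.2 q.2 → p = q := by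
    rintro ⟨⟨x, hx⟩, i⟩ ⟨⟨y, hy⟩, j⟩ h
    have h1 : x = y := by rw [← W.out_fst hx i, ← W.out_fst hy j]; exact congrArg (·.fst) h
    have h2 : some i = some j := by rw [← W.lab_out hx i, ← W.lab_out hy j]; exact congrArg _ h
    subst h1
    rw [Option.some.inj h2]
  have hsymm : ∀ (p : I × Fin 3), W.lab (W.out p.1.2 p.2).symm = none := fun p =>
    W.lab_symm_of_lab (W.lab_out p.1.2 p.2)
  have hlab : ∀ (p : I × Fin 3), W.lab (W.out p.1.2 p.2) = some p.2 := fun p => W.lab_out p.1.2 p.2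
  have hsy := (SimpleGraph.Dart.symm_involutive (G := G.graph)).injective
  have hg : Function.Bijective g := by
    constructor
    · rintro ((p | p) | (i | i)) ((q | q) | (j | j)) h <;>
        simp only [g, Sum.elim_inl, Sum.elim_inr] at h
      · rw [hout p q h]
      · have := hlab p; rw [h, hsymm q] at this; cases this
      · have := hlab p; rw [h, lab_outerDart] at this; cases this
      · have := hlab p; rw [h, lab_outerDart_symm] at this; cases this
      · have := hlab q; rw [← h, hsymm p] at this; cases this
      · rw [hout p q (hsy h)]
      · have := hlab p
        rw [← (W.out p.1.2 p.2).symm_symm, h, lab_outerDart_symm] at this; cases this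
      · have := hlab p; rw [hsy h, lab_outerDart] at this; cases this
      · have := hlab q; rw [← h, lab_outerDart] at this; cases this
      · have := hlab q
        rw [← (W.out q.1.2 q.2).symm_symm, ← h, lab_outerDart_symm] at this; cases this
      · rw [outerDart_injective h]
      · exact absurd h (outerDart_ne_symm i j)
      · have := hlab q; rw [← h, lab_outerDart_symm] at this; cases this
      · have := hlab q; rw [← hsy h, lab_outerDart] at this; cases this
      · exact absurd h.symm (outerDart_ne_symm j i)
      · rw [outerDart_injective (hsy h)]
    · intro d
      rcases W.dart_cases d with ⟨i, h⟩ | ⟨i, h⟩ | ⟨i, rfl⟩ | ⟨i, rfl⟩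
      · exact ⟨.inl (.inl (⟨_, W.fst_internal h⟩, i)), (W.eq_out (W.fst_internal h) rfl h).symm⟩
      · refine ⟨.inl (.inr (⟨_, W.fst_internal h⟩, i)), ?_⟩
        simp only [g, Sum.elim_inl, Sum.elim_inr]
        rw [← W.eq_out _ rfl h, SimpleGraph.Dart.symm_symm]
      · exact ⟨.inr (.inl i), rfl⟩
      · exact ⟨.inr (.inr i), rfl⟩
  rw [← Nat.card_congr (Equiv.ofBijective g hg), Nat.card_sum, Nat.card_sum, Nat.card_sum,
    Nat.card_prod, G.card_eq_card_internal_add]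
  simp only [Nat.card_eq_fintype_card, Fintype.card_fin]
  simp only [I]
  ring

lemma surjective_leftFace_ang :
    Function.Surjective fun d : G.graph.Dart => (G.rot.leftFace d, W.ang d) := by
  rintro ⟨f, i⟩
  obtain ⟨d, h1, h2⟩ := W.exists_leftFace_ang f i
  exact ⟨d, Prod.ext h1 h2⟩

/-- With e = 3n - 6, Euler's formula gives f = 2n - 6 + 2c for c components, whereas three labels
per face give 3f ≤ 6n - 12. This forces c = 1. -/
lemma card_component_and_face (W : SchnyderWood G) :
    Nat.card G.graph.ConnectedComponent = 1 ∧ Nat.card G.rot.Face + 4 = 2 * Nat.card V := by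
  have h1 := W.card_dart_add
  have h2 := card_dart_eq G.graph
  have h3 := Nat.card_le_card_of_surjective _ W.surjective_leftFace_ang
  rw [Nat.card_prod, Nat.card_eq_fintype_card (α := Fin 3), Fintype.card_fin] at h3
  have h4 := G.genusZero
  have := W.isEmpty_isolated
  rw [RotationSystem.GenusZero, Nat.card_of_isEmpty (α := {v : V // ∀ w, ¬ G.graph.Adj v w})] at h4
  have h5 : 0 < Nat.card G.graph.ConnectedComponent := by
    have : Nonempty G.graph.ConnectedComponent := ⟨G.graph.connectedComponentMk (G.outer 0)⟩
    exact Nat.card_pos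
  omega

lemma connected (W : SchnyderWood G) : G.graph.Connected := by
  have h := W.card_component_and_face.1
  have : Subsingleton G.graph.ConnectedComponent := (Nat.card_eq_one_iff_unique.1 h).1
  have : Nonempty V := ⟨G.outer 0⟩
  rw [SimpleGraph.connected_iff]
  refine ⟨fun u v => ?_, this⟩
  exact SimpleGraph.ConnectedComponent.exact (Subsingleton.elim _ _)

lemma card_face (W : SchnyderWood G) : Nat.card G.rot.Face + 4 = 2 * Nat.card V := W.card_component_and_face.2

/-- Equality in the count of corners: every face is a triangle with corners labelled 0, 1, 2. A dart
can therefore be identified by its left face and its label. -/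
lemma bijective_leftFace_ang :
    Function.Bijective fun d : G.graph.Dart => (G.rot.leftFace d, W.ang d) := by
  refine (Nat.bijective_iff_surjective_and_card _).2 ⟨W.surjective_leftFace_ang, ?_⟩
  rw [Nat.card_prod, Nat.card_eq_fintype_card (α := Fin 3), Fintype.card_fin]
  have h1 := W.card_dart_add
  have h2 := W.card_face
  omega

lemma dart_eq_of_leftFace_of_ang {d d' : G.graph.Dart} (h : G.rot.leftFace d = G.rot.leftFace d')
    (ha' : W.ang d = W.ang d') : d = d' :=
  W.bijective_leftFace_ang.1 (Prod.ext h ha')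

/-- The dart with angle label `i` in the face `f`. -/
noncomputable def corner (f : G.rot.Face) (i : Fin 3) : G.graph.Dart :=
  (W.exists_leftFace_ang f i).choose

lemma leftFace_corner (f : G.rot.Face) (i : Fin 3) : G.rot.leftFace (W.corner f i) = f :=
  (W.exists_leftFace_ang f i).choose_spec.1

lemma ang_corner (f : G.rot.Face) (i : Fin 3) : W.ang (W.corner f i) = i :=
  (W.exists_leftFace_ang f i).choose_spec.2

lemma corner_eq {d : G.graph.Dart} {f : G.rot.Face} {i : Fin 3} (h : G.rot.leftFace d = f)
    (h' : W.ang d = i) : W.corner f i = d :=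
  W.dart_eq_of_leftFace_of_ang ((W.leftFace_corner f i).trans h.symm)
    ((W.ang_corner f i).trans h'.symm)

lemma leftFace_eq_outerFace_iff (W : SchnyderWood G) {d : G.graph.Dart} :
    G.rot.leftFace d = G.outerFace ↔ ∃ i, d = (G.outerDart i).symm := by
  constructor
  -- A dart of the outer face with label a must be the reversed outer dart number 2a, whose label is
  -- 4a = a modulo 3.
  · intro h
    refine ⟨W.ang d + W.ang d, W.dart_eq_of_leftFace_of_ang ?_ ?_⟩
    · rw [h, G.leftFace_outerDart_symm]
    · rw [ang_outerDart_symm]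
      generalize W.ang d = a
      fin_cases a <;> rfl
  · rintro ⟨i, rfl⟩
    exact G.leftFace_outerDart_symm i

/-- A function on the faces that does not change across edges is constant. -/
lemma face_const (W : SchnyderWood G) {α : Type*} (χ : G.rot.Face → α)
    (h : ∀ d, χ (G.rot.leftFace d) = χ (G.rot.leftFace d.symm)) (f g : G.rot.Face) : χ f = χ g := by
  -- Rotating about a vertex joins all faces at this vertex; walking in the connected graph then
  -- joins all faces.
  have hv : ∀ d d' : G.graph.Dart, d.fst = d'.fst →
      χ (G.rot.leftFace d) = χ (G.rot.leftFace d') := by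
    intro d d' hd
    obtain ⟨k, rfl⟩ := G.rot.exists_next_pow hd
    clear hd
    induction k with
    | zero => rfl
    | succ k ih =>
      rw [ih, pow_succ', Equiv.Perm.mul_apply, h (G.rot.next _), G.rot.leftFace_symm_next]
  have hw : ∀ (u v : V) (p : G.graph.Walk u v) (d d' : G.graph.Dart), d.fst = u → d'.fst = v →
      χ (G.rot.leftFace d) = χ (G.rot.leftFace d') := by
    intro u v p
    induction p with
    | nil => intro d d' h1 h2; exact hv _ _ (h1.trans h2.symm)
    | @cons u v w huv p ih =>
      intro d d' h1 h2
      let e : G.graph.Dart := ⟨(u, v), huv⟩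
      rw [hv d e h1, h e]
      exact ih _ _ rfl h2
  obtain ⟨d, rfl⟩ := G.rot.leftFace_surjective f
  obtain ⟨d', rfl⟩ := G.rot.leftFace_surjective g
  obtain ⟨p⟩ := W.connected.preconnected d.fst d'.fst
  exact hw _ _ p d d' rfl rfl

end SchnyderWood

/-! ### Chains -/

section Homology

variable {V : Type*} [Finite V] {G : SimpleGraph V} (R : RotationSystem G)

/-- In a connected plane graph, a divergence-free flow is the boundary of a function on the faces. -/
lemma RotationSystem.exists_potential [Fintype G.Dart]
    (hV : ∀ (g : V → ℚ), (∀ d : G.Dart, g d.snd = g d.fst) → ∀ u v, g u = g v)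
    (hF : ∀ (χ : R.Face → ℚ), (∀ d, χ (R.leftFace d) = χ (R.leftFace d.symm)) →
      ∀ f g, χ f = χ g)
    (v₀ : V) (f₀ : R.Face)
    (euler : Nat.card V + Nat.card R.Face = Nat.card G.edgeSet + 2)
    (z : G.Dart → ℚ) (hz : ∀ d, z d.symm = - z d)
    (hdiv : ∀ g : V → ℚ, ∑ d, g d.fst * z d = 0) :
    ∃ χ : R.Face → ℚ, χ f₀ = 0 ∧ ∀ d, z d = χ (R.leftFace d) - χ (R.leftFace d.symm) := by
  classical
  have := Fintype.ofFinite V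
  have := Fintype.ofFinite R.Face
  have := Fintype.ofFinite G.edgeSet
  have hsymm : ∀ F : G.Dart → ℚ, ∑ d : G.Dart, F d.symm = ∑ d, F d := fun F =>
    Equiv.sum_comp (SimpleGraph.Dart.symm_involutive (G := G)).toPerm F
  -- gradients are orthogonal to divergence-free flows
  have horth : ∀ (g : V → ℚ) (y : G.Dart → ℚ), (∀ d, y d.symm = - y d) →
      (∀ g : V → ℚ, ∑ d, g d.fst * y d = 0) → ∑ d : G.Dart, (g d.snd - g d.fst) * y d = 0 := by
    intro g y hy hy'
    have h1 : ∑ d : G.Dart, g d.snd * y d = - ∑ d : G.Dart, g d.fst * y d := by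
      rw [← hsymm, ← Finset.sum_neg_distrib]
      refine Finset.sum_congr rfl fun d _ => ?_
      rw [hy]
      simp
    simp only [sub_mul, Finset.sum_sub_distrib, h1, hy', neg_zero, sub_zero]
  have hbd : ∀ (χ : R.Face → ℚ) (g : V → ℚ),
      ∑ d : G.Dart, g d.fst * (χ (R.leftFace d) - χ (R.leftFace d.symm)) = 0 := by
    intro χ g
    simp only [mul_sub, Finset.sum_sub_distrib]
    rw [sub_eq_zero, ← Equiv.sum_comp R.next (fun d => g d.fst * χ (R.leftFace d.symm))]
    refine Finset.sum_congr rfl fun d _ => ?_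
    rw [R.next_fst, R.leftFace_symm_next]
  -- Gradients, jumps of face functions, and symmetric functions on darts. The domain has dimension
  -- v + f + e = 2e + 2 and the target has dimension 2e. So `L` is onto as soon as its kernel has
  -- dimension at most 2, which corresponds to the additive constants of the first two parts.
  let L : ((V → ℚ) × (R.Face → ℚ) × (G.edgeSet → ℚ)) →ₗ[ℚ] (G.Dart → ℚ) :=
    { toFun := fun a d => (a.1 d.snd - a.1 d.fst) +
        (a.2.1 (R.leftFace d) - a.2.1 (R.leftFace d.symm)) + a.2.2 ⟨d.edge, d.edge_mem⟩
      map_add' := by intro a b; ext d; simp; ring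
      map_smul' := by intro c a; ext d; simp; ring }
  have hL : ∀ g χ s d, L (g, χ, s) d = (g d.snd - g d.fst) +
        (χ (R.leftFace d) - χ (R.leftFace d.symm)) + s ⟨d.edge, d.edge_mem⟩ := fun _ _ _ _ => rfl
  have hLs : ∀ g χ s d, L (g, χ, s) d.symm = - (g d.snd - g d.fst) -
        (χ (R.leftFace d) - χ (R.leftFace d.symm)) + s ⟨d.edge, d.edge_mem⟩ := by
    intro g χ s d
    rw [hL]
    simp only [SimpleGraph.Dart.symm_symm, SimpleGraph.Dart.edge_symm]
    simp
    ring
  -- A gradient without divergence is orthogonal to itself, hence zero; rational coefficients give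
  -- definiteness.
  have hzero : ∀ (g : V → ℚ) (y : G.Dart → ℚ), (∀ d, y d = (g d.snd - g d.fst)) →
      (∀ d, y d.symm = - y d) → (∀ g : V → ℚ, ∑ d, g d.fst * y d = 0) → ∀ d, y d = 0 := by
    intro g y hy hys hyd d
    have h := horth g y hys hyd
    simp only [← hy] at h
    have := (Finset.sum_eq_zero_iff_of_nonneg (fun d _ => mul_self_nonneg (y d))).1 h d
      (Finset.mem_univ d)
    exact mul_self_eq_zero.1 this
  have hker : Module.finrank ℚ (LinearMap.ker L) ≤ 2 := by
    let E : LinearMap.ker L →ₗ[ℚ] ℚ × ℚ :=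
      { toFun := fun a => (a.1.1 v₀, a.1.2.1 f₀)
        map_add' := by intro a b; rfl
        map_smul' := by intro a b; rfl }
    have hE : Function.Injective E := by
      rw [← LinearMap.ker_eq_bot, LinearMap.ker_eq_bot']
      rintro ⟨⟨g, χ, s⟩, ha⟩ h0
      have ha' : ∀ d, L (g, χ, s) d = 0 := fun d => congrFun (LinearMap.mem_ker.1 ha) d
      -- The first two parts are antisymmetric under reversal, so adding the equations for `d` and
      -- `d.symm` isolates the symmetric part.
      have hs : ∀ d : G.Dart, s ⟨d.edge, d.edge_mem⟩ = 0 := by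
        intro d
        have h1 := ha' d
        have h2 := ha' d.symm
        rw [hL] at h1; rw [hLs] at h2
        linarith
      have hgχ : ∀ d : G.Dart, -(χ (R.leftFace d) - χ (R.leftFace d.symm)) = g d.snd - g d.fst := by
        intro d
        have h1 := ha' d
        rw [hL, hs] at h1
        linarith
      have hy := hzero g (fun d => -(χ (R.leftFace d) - χ (R.leftFace d.symm))) hgχ
        (by intro d; simp) (by
          intro g'
          have := hbd χ g'
          simp only [mul_neg, Finset.sum_neg_distrib, this, neg_zero])
      have hχ := hF χ (fun d => by linarith [hy d])
      have hg := hV g (fun d => by linarith [hy d, hgχ d])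
      have h0' : g v₀ = 0 ∧ χ f₀ = 0 := Prod.mk_inj.1 h0
      ext1
      simp only [ZeroMemClass.coe_zero, Prod.mk_eq_zero]
      refine ⟨funext fun v => (hg v v₀).trans h0'.1, funext fun f => (hχ f f₀).trans h0'.2, ?_⟩
      funext e
      obtain ⟨e, he⟩ := e
      induction e with
      | h a b => exact hs ⟨(a, b), he⟩
    have := LinearMap.finrank_le_finrank_of_injective hE
    simpa using this
  have hsurj : Function.Surjective L := by
    rw [← LinearMap.range_eq_top]
    apply Submodule.eq_top_of_finrank_eq
    have h1 := L.finrank_range_add_finrank_ker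
    have h2 : Module.finrank ℚ ((V → ℚ) × (R.Face → ℚ) × (G.edgeSet → ℚ)) =
        Nat.card V + (Nat.card R.Face + Nat.card G.edgeSet) := by
      rw [Module.finrank_prod, Module.finrank_prod]
      simp [Nat.card_eq_fintype_card]
    have h3 : Module.finrank ℚ (G.Dart → ℚ) = 2 * Nat.card G.edgeSet := by
      rw [← card_dart_eq]
      simp [Nat.card_eq_fintype_card]
    have h4 := (LinearMap.range L).finrank_le
    omega
  obtain ⟨⟨g, χ, s⟩, ha⟩ := hsurj z
  have ha' : ∀ d, L (g, χ, s) d = z d := fun d => congrFun ha d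
  have hs : ∀ d : G.Dart, s ⟨d.edge, d.edge_mem⟩ = 0 := by
    intro d
    have h1 := ha' d
    have h2 := ha' d.symm
    rw [hz] at h2
    rw [hL] at h1; rw [hLs] at h2
    linarith
  -- What remains of `z` after subtracting its jump part is both a gradient and divergence-free.
  have hy := hzero g (fun d => z d - (χ (R.leftFace d) - χ (R.leftFace d.symm)))
    (by intro d; have := ha' d; rw [hL, hs] at this; linarith)
    (by intro d; simp only [hz, SimpleGraph.Dart.symm_symm]; ring) (by
      intro g'
      have := hbd χ g'
      simp only [mul_sub _ (z _), Finset.sum_sub_distrib, this, hdiv, sub_zero])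
  exact ⟨fun f => χ f - χ f₀, sub_self _, fun d => by linarith [hy d]⟩

end Homology


/-- Along a counter-clockwise arc from the dart `a` to the dart `b`, with interior darts `I`, a
function that grows from dart to dart is bounded by its values at the ends of the arc. -/
lemma RotationSystem.arc_mono {V : Type*} [Finite V] {G : SimpleGraph V} (R : RotationSystem G)
    {a b : G.Dart} (hab : a.fst = b.fst) (I : G.Dart → Prop) (hb : ¬ (b = a ∨ I b))
    (hstep : ∀ d, d.fst = a.fst → (d = a ∨ I d) → R.next d = b ∨ I (R.next d))
    (hprev : ∀ d, d.fst = a.fst → I (R.next d) → d = a ∨ I d)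
    (h : G.Dart → ℚ) (hm : ∀ d, d.fst = a.fst → I d → h (R.next.symm d) ≤ h d)
    {d : G.Dart} (hd : d.fst = a.fst) (hI : d = a ∨ I d) :
    h a ≤ h d ∧ h d ≤ h (R.next.symm b) := by
  constructor
  · have key : ∀ k d, (d = a ∨ I d) → (R.next ^ k) a = d → h a ≤ h d := by
      intro k
      induction k with
      | zero => rintro d - rfl; exact le_rfl
      | succ k ih =>
        rintro d hI rfl
        rw [pow_succ', Equiv.Perm.mul_apply] at hI ⊢
        rcases hI with hI | hI
        · rw [hI]
        · have hf := R.next_pow_fst k a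
          refine (ih _ (hprev _ hf hI) rfl).trans ?_
          simpa using hm _ ((R.next_fst _).trans hf) hI
    obtain ⟨k, hk⟩ := R.exists_next_pow hd.symm
    exact key k d hI hk
  · have key : ∀ k d, d.fst = a.fst → (d = a ∨ I d) → (R.next ^ k) d = b →
        h d ≤ h (R.next.symm b) := by
      intro k
      induction k with
      | zero => rintro d - hI rfl; exact absurd hI hb
      | succ k ih =>
        intro d hd hI hk
        rcases hstep d hd hI with hn | hn
        · rw [← hn, Equiv.symm_apply_apply]
        · have hf := (R.next_fst d).trans hd
          refine le_trans ?_ (ih (R.next d) hf (.inr hn) ?_)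
          · simpa using hm _ hf hn
          · rw [← hk, pow_succ, Equiv.Perm.mul_apply]
    obtain ⟨k, hk⟩ := R.exists_next_pow (hd.trans hab)
    exact key k d hd hI hk

/-! ### Walks along prescribed darts and the flows that they carry -/

section Walks

variable {V : Type*} {G : SimpleGraph V}

/-- There is a dart in `E` from `x` to `y`. -/
def Via (E : G.Dart → Prop) (x y : V) : Prop := ∃ d, E d ∧ d.fst = x ∧ d.snd = y

lemma exists_walk_of_reflTransGen {E : G.Dart → Prop} {u v : V}
    (h : Relation.ReflTransGen (Via E) u v) : ∃ p : G.Walk u v, ∀ d ∈ p.darts, E d := by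
  induction h using Relation.ReflTransGen.head_induction_on with
  | refl => exact ⟨.nil, by simp⟩
  | head h _ ih =>
    obtain ⟨d, hd, rfl, rfl⟩ := h
    obtain ⟨p, hp⟩ := ih
    refine ⟨.cons d.adj p, ?_⟩
    simp only [SimpleGraph.Walk.darts_cons, List.mem_cons]
    rintro e (rfl | he)
    · exact hd
    · exact hp e he

lemma exists_closed_walk_of_transGen {E : G.Dart → Prop} {u : V}
    (h : Relation.TransGen (Via E) u u) :
    ∃ p : G.Walk u u, p.darts ≠ [] ∧ ∀ d ∈ p.darts, E d := by
  obtain ⟨v, ⟨d, hd, rfl, rfl⟩, h⟩ := Relation.TransGen.head'_iff.1 h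
  obtain ⟨p, hp⟩ := exists_walk_of_reflTransGen h
  refine ⟨.cons d.adj p, by simp, ?_⟩
  simp only [SimpleGraph.Walk.darts_cons, List.mem_cons]
  rintro e (rfl | he)
  · exact hd
  · exact hp e he

lemma wellFounded_of_irrefl [Finite V] {r : V → V → Prop} (h : ∀ x, ¬ Relation.TransGen r x x) :
    WellFounded fun x y => r y x := by
  have : Std.Irrefl (fun x y => Relation.TransGen r y x) := ⟨h⟩
  have : IsTrans V (fun x y => Relation.TransGen r y x) := ⟨fun _ _ _ h1 h2 => h2.trans h1⟩
  exact Subrelation.wf (fun h => Relation.TransGen.single h)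
    (Finite.wellFounded_of_trans_of_irrefl (fun x y => Relation.TransGen r y x))

/-- If one can leave every vertex of `S` along a dart of `E` without leaving `S`, then there is a
cycle. -/
lemma exists_closed_walk [Finite V] {E : G.Dart → Prop} {S : V → Prop} {x : V} (hx : S x)
    (h : ∀ x, S x → ∃ d, E d ∧ d.fst = x ∧ S d.snd) :
    ∃ (y : V) (p : G.Walk y y), p.darts ≠ [] ∧ ∀ d ∈ p.darts, E d ∧ S d.fst := by
  by_contra hcon
  have hirr : ∀ y, ¬ Relation.TransGen (Via fun d : G.Dart => E d ∧ S d.fst) y y := fun y hy =>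
    hcon ⟨y, exists_closed_walk_of_transGen hy⟩
  -- Without cycles the relation would be well-founded on the finite vertex set; a last vertex of
  -- `S` contradicts the possibility to go on.
  obtain ⟨y, hy, hmin⟩ := (wellFounded_of_irrefl hirr).has_min {y | S y} ⟨x, hx⟩
  obtain ⟨d, hd, rfl, hd'⟩ := h y hy
  exact hmin _ hd' ⟨d, ⟨hd, hy⟩, rfl, rfl⟩

open Classical in
/-- The flow along a walk. -/
noncomputable def chain {u v : V} (p : G.Walk u v) (d : G.Dart) : ℚ :=
  p.darts.count d - p.darts.count d.symm

lemma chain_symm {u v : V} (p : G.Walk u v) (d : G.Dart) : chain p d.symm = - chain p d := by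
  simp [chain]

lemma chain_eq_zero {u v : V} {p : G.Walk u v} {d : G.Dart} (h : d ∉ p.darts)
    (h' : d.symm ∉ p.darts) : chain p d = 0 := by
  classical
  simp [chain, List.count_eq_zero_of_not_mem h, List.count_eq_zero_of_not_mem h']

lemma chain_nonneg {u v : V} {p : G.Walk u v} {d : G.Dart} (h' : d.symm ∉ p.darts) :
    0 ≤ chain p d := by
  classical
  simp [chain, List.count_eq_zero_of_not_mem h']

lemma one_le_chain {u v : V} {p : G.Walk u v} {d : G.Dart} (h : d ∈ p.darts)
    (h' : d.symm ∉ p.darts) : 1 ≤ chain p d := by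
  classical
  simp only [chain, List.count_eq_zero_of_not_mem h', Nat.cast_zero, sub_zero]
  exact_mod_cast List.count_pos_iff.2 h

lemma sum_chain [Fintype G.Dart] {u v : V} (p : G.Walk u v) (g : V → ℚ) :
    ∑ d, g d.fst * chain p d = g u - g v := by
  classical
  induction p with
  | nil => simp [chain]
  | @cons a b c hab p ih =>
    let e : G.Dart := ⟨(a, b), hab⟩
    have hc : ∀ d, chain (.cons hab p) d =
        chain p d + ((if d = e then 1 else 0) - if d = e.symm then 1 else 0) := by
      intro d
      have h1 : (d.symm = e) ↔ (d = e.symm) := by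
        constructor
        · intro h; rw [← h, SimpleGraph.Dart.symm_symm]
        · rintro rfl; simp
      simp only [chain, SimpleGraph.Walk.darts_cons, List.count_cons]
      have e1 : (if ((⟨(a, b), hab⟩ : G.Dart) == d) = true then 1 else 0) =
          if d = e then 1 else 0 := by
        simp only [beq_iff_eq, eq_comm (a := d), e]
      have e2 : (if ((⟨(a, b), hab⟩ : G.Dart) == d.symm) = true then 1 else 0) =
          if d = e.symm then 1 else 0 := by
        simp only [beq_iff_eq, eq_comm (b := d.symm), ← h1, e]
      rw [e1, e2]
      push_cast
      ring
    simp only [hc, mul_add, mul_sub, Finset.sum_add_distrib, Finset.sum_sub_distrib, ih]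
    simp only [mul_ite, mul_one, mul_zero, Finset.sum_ite_eq', Finset.mem_univ, if_true]
    simp [e]

end Walks

/-! ### Face functions that are monotone around a vertex -/

namespace SchnyderWood

variable {V : Type*} {G : MaximalPlaneGraph V} (W : SchnyderWood G)

lemma lab_eq_of_ang {d : G.graph.Dart} (hx : G.IsInternalVertex d.fst) {j : Fin 3}
    (h : W.ang d = j + 2) : W.lab d = some j ∨ W.lab d.symm = some (j + 2) := by
  rcases W.dart_cases_internal hx with ⟨i, hi⟩ | ⟨i, hi⟩
  · rw [W.ang_of_lab hi, add_left_inj] at h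
    exact .inl (h ▸ hi)
  · rw [W.ang_of_lab_symm hi] at h
    exact .inr (h ▸ hi)

variable [Finite V]

lemma exists_potential (W : SchnyderWood G) [Fintype G.graph.Dart] (z : G.graph.Dart → ℚ)
    (hz : ∀ d, z d.symm = - z d) (hdiv : ∀ g : V → ℚ, ∑ d, g d.fst * z d = 0) :
    ∃ χ : G.rot.Face → ℚ, χ G.outerFace = 0 ∧
      ∀ d, z d = χ (G.rot.leftFace d) - χ (G.rot.leftFace d.symm) := by
  refine G.rot.exists_potential ?_ (fun χ h => W.face_const χ h) (G.outer 0) G.outerFace ?_ z hz hdiv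
  · intro g hg u v
    obtain ⟨p⟩ := W.connected.preconnected u v
    induction p with
    | nil => rfl
    | cons h p ih => rw [← ih]; exact (hg ⟨(_, _), h⟩).symm
  · have h1 := W.card_dart_add
    have h2 := card_dart_eq G.graph
    have h3 := W.card_face
    omega

/-- This is `arc_mono` for the sector from the outgoing dart of color j to that of color j + 1: its
corners are those labelled j + 2, and its interior darts are the incoming ones of color j + 2. -/
lemma sector_mono {x : V} (hx : G.IsInternalVertex x) (j : Fin 3) (h : G.graph.Dart → ℚ)
    (hm : ∀ d, d.fst = x → W.lab d.symm = some (j + 2) → h (G.rot.next.symm d) ≤ h d)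
    {d : G.graph.Dart} (hd : d.fst = x) (ha : W.ang d = j + 2) :
    h (W.out hx j) ≤ h d ∧ h d ≤ h (G.rot.next.symm (W.out hx (j + 1))) := by
  have hf := W.out_fst hx
  refine G.rot.arc_mono ((hf j).trans (hf (j + 1)).symm) (fun d => W.lab d.symm = some (j + 2))
    ?_ ?_ ?_ h ?_ (hd.trans (hf j).symm) ?_
  · rintro (h' | h')
    · have := W.lab_out hx (j + 1)
      rw [h', W.lab_out] at this
      revert this
      fin_cases j <;> simp
    · simp [W.lab_symm_of_lab (W.lab_out hx (j + 1))] at h'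
  · intro d hd hI
    rw [hf] at hd
    have hx' : G.IsInternalVertex d.fst := hd ▸ hx
    rcases W.lab_next hx' (hI.imp (fun h => by rw [h, lab_out]) id) with h' | h'
    · exact .inl (W.eq_out hx ((G.rot.next_fst d).trans hd) h')
    · exact .inr h'
  · intro d hd hI
    rw [hf] at hd
    have hx' : G.IsInternalVertex d.fst := hd ▸ hx
    have hs : ∃ i, W.lab d = some i ∨ W.lab d.symm = some (i + 2) := by
      rcases W.dart_cases_internal hx' with ⟨i, h⟩ | ⟨i, h⟩
      · exact ⟨i, .inl h⟩
      · exact ⟨i + 1, .inr (by rw [h]; congr 1; fin_cases i <;> rfl)⟩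
    obtain ⟨i, hi⟩ := hs
    have : i = j := by
      rcases W.lab_next hx' hi with h' | h'
      · rw [W.lab_symm_of_lab h'] at hI; cases hI
      · rw [hI] at h'
        exact (add_right_cancel (Option.some.inj h')).symm
    subst this
    exact hi.imp (fun h => W.eq_out hx hd h) id
  · intro d hd hI
    exact hm d (hd.trans (hf j)) hI
  · exact (W.lab_eq_of_ang (hd ▸ hx) ha).imp (fun h => W.eq_out hx hd h) id

/-- The analogue at an outer vertex, whose single sector is the whole rotation cut open at the outer
face. -/
lemma outer_sector_mono (W : SchnyderWood G) (j : Fin 3) (h : G.graph.Dart → ℚ)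
    (hm : ∀ d, d.fst = G.outer j → W.lab d.symm = some j → h (G.rot.next.symm d) ≤ h d)
    {d : G.graph.Dart} (hd : d.fst = G.outer j) (hd' : d ≠ (G.outerDart (j + 2)).symm) :
    h (G.outerDart j) ≤ h d ∧ h d ≤ h (G.rot.next.symm (G.outerDart (j + 2)).symm) := by
  have e3 : j + 2 + 1 = j := by fin_cases j <;> rfl
  refine G.rot.arc_mono ?_ (fun d => W.lab d.symm = some j) ?_ ?_ ?_ h hm hd ?_
  · change G.outer j = G.outer (j + 2 + 1)
    rw [e3]
  · rintro (h' | h')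
    · exact outerDart_ne_symm _ _ h'.symm
    · rw [SimpleGraph.Dart.symm_symm, lab_outerDart] at h'; cases h'
  · intro d hd hI
    refine (W.lab_next_outer hd ?_).symm
    rintro rfl
    rcases hI with hI | hI
    · exact outerDart_ne_symm _ _ hI.symm
    · rw [SimpleGraph.Dart.symm_symm, lab_outerDart] at hI; cases hI
  · intro d hd hI
    rcases W.dart_cases_outer hd with h' | h' | h'
    · exact .inr h'
    · exact .inl h'
    · rw [h', G.next_outerDart_symm, lab_outerDart_symm] at hI; cases hI
  · rcases W.dart_cases_outer hd with h' | h' | h'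
    · exact .inr h'
    · exact .inl h'
    · exact absurd h' hd'

/-! ### Acyclicity -/

/-- The darts that are directed with color `i`, or against their direction with another color. -/
def Ascends (i : Fin 3) (d : G.graph.Dart) : Prop :=
  W.lab d = some i ∨ W.lab d.symm = some (i + 1) ∨ W.lab d.symm = some (i + 2)

/-- A function on the faces that grows across all ascending darts of color `i`, from right to left,
and does not change across outer edges. -/
structure IsAscending (i : Fin 3) (χ : G.rot.Face → ℚ) : Prop where
  le : ∀ d, W.Ascends i d → χ (G.rot.leftFace d.symm) ≤ χ (G.rot.leftFace d)
  outer : ∀ j, χ (G.rot.leftFace (G.outerDart j)) = χ G.outerFace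

variable {W} in
-- Turning counter-clockwise from just after the outgoing dart of color i + 2 to just before that of
-- color i + 1, all darts passed are ascending, so χ grows; on the rest of the turn all darts are
-- descending. The maximum and the minimum around the vertex are thus located at these two darts.
lemma IsAscending.le_right_out {i : Fin 3} {χ : G.rot.Face → ℚ} (h : W.IsAscending i χ) {x : V}
    (hx : G.IsInternalVertex x) {d : G.graph.Dart} (hd : d.fst = x) :
    χ (G.rot.leftFace d) ≤ χ (G.rot.leftFace (W.out hx (i + 1)).symm) ∧
      χ (G.rot.leftFace (W.out hx (i + 2))) ≤ χ (G.rot.leftFace d) := by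
  have e1 : i + 2 + 1 = i := by fin_cases i <;> rfl
  have e2 : i + 2 + 2 = i + 1 := by fin_cases i <;> rfl
  have e3 : i + 1 + 2 = i := by fin_cases i <;> rfl
  have e4 : i + 1 + 1 = i + 2 := by fin_cases i <;> rfl
  set H : G.graph.Dart → ℚ := fun d => χ (G.rot.leftFace d) with hH
  have hprev : ∀ d, H (G.rot.next.symm d) = χ (G.rot.leftFace d.symm) := fun d => by
    simp only [hH, G.rot.leftFace_next_symm]
  have s1 := fun {d} => W.sector_mono hx (i + 2) H (d := d) (by
    intro d _ hl
    rw [hprev]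
    exact h.le d (.inr (.inl (by rw [hl, e2]))))
  have s2 := fun {d} => W.sector_mono hx i H (d := d) (by
    intro d _ hl
    rw [hprev]
    exact h.le d (.inr (.inr hl)))
  have s3 := fun {d} => W.sector_mono hx (i + 1) (fun d => - H d) (d := d) (by
    intro d _ hl
    rw [hprev, neg_le_neg_iff]
    have := h.le d.symm (.inl (by rw [hl, e3]))
    rwa [SimpleGraph.Dart.symm_symm] at this)
  rw [e1, e2] at s1
  rw [e3, e4] at s3
  have f := W.out_fst hx
  have a0 : W.ang (W.out hx i) = i + 2 := W.ang_of_lab (W.lab_out hx i)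
  have a1 : W.ang (W.out hx (i + 1)) = i := (W.ang_of_lab (W.lab_out hx _)).trans e3
  have a2 : W.ang (W.out hx (i + 2)) = i + 1 := (W.ang_of_lab (W.lab_out hx _)).trans e2
  have b0 : H (G.rot.next.symm (W.out hx i)) ≤ H (W.out hx i) := by
    rw [hprev]; exact h.le _ (.inl (W.lab_out hx i))
  have b1 : H (W.out hx (i + 1)) ≤ H (G.rot.next.symm (W.out hx (i + 1))) := by
    rw [hprev]
    have := h.le (W.out hx (i + 1)).symm (.inr (.inl (by
      rw [SimpleGraph.Dart.symm_symm, W.lab_out])))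
    rwa [SimpleGraph.Dart.symm_symm] at this
  have b2 : H (W.out hx (i + 2)) ≤ H (G.rot.next.symm (W.out hx (i + 2))) := by
    rw [hprev]
    have := h.le (W.out hx (i + 2)).symm (.inr (.inr (by
      rw [SimpleGraph.Dart.symm_symm, W.lab_out])))
    rwa [SimpleGraph.Dart.symm_symm] at this
  rw [← hprev]
  change H d ≤ _ ∧ _ ≤ H d
  have c1 := s1 (f (i + 2)) a2
  have c2 := s2 (f i) a0
  have c3 := s3 (f (i + 1)) a1
  have hang : W.ang d = i + 1 ∨ W.ang d = i + 2 ∨ W.ang d = i := by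
    generalize W.ang d = a
    fin_cases a <;> fin_cases i <;> simp
  rcases hang with ha | ha | ha
  · have := s1 hd ha
    constructor <;> linarith
  · have := s2 hd ha
    constructor <;> linarith
  · have := s3 hd ha
    constructor <;> linarith

variable {W} in
-- All internal darts at an outer vertex are incoming of one color, so χ is monotone along the
-- sector. It has the same value at both ends, next to outer edges, and is therefore constant.
lemma IsAscending.eq_outer {i : Fin 3} {χ : G.rot.Face → ℚ} (h : W.IsAscending i χ) {j : Fin 3}
    {d : G.graph.Dart} (hd : d.fst = G.outer j) : χ (G.rot.leftFace d) = χ G.outerFace := by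
  by_cases hd' : d = (G.outerDart (j + 2)).symm
  · rw [hd', G.leftFace_outerDart_symm]
  have h1 := h.outer j
  have h2 := h.outer (j + 2)
  by_cases hj : j = i
  · have := W.outer_sector_mono j (fun d => - χ (G.rot.leftFace d)) (by
      intro d _ hl
      rw [G.rot.leftFace_next_symm, neg_le_neg_iff]
      have := h.le d.symm (.inl (by rw [hl, hj]))
      rwa [SimpleGraph.Dart.symm_symm] at this) hd hd'
    rw [G.rot.leftFace_next_symm, SimpleGraph.Dart.symm_symm] at this
    linarith
  · have := W.outer_sector_mono j (fun d => χ (G.rot.leftFace d)) (by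
      intro d _ hl
      rw [G.rot.leftFace_next_symm]
      refine h.le d (.inr ?_)
      rw [hl]
      revert hj
      fin_cases i <;> fin_cases j <;> simp) hd hd'
    rw [G.rot.leftFace_next_symm, SimpleGraph.Dart.symm_symm] at this
    linarith

variable {W} in
-- At a vertex of a face with maximal χ, the face on the right of the outgoing edge of color i + 1
-- is again maximal, and it also touches the head of this edge. As the maximum is positive, no outer
-- vertex is ever reached, and following this color must run into a cycle.
lemma IsAscending.exists_cycle_of_pos {i : Fin 3} {χ : G.rot.Face → ℚ} (h : W.IsAscending i χ)
    (h0 : χ G.outerFace = 0) {f : G.rot.Face} (hf : 0 < χ f) :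
    ∃ (y : V) (p : G.graph.Walk y y), p.darts ≠ [] ∧
      ∀ d ∈ p.darts, W.lab d = some (i + 1) ∧ 0 < χ (G.rot.leftFace d.symm) := by
  have : Nonempty G.rot.Face := ⟨f⟩
  obtain ⟨g, hg⟩ := Finite.exists_max χ
  have hgpos := hf.trans_le (hg f)
  obtain ⟨d₀, rfl⟩ := G.rot.leftFace_surjective g
  have hint : ∀ d : G.graph.Dart, χ (G.rot.leftFace d) = χ (G.rot.leftFace d₀) →
      G.IsInternalVertex d.fst := by
    intro d hd j hj
    rw [h.eq_outer hj, h0] at hd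
    linarith
  have hout : ∀ d : G.graph.Dart, χ (G.rot.leftFace d) = χ (G.rot.leftFace d₀) → ∀ hx,
      χ (G.rot.leftFace (W.out (x := d.fst) hx (i + 1)).symm) = χ (G.rot.leftFace d₀) :=
    fun d hd hx => le_antisymm (hg _) (hd ▸ (h.le_right_out hx rfl).1)
  obtain ⟨y, p, hp, hp'⟩ := exists_closed_walk
    (E := fun d => W.lab d = some (i + 1) ∧ 0 < χ (G.rot.leftFace d.symm))
    (S := fun x => ∃ d : G.graph.Dart, d.fst = x ∧ χ (G.rot.leftFace d) = χ (G.rot.leftFace d₀))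
    (x := d₀.fst) ⟨d₀, rfl, rfl⟩ (by
      rintro x ⟨d, rfl, hd⟩
      have hx := hint d hd
      have := hout d hd hx
      exact ⟨W.out hx (i + 1), ⟨W.lab_out hx _, by rw [this]; exact hgpos⟩, W.out_fst hx _,
        ⟨_, rfl, this⟩⟩)
  exact ⟨y, p, hp, fun d hd => (hp' d hd).1⟩

variable {W} in
-- The mirror image for a minimum: now the minimal face is on the left of the outgoing edge of color
-- i + 2.
lemma IsAscending.exists_cycle_of_neg {i : Fin 3} {χ : G.rot.Face → ℚ} (h : W.IsAscending i χ)
    (h0 : χ G.outerFace = 0) {f : G.rot.Face} (hf : χ f < 0) :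
    ∃ (y : V) (p : G.graph.Walk y y), p.darts ≠ [] ∧
      ∀ d ∈ p.darts, W.lab d = some (i + 2) ∧ χ (G.rot.leftFace d) < 0 := by
  have : Nonempty G.rot.Face := ⟨f⟩
  obtain ⟨g, hg⟩ := Finite.exists_min χ
  have hgneg := (hg f).trans_lt hf
  obtain ⟨d₀, rfl⟩ := G.rot.leftFace_surjective g
  have hint : ∀ d : G.graph.Dart, χ (G.rot.leftFace d) = χ (G.rot.leftFace d₀) →
      G.IsInternalVertex d.fst := by
    intro d hd j hj
    rw [h.eq_outer hj, h0] at hd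
    linarith
  have hout : ∀ d : G.graph.Dart, χ (G.rot.leftFace d) = χ (G.rot.leftFace d₀) → ∀ hx,
      χ (G.rot.leftFace (W.out (x := d.fst) hx (i + 2))) = χ (G.rot.leftFace d₀) :=
    fun d hd hx => le_antisymm (hd ▸ (h.le_right_out hx rfl).2) (hg _)
  obtain ⟨y, p, hp, hp'⟩ := exists_closed_walk
    (E := fun d => W.lab d = some (i + 2) ∧ χ (G.rot.leftFace d) < 0)
    (S := fun x => ∃ d : G.graph.Dart, d.fst = x ∧ χ (G.rot.leftFace d) = χ (G.rot.leftFace d₀))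
    (x := d₀.fst) ⟨d₀, rfl, rfl⟩ (by
      rintro x ⟨d, rfl, hd⟩
      have hx := hint d hd
      have := hout d hd hx
      exact ⟨W.out hx (i + 2), ⟨W.lab_out hx _, by rw [this]; exact hgneg⟩, W.out_fst hx _,
        ⟨G.rot.facePerm (W.out hx (i + 2)), G.rot.facePerm_fst _, by
          rw [G.rot.leftFace_facePerm, this]⟩⟩)
  exact ⟨y, p, hp, fun d hd => (hp' d hd).1⟩

end SchnyderWood

end Schnyder


namespace Schnyder

namespace SchnyderWood

variable {V : Type*} {G : MaximalPlaneGraph V} (W : SchnyderWood G)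

variable {W} in
lemma Ascends.not_symm {i : Fin 3} {d : G.graph.Dart} (h : W.Ascends i d) :
    ¬ W.Ascends i d.symm := by
  have key : ∀ {d : G.graph.Dart} {a b : Fin 3}, W.lab d = some a → W.lab d.symm ≠ some b := by
    intro d a b h h'
    rw [W.lab_symm_of_lab h] at h'; cases h'
  have n1 : i ≠ i + 1 := by fin_cases i <;> simp
  have n2 : i ≠ i + 2 := by fin_cases i <;> simp
  intro h'
  rw [Ascends, SimpleGraph.Dart.symm_symm] at h'
  rcases h with h | h | h <;> rcases h' with h' | h' | h'
  · exact key h h'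
  · rw [h] at h'; exact n1 (Option.some.inj h')
  · rw [h] at h'; exact n2 (Option.some.inj h')
  · rw [h] at h'; exact n1 (Option.some.inj h').symm
  · exact key h' h
  · exact key h' h
  · rw [h] at h'; exact n2 (Option.some.inj h').symm
  · exact key h' h
  · exact key h' h

lemma ascends_of_lab_ne {i j : Fin 3} {d : G.graph.Dart} (h : W.lab d = some j) (hij : j ≠ i) :
    W.Ascends i d.symm := by
  rw [Ascends, SimpleGraph.Dart.symm_symm, h]
  revert hij
  fin_cases i <;> fin_cases j <;> simp

lemma not_ascends_outerDart (i j : Fin 3) : ¬ W.Ascends i (G.outerDart j) := by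
  simp [Ascends, lab_outerDart, lab_outerDart_symm]

lemma not_ascends_outerDart_symm (i j : Fin 3) : ¬ W.Ascends i (G.outerDart j).symm := by
  simp [Ascends, lab_outerDart, lab_outerDart_symm]

variable [Finite V]

lemma exists_isAscending {i : Fin 3} {x : V} (p : G.graph.Walk x x)
    (hp : ∀ d ∈ p.darts, W.Ascends i d) :
    ∃ χ : G.rot.Face → ℚ, χ G.outerFace = 0 ∧ W.IsAscending i χ ∧
      ∀ d, chain p d = χ (G.rot.leftFace d) - χ (G.rot.leftFace d.symm) := by
  have := Fintype.ofFinite G.graph.Dart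
  obtain ⟨χ, h0, h⟩ := W.exists_potential (chain p) (chain_symm p)
    (fun g => by rw [sum_chain, sub_self])
  refine ⟨χ, h0, ⟨fun d hd => ?_, fun j => ?_⟩, h⟩
  · have := chain_nonneg (p := p) (d := d) fun hd' => hd.not_symm (hp _ hd')
    linarith [h d]
  · have := chain_eq_zero (p := p) (fun hd => W.not_ascends_outerDart i j (hp _ hd))
      (fun hd => W.not_ascends_outerDart_symm i j (hp _ hd))
    rw [h, G.leftFace_outerDart_symm] at this
    linarith

/-- Ascending darts are never traversed in both directions, so nothing cancels in the flow of the
walk. -/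
lemma exists_ne_zero_of_chain {i : Fin 3} {x : V} {p : G.graph.Walk x x}
    (hp : ∀ d ∈ p.darts, W.Ascends i d) (hne : p.darts ≠ []) {χ : G.rot.Face → ℚ}
    (h : ∀ d, chain p d = χ (G.rot.leftFace d) - χ (G.rot.leftFace d.symm)) :
    ∃ f, χ f ≠ 0 := by
  by_contra hcon
  push Not at hcon
  obtain ⟨d, hd⟩ := List.exists_mem_of_ne_nil _ hne
  have h1 := one_le_chain hd fun hd' => (hp d hd).not_symm (hp _ hd')
  rw [h, hcon, hcon] at h1
  norm_num at h1

/-- There are no directed cycles of one color: another color would have a cycle that encloses fewer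
faces. -/
lemma no_tree_cycle (N : ℕ) : ∀ (i : Fin 3) (x : V) (p : G.graph.Walk x x), p.darts ≠ [] →
    (∀ d ∈ p.darts, W.lab d = some i) → G.facesInside p = N → False := by
  induction N using Nat.strong_induction_on with
  | _ N ih =>
  intro i x p hne hp hN
  have hpA : ∀ d ∈ p.darts, W.Ascends i d := fun d hd => .inl (hp d hd)
  obtain ⟨χ, h0, hA, hχ⟩ := W.exists_isAscending p hpA
  obtain ⟨f, hf⟩ := W.exists_ne_zero_of_chain hpA hne hχ
  -- The potential vanishes outside of `p`, as it only jumps across edges of `p`.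
  have hreach : ∀ g, Relation.ReflTransGen (G.DualAdj {e | e ∈ p.edges}) G.outerFace g →
      χ g = 0 := by
    intro g hg
    induction hg with
    | refl => exact h0
    | tail _ hd ih =>
      obtain ⟨d, hd, rfl, rfl⟩ := hd
      have : chain p d = 0 := chain_eq_zero (fun h => hd (List.mem_map_of_mem h))
        (fun h => hd (by
          rw [← SimpleGraph.Dart.edge_symm]; exact List.mem_map_of_mem h))
      rw [hχ, ih] at this
      linarith
  have key : ∀ (j : Fin 3) (y : V) (q : G.graph.Walk y y), j ≠ i → q.darts ≠ [] →
      (∀ d ∈ q.darts, W.lab d = some j) →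
      (∀ d ∈ q.darts, χ (G.rot.leftFace d) ≠ 0 ∨ χ (G.rot.leftFace d.symm) ≠ 0) → False := by
    intro j y q hj hqne hq hqχ
    have hdisj : ∀ d : G.graph.Dart, d.edge ∈ p.edges → d.edge ∉ q.edges := by
      intro d h1 h2
      obtain ⟨d1, hd1, e1⟩ := List.mem_map.1 h1
      obtain ⟨d2, hd2, e2⟩ := List.mem_map.1 h2
      have l1 := hp d1 hd1
      have l2 := hq d2 hd2
      rcases (SimpleGraph.dart_edge_eq_iff _ _).1 (e1.trans e2.symm) with rfl | rfl
      · rw [l1] at l2; exact hj (Option.some.inj l2).symm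
      · rw [W.lab_symm_of_lab l2] at l1; cases l1
    -- An edge of `q` is not crossed by the flow of `p`, so χ has the same nonzero value on both of
    -- its sides. Hence `q` never separates faces outside of `p`.
    have hboth : ∀ d : G.graph.Dart, d.edge ∈ q.edges →
        χ (G.rot.leftFace d) = χ (G.rot.leftFace d.symm) ∧ χ (G.rot.leftFace d) ≠ 0 := by
      intro d hd
      have hz : chain p d = 0 := chain_eq_zero (fun h => hdisj d (List.mem_map_of_mem h) hd)
        (fun h => hdisj d (by
          rw [← SimpleGraph.Dart.edge_symm]; exact List.mem_map_of_mem h) hd)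
      rw [hχ, sub_eq_zero] at hz
      refine ⟨hz, ?_⟩
      obtain ⟨d2, hd2, e2⟩ := List.mem_map.1 hd
      have := hqχ d2 hd2
      rcases (SimpleGraph.dart_edge_eq_iff _ _).1 e2 with rfl | rfl
      · rcases this with h | h
        · exact h
        · rwa [hz]
      · rw [SimpleGraph.Dart.symm_symm] at this
        rcases this with h | h
        · rwa [hz]
        · exact h
    have hsub : ∀ g, Relation.ReflTransGen (G.DualAdj {e | e ∈ p.edges}) G.outerFace g →
        Relation.ReflTransGen (G.DualAdj {e | e ∈ q.edges}) G.outerFace g := by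
      intro g hg
      induction hg with
      | refl => exact .refl
      | tail hb hd ih =>
        obtain ⟨d, hd, rfl, rfl⟩ := hd
        exact ih.tail ⟨d, fun hq' => (hboth d hq').2 (hreach _ hb), rfl, rfl⟩
    -- Strictness: some edge of `p` has an outside face on one side only. With respect to `q` this
    -- edge may be crossed, so the face behind it is enclosed by `p` but not by `q`.
    have hex : ∃ d, Relation.ReflTransGen (G.DualAdj {e | e ∈ p.edges}) G.outerFace
        (G.rot.leftFace d) ∧ ¬ Relation.ReflTransGen (G.DualAdj {e | e ∈ p.edges}) G.outerFace
        (G.rot.leftFace d.symm) := by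
      by_contra hcon
      push Not at hcon
      have := W.face_const (fun f => Relation.ReflTransGen (G.DualAdj {e | e ∈ p.edges})
        G.outerFace f) (fun d => propext ⟨hcon d, fun h => by
          have := hcon d.symm h
          rwa [SimpleGraph.Dart.symm_symm] at this⟩) G.outerFace f
      exact hf (hreach f (this.mp .refl))
    obtain ⟨d, hd1, hd2⟩ := hex
    have hdp : d.edge ∈ p.edges := by
      by_contra h
      exact hd2 (hd1.tail ⟨d, h, rfl, rfl⟩)
    have hd3 : Relation.ReflTransGen (G.DualAdj {e | e ∈ q.edges}) G.outerFace
        (G.rot.leftFace d.symm) :=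
      (hsub _ hd1).tail ⟨d, hdisj d hdp, rfl, rfl⟩
    refine ih (G.facesInside q) ?_ j y q hqne hq rfl
    rw [← hN]
    refine Set.ncard_lt_ncard ⟨fun g hg hg' => hg (hsub g hg'), fun hcon => hcon hd2 hd3⟩
      (Set.toFinite _)
  rcases lt_or_gt_of_ne hf with hf | hf
  · obtain ⟨y, q, hq, hq'⟩ := hA.exists_cycle_of_neg h0 hf
    exact key (i + 2) y q (by fin_cases i <;> simp) hq (fun d hd => (hq' d hd).1)
      (fun d hd => .inl (hq' d hd).2.ne)
  · obtain ⟨y, q, hq, hq'⟩ := hA.exists_cycle_of_pos h0 hf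
    exact key (i + 1) y q (by fin_cases i <;> simp) hq (fun d hd => (hq' d hd).1)
      (fun d hd => .inr (hq' d hd).2.ne')

/-- Any ascending cycle has a nonzero potential, whose sign yields a cycle of one color; those are
excluded already. -/
lemma ascends_acyclic (i : Fin 3) (x : V) : ¬ Relation.TransGen (Via (W.Ascends i)) x x := by
  intro h
  obtain ⟨p, hne, hp⟩ := exists_closed_walk_of_transGen h
  obtain ⟨χ, h0, hA, hχ⟩ := W.exists_isAscending p hp
  obtain ⟨f, hf⟩ := W.exists_ne_zero_of_chain hp hne hχ
  rcases lt_or_gt_of_ne hf with hf | hf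
  · obtain ⟨y, q, hq, hq'⟩ := hA.exists_cycle_of_neg h0 hf
    exact W.no_tree_cycle _ _ y q hq (fun d hd => (hq' d hd).1) rfl
  · obtain ⟨y, q, hq, hq'⟩ := hA.exists_cycle_of_pos h0 hf
    exact W.no_tree_cycle _ _ y q hq (fun d hd => (hq' d hd).1) rfl

/-! ### The three orders and the three trees -/

/-- One can get from `x` to `y` along ascending darts of color `i`. -/
abbrev Le (i : Fin 3) : V → V → Prop := Relation.ReflTransGen (Via (W.Ascends i))

/-- `y` lies on the directed path of color `i` that starts at `x`. -/
abbrev Anc (i : Fin 3) : V → V → Prop := Relation.ReflTransGen (Via fun d => W.lab d = some i)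

lemma le_antisymm {i : Fin 3} {x y : V} (h : W.Le i x y) (h' : W.Le i y x) : x = y := by
  by_contra hne
  rcases Relation.reflTransGen_iff_eq_or_transGen.1 h with h1 | h1
  · exact hne h1.symm
  · exact W.ascends_acyclic i x (h1.trans_left h')

lemma le_of_anc {i : Fin 3} {x y : V} (h : W.Anc i x y) : W.Le i x y :=
  h.lift id fun _ _ ⟨d, hd, h⟩ => ⟨d, .inl hd, h⟩

lemma le_of_anc_ne {i j : Fin 3} (hij : j ≠ i) {x y : V} (h : W.Anc j x y) : W.Le i y x := by
  induction h with
  | refl => exact .refl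
  | tail _ hd ih =>
    obtain ⟨d, hd, rfl, rfl⟩ := hd
    exact .head ⟨d.symm, W.ascends_of_lab_ne hd hij, rfl, rfl⟩ ih

/-- Following one color cannot cycle, so it ends at a vertex without outgoing edges, which is outer;
the color of the last edge tells which outer vertex it is. -/
lemma anc_outer {i : Fin 3} {x : V} (hx : G.IsInternalVertex x) : W.Anc i x (G.outer i) := by
  have hirr : ∀ y, ¬ Relation.TransGen (Via fun d => W.lab d = some i) y y := fun y hy =>
    W.ascends_acyclic i y
      (hy.lift id fun _ _ ⟨d, hd, h⟩ => ⟨d, .inl hd, h⟩)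
  induction x using (wellFounded_of_irrefl hirr).induction with
  | _ x ih =>
  have hv : Via (fun d => W.lab d = some i) x (W.out hx i).snd :=
    ⟨_, W.lab_out hx i, W.out_fst hx i, rfl⟩
  refine .head hv ?_
  by_cases hy : G.IsInternalVertex (W.out hx i).snd
  · exact ih _ hv hy
  · obtain ⟨j, hj⟩ := G.not_isInternalVertex.1 hy
    rw [hj, W.lab_of_snd_outer (W.lab_out hx i) hj]

/-- Paths in a tree are unique. -/
lemma anc_total {i : Fin 3} {a x y : V} (h : W.Anc i a x) (h' : W.Anc i a y) :
    W.Anc i x y ∨ W.Anc i y x := by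
  induction h with
  | refl => exact .inl h'
  | tail hb hd ih =>
    rcases ih with ih | ih
    · rcases Relation.ReflTransGen.cases_head ih with rfl | ⟨c, hc, hcy⟩
      · exact .inr (.single hd)
      · obtain ⟨d, hd, rfl, rfl⟩ := hd
        obtain ⟨d', hd', hf, rfl⟩ := hc
        rw [← W.eq_of_lab hd' hd hf]
        exact .inl hcy
    · exact .inr (ih.tail hd)

lemma exists_isTreePath {w : V} (hw : G.IsInternalVertex w) (i : Fin 3) :
    ∃ P : G.graph.Walk w (G.outer i), W.IsTreePath i P := by
  classical
  obtain ⟨p, hp⟩ := exists_walk_of_reflTransGen (W.anc_outer (i := i) hw)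
  exact ⟨p.bypass, p.bypass_isPath, fun d hd => hp d (p.darts_bypass_subset_darts hd)⟩

lemma anc_of_mem_support {i : Fin 3} {u v x : V} {P : G.graph.Walk u v}
    (hP : ∀ d ∈ P.darts, W.lab d = some i) (hx : x ∈ P.support) : W.Anc i u x := by
  induction P with
  | nil =>
    simp only [SimpleGraph.Walk.support_nil, List.mem_singleton] at hx
    rw [hx]
  | cons h p ih =>
    simp only [SimpleGraph.Walk.darts_cons, List.mem_cons, forall_eq_or_imp] at hP
    simp only [SimpleGraph.Walk.support_cons, List.mem_cons] at hx
    rcases hx with rfl | hx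
    · exact .refl
    · exact .head ⟨_, hP.1, rfl, rfl⟩ (ih hP.2 hx)

/-- Paths of different colors from the same vertex meet nowhere else. -/
lemma eq_of_anc_of_anc {i j : Fin 3} (hij : i ≠ j) {w x : V} (h : W.Anc i w x) (h' : W.Anc j w x) :
    x = w :=
  -- In the order of color i one climbs along a path of color i and descends along a path of any
  -- other color.
  W.le_antisymm (W.le_of_anc_ne hij.symm h') (W.le_of_anc h)

lemma isPath_append {i j : Fin 3} (hij : i ≠ j) {w : V} {P : G.graph.Walk w (G.outer i)}
    {Q : G.graph.Walk w (G.outer j)} (hP : W.IsTreePath i P) (hQ : W.IsTreePath j Q) :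
    (P.reverse.append Q).IsPath := by
  rw [SimpleGraph.Walk.isPath_def, SimpleGraph.Walk.support_append, List.nodup_append]
  refine ⟨?_, ?_, ?_⟩
  · rw [SimpleGraph.Walk.support_reverse, List.nodup_reverse]
    exact hP.1.support_nodup
  · exact hQ.1.support_nodup.sublist (List.tail_sublist _)
  · intro x hx y hy
    rintro rfl
    rw [SimpleGraph.Walk.support_reverse, List.mem_reverse] at hx
    have h1 := W.anc_of_mem_support hP.2 hx
    have h2 := W.anc_of_mem_support hQ.2 (List.mem_of_mem_tail hy)
    have := W.eq_of_anc_of_anc hij h1 h2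
    subst this
    have hn := hQ.1.support_nodup
    rw [← SimpleGraph.Walk.cons_tail_support, List.nodup_cons] at hn
    exact hn.1 hy

/-- The edges of both paths carry labels and are internal, so the closing outer edge is not among
them. -/
lemma isCycle_cons {i j : Fin 3} (hij : i ≠ j) {w : V} {P : G.graph.Walk w (G.outer i)}
    {Q : G.graph.Walk w (G.outer j)} (hP : W.IsTreePath i P) (hQ : W.IsTreePath j Q)
    (h : G.graph.Adj (G.outer j) (G.outer i)) (hd : ¬ G.IsInternalEdge s(G.outer j, G.outer i)) :
    (SimpleGraph.Walk.cons h (P.reverse.append Q)).IsCycle := by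
  rw [SimpleGraph.Walk.cons_isCycle_iff]
  refine ⟨W.isPath_append hij hP hQ, ?_⟩
  rw [SimpleGraph.Walk.edges_append, SimpleGraph.Walk.edges_reverse, List.mem_append,
    List.mem_reverse]
  rintro (he | he)
  · obtain ⟨d, hd', e⟩ := List.mem_map.1 he
    exact hd (e ▸ W.isInternalEdge_of_lab (hP.2 d hd'))
  · obtain ⟨d, hd', e⟩ := List.mem_map.1 he
    exact hd (e ▸ W.isInternalEdge_of_lab (hQ.2 d hd'))

end SchnyderWood

end Schnyder


namespace Schnyder

namespace SchnyderWood

variable {V : Type*} [Finite V] {G : MaximalPlaneGraph V} (W : SchnyderWood G)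

/-! ### Regions -/

/-- The internal faces whose angle labelled `i` lies below `v` in the order of color `i`. For internal
`v` these are the faces enclosed by the paths of the two other colors. -/
def region (i : Fin 3) (v : V) : Set G.rot.Face :=
  {f | f ≠ G.outerFace ∧ W.Le i (W.corner f i).fst v}

/-- Every internal corner at an outer vertex is labelled by the index of this vertex. -/
lemma corner_fst_cases {f : G.rot.Face} (hf : f ≠ G.outerFace) (i : Fin 3) :
    G.IsInternalVertex (W.corner f i).fst ∨ (W.corner f i).fst = G.outer i := by
  by_cases hx : G.IsInternalVertex (W.corner f i).fst
  · exact .inl hx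
  · obtain ⟨j, hj⟩ := G.not_isInternalVertex.1 hx
    have ha := W.ang_corner f i
    rcases W.dart_cases_outer hj with h | h | h
    · rw [W.ang_of_lab_symm h] at ha
      exact .inr (by rw [hj, ha])
    · rw [h, ang_outerDart] at ha
      exact .inr (by rw [hj, ha])
    · have := W.leftFace_corner f i
      rw [h, G.leftFace_outerDart_symm] at this
      exact absurd this.symm hf

lemma anc_corner_outer {f : G.rot.Face} (hf : f ≠ G.outerFace) (i : Fin 3) :
    W.Anc i (W.corner f i).fst (G.outer i) := by
  rcases W.corner_fst_cases hf i with h | h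
  · exact W.anc_outer h
  · rw [h]

/-- The faces around the vertices of a path of color `i` can be reached from the outer face. -/
lemma reach_of_anc {i : Fin 3} {C : Set (Sym2 V)} {a : V} (h : W.Anc i a (G.outer i))
    (hC : ∀ v, W.Anc i a v → ∀ d : G.graph.Dart, d.fst = v → d.edge ∉ C) :
    ∀ d : G.graph.Dart, d.fst = a →
      Relation.ReflTransGen (G.DualAdj C) G.outerFace (G.rot.leftFace d) := by
  have around : ∀ d d' : G.graph.Dart, d.fst = d'.fst →
      (∀ e : G.graph.Dart, e.fst = d.fst → e.edge ∉ C) →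
      Relation.ReflTransGen (G.DualAdj C) (G.rot.leftFace d) (G.rot.leftFace d') := by
    intro d d' hd he
    obtain ⟨k, rfl⟩ := G.rot.exists_next_pow hd
    clear hd
    induction k with
    | zero => exact .refl
    | succ k ih =>
      refine ih.tail ⟨(G.rot.next ((G.rot.next ^ k) d)).symm, ?_, ?_, ?_⟩
      · rw [SimpleGraph.Dart.edge_symm]
        exact he _ (by rw [G.rot.next_fst, G.rot.next_pow_fst])
      · rw [G.rot.leftFace_symm_next]
      · rw [SimpleGraph.Dart.symm_symm, pow_succ', Equiv.Perm.mul_apply]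
  induction h using Relation.ReflTransGen.head_induction_on with
  | refl =>
    intro d hd
    have e3 : i + 2 + 1 = i := by fin_cases i <;> rfl
    rw [← G.leftFace_outerDart_symm (i + 2)]
    have h1 : (G.outerDart (i + 2)).symm.fst = G.outer i := by
      change G.outer (i + 2 + 1) = _
      rw [e3]
    exact around _ _ (h1.trans hd.symm) fun e he => hC _ .refl e (he.trans h1)
  | head hd _ ih =>
    obtain ⟨e, he, rfl, rfl⟩ := hd
    intro d hd
    -- The left face of `e` touches both ends of `e`, which carries the reachability from the head
    -- to the tail without crossing `e`.
    have h1 := ih (fun v hv => hC v (.head ⟨e, he, rfl, rfl⟩ hv)) (G.rot.facePerm e)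
      (G.rot.facePerm_fst e)
    rw [G.rot.leftFace_facePerm] at h1
    exact h1.trans (around e d hd.symm fun e' he' => hC _ .refl e' he')

open Classical in
lemma chain_outer (j : Fin 3) (d : G.graph.Dart) :
    chain (.cons (G.outer_adj j) .nil) d =
      (if d = G.outerDart j then 1 else 0) - if d = (G.outerDart j).symm then 1 else 0 := by
  have h1 : (d.symm = G.outerDart j) ↔ (d = (G.outerDart j).symm) := by
    constructor
    · intro h; rw [← h, SimpleGraph.Dart.symm_symm]
    · rintro rfl; simp
  have h2 : (⟨(G.outer j, G.outer (j + 1)), G.outer_adj j⟩ : G.graph.Dart) = G.outerDart j := rfl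
  simp only [chain, SimpleGraph.Walk.darts_cons, SimpleGraph.Walk.darts_nil, List.count_cons, h2,
    List.count_nil, beq_iff_eq, zero_add, Nat.cast_ite, Nat.cast_one, Nat.cast_zero, ← h1,
    eq_comm (a := G.outerDart j)]

/-! ### The flow around a region and its potential -/

section Paths

variable {w : V} (P : (i : Fin 3) → G.graph.Walk w (G.outer i))

/-- The flow around the region of color `i`. -/
noncomputable def flow (i : Fin 3) (d : G.graph.Dart) : ℚ :=
  chain (P (i + 1)) d - chain (P (i + 2)) d + chain (.cons (G.outer_adj (i + 1)) .nil) d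

/-- The boundary of the region of color `i`. -/
def boundary (i : Fin 3) : Set (Sym2 V) :=
  {e | e ∈ (P (i + 1)).edges ∨ e ∈ (P (i + 2)).edges ∨ e = s(G.outer (i + 1), G.outer (i + 2))}

lemma flow_symm (i : Fin 3) (d : G.graph.Dart) : flow P i d.symm = - flow P i d := by
  simp only [flow, chain_symm]
  ring

lemma sum_flow [Fintype G.graph.Dart] (i : Fin 3) (g : V → ℚ) :
    ∑ d, g d.fst * flow P i d = 0 := by
  have e : i + 1 + 1 = i + 2 := by fin_cases i <;> rfl
  simp only [flow, mul_add, mul_sub, Finset.sum_add_distrib, Finset.sum_sub_distrib, sum_chain, e]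
  ring

lemma chain_eq_zero_of_edge {u v : V} {p : G.graph.Walk u v} {d : G.graph.Dart}
    (h : d.edge ∉ p.edges) : chain p d = 0 :=
  chain_eq_zero (fun h' => h (List.mem_map_of_mem h'))
    (fun h' => h (by rw [← SimpleGraph.Dart.edge_symm]; exact List.mem_map_of_mem h'))

lemma flow_eq_zero {i : Fin 3} {d : G.graph.Dart} (h : d.edge ∉ boundary P i) :
    flow P i d = 0 := by
  have e : i + 1 + 1 = i + 2 := by fin_cases i <;> rfl
  simp only [boundary, Set.mem_ofPred_eq, not_or] at h
  simp only [flow, chain_eq_zero_of_edge h.1, chain_eq_zero_of_edge h.2.1]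
  rw [chain_eq_zero_of_edge]
  · ring
  · simpa [e] using h.2.2

variable {P}

lemma chain_eq_zero_of_lab
    (hP : ∀ i, ∀ d ∈ (P i).darts, W.lab d = some i) {i j : Fin 3} (hij : i ≠ j) {d : G.graph.Dart}
    (h : W.lab d = some i) : chain (P j) d = 0 := by
  refine chain_eq_zero (fun h' => ?_) (fun h' => ?_)
  · have := hP j _ h'
    rw [h] at this
    exact hij (Option.some.inj this)
  · have := hP j _ h'
    rw [W.lab_symm_of_lab h] at this
    cases this

lemma flow_of_lab {i j : Fin 3} {d : G.graph.Dart} (h : W.lab d = some j) :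
    flow P i d = chain (P (i + 1)) d - chain (P (i + 2)) d := by
  classical
  rw [flow, chain_outer, if_neg, if_neg]
  · ring
  · rintro rfl; rw [lab_outerDart_symm] at h; cases h
  · rintro rfl; rw [lab_outerDart] at h; cases h

lemma flow_of_lab_self
    (hP : ∀ i, ∀ d ∈ (P i).darts, W.lab d = some i) {i : Fin 3} {d : G.graph.Dart} (h : W.lab d = some i) :
    flow P i d = 0 := by
  rw [W.flow_of_lab h, W.chain_eq_zero_of_lab hP _ h, W.chain_eq_zero_of_lab hP _ h, sub_zero]
  · fin_cases i <;> simp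
  · fin_cases i <;> simp

lemma flow_of_lab_add_one
    (hP : ∀ i, ∀ d ∈ (P i).darts, W.lab d = some i) {i : Fin 3} {d : G.graph.Dart} (h : W.lab d = some (i + 1)) :
    flow P i d = chain (P (i + 1)) d ∧ 0 ≤ flow P i d := by
  have : flow P i d = chain (P (i + 1)) d := by
    rw [W.flow_of_lab h, W.chain_eq_zero_of_lab hP (j := i + 2) _ h, sub_zero]
    fin_cases i <;> simp
  refine ⟨this, this ▸ chain_nonneg fun h' => ?_⟩
  have := hP _ _ h'
  rw [W.lab_symm_of_lab h] at this
  cases this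

lemma flow_of_lab_add_two
    (hP : ∀ i, ∀ d ∈ (P i).darts, W.lab d = some i) {i : Fin 3} {d : G.graph.Dart} (h : W.lab d = some (i + 2)) :
    flow P i d ≤ 0 := by
  rw [W.flow_of_lab h, W.chain_eq_zero_of_lab hP (j := i + 1) _ h, zero_sub, neg_nonpos]
  · refine chain_nonneg fun h' => ?_
    have := hP _ _ h'
    rw [W.lab_symm_of_lab h] at this
    cases this
  · fin_cases i <;> simp

lemma mem_boundary_fst
    (hP : ∀ i, ∀ d ∈ (P i).darts, W.lab d = some i) {i : Fin 3} {d : G.graph.Dart} (h : d.edge ∈ boundary P i) :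
    W.Anc (i + 1) w d.fst ∨ W.Anc (i + 2) w d.fst := by
  have hs : ∀ {u v : V} (p : G.graph.Walk u v), d.edge ∈ p.edges → d.fst ∈ p.support := by
    intro u v p h
    exact p.fst_mem_support_of_mem_edges (show s(d.fst, d.snd) ∈ p.edges from h)
  rcases h with h | h | h
  · exact .inl (W.anc_of_mem_support (hP _) (hs _ h))
  · exact .inr (W.anc_of_mem_support (hP _) (hs _ h))
  · have h' : s(d.fst, d.snd) = s(G.outer (i + 1), G.outer (i + 2)) := h
    rcases Sym2.eq_iff.1 h' with ⟨h, -⟩ | ⟨h, -⟩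
    · rw [h]; exact .inl (W.anc_of_mem_support (hP _) (SimpleGraph.Walk.end_mem_support _))
    · rw [h]; exact .inr (W.anc_of_mem_support (hP _) (SimpleGraph.Walk.end_mem_support _))

/-- A face can be reached from the outer face, unless the path of color `i` from its angle labelled `i`
meets the boundary of the region. -/
lemma reach_of_forall
    (hP : ∀ i, ∀ d ∈ (P i).darts, W.lab d = some i) {i : Fin 3} {f : G.rot.Face} (hf : f ≠ G.outerFace)
    (h : ∀ v, W.Anc i (W.corner f i).fst v → ¬ W.Anc (i + 1) w v ∧ ¬ W.Anc (i + 2) w v) :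
    Relation.ReflTransGen (G.DualAdj (boundary P i)) G.outerFace f := by
  have := W.reach_of_anc (C := boundary P i) (W.anc_corner_outer hf i) (by
    rintro v hv d rfl hd
    rcases W.mem_boundary_fst hP hd with h' | h'
    · exact (h _ hv).1 h'
    · exact (h _ hv).2 h') (W.corner f i) rfl
  rwa [leftFace_corner] at this

lemma le_of_anc_of_anc {i : Fin 3} {a v : V} (ha : W.Anc i a v)
    (h : W.Anc (i + 1) w v ∨ W.Anc (i + 2) w v) : W.Le i a w := by
  refine (W.le_of_anc ha).trans ?_
  rcases h with h | h
  · exact W.le_of_anc_ne (by fin_cases i <;> simp) h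
  · exact W.le_of_anc_ne (by fin_cases i <;> simp) h

/-- If the path of color i from the corner labelled i met the boundary in v, the corner would be
below v, and v is below w since it lies on a path of another color from w. -/
lemma reach_of_notMem_region
    (hP : ∀ i, ∀ d ∈ (P i).darts, W.lab d = some i) {i : Fin 3} {f : G.rot.Face} (hf : f ∉ W.region i w) :
    Relation.ReflTransGen (G.DualAdj (boundary P i)) G.outerFace f := by
  by_cases h0 : f = G.outerFace
  · rw [h0]
  · refine W.reach_of_forall hP h0 fun v hv => ⟨fun h => hf ⟨h0, ?_⟩, fun h => hf ⟨h0, ?_⟩⟩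
    · exact W.le_of_anc_of_anc hv (.inl h)
    · exact W.le_of_anc_of_anc hv (.inr h)

lemma eq_zero_of_reach {i : Fin 3} {χ : G.rot.Face → ℚ} (h0 : χ G.outerFace = 0)
    (hχ : ∀ d, flow P i d = χ (G.rot.leftFace d) - χ (G.rot.leftFace d.symm)) {f : G.rot.Face}
    (hf : Relation.ReflTransGen (G.DualAdj (boundary P i)) G.outerFace f) : χ f = 0 := by
  induction hf with
  | refl => exact h0
  | tail _ hd ih =>
    obtain ⟨d, hd, rfl, rfl⟩ := hd
    have := flow_eq_zero P hd
    rw [hχ, ih] at this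
    linarith

/-- The value of χ on the corners labelled i is the same all around a vertex, it does not decrease
when one goes down in the order of color i, and it is at least 1 at w. As a face of the region has
its corner labelled i below w, the bound reaches it. -/
lemma one_le_of_mem_region
    (hP : ∀ i, ∀ d ∈ (P i).darts, W.lab d = some i) (hw : G.IsInternalVertex w) {i : Fin 3} {χ : G.rot.Face → ℚ}
    (h0 : χ G.outerFace = 0)
    (hχ : ∀ d, flow P i d = χ (G.rot.leftFace d) - χ (G.rot.leftFace d.symm)) {f : G.rot.Face}
    (hf : f ∈ W.region i w) : 1 ≤ χ f := by
  have e1 : i + 2 + 1 = i := by fin_cases i <;> rfl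
  have e2 : i + 2 + 2 = i + 1 := by fin_cases i <;> rfl
  have e3 : i + 1 + 2 = i := by fin_cases i <;> rfl
  have e4 : i + 1 + 1 = i + 2 := by fin_cases i <;> rfl
  set H : G.graph.Dart → ℚ := fun d => χ (G.rot.leftFace d) with hH
  have hprev : ∀ d, H (G.rot.next.symm d) = χ (G.rot.leftFace d.symm) := fun d => by
    simp only [hH, G.rot.leftFace_next_symm]
  have hstep : ∀ d, flow P i d = H d - H (G.rot.next.symm d) := fun d => by rw [hχ, hprev]
  have hsy : ∀ d, flow P i d = - flow P i d.symm := fun d => by rw [flow_symm, neg_neg]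
  have inI : ∀ d, W.lab d.symm = some i → flow P i d = 0 := fun d hd => by
    rw [hsy, W.flow_of_lab_self hP hd, neg_zero]
  have in1 : ∀ d, W.lab d.symm = some (i + 1) → flow P i d ≤ 0 := fun d hd => by
    rw [hsy, neg_nonpos]; exact (W.flow_of_lab_add_one hP hd).2
  have in2 : ∀ d, W.lab d.symm = some (i + 2) → 0 ≤ flow P i d := fun d hd => by
    rw [hsy, neg_nonneg]; exact W.flow_of_lab_add_two hP hd
  -- all angles labelled `i` at a vertex are on the same side of the boundary
  have hconst : ∀ {x : V} (hx : G.IsInternalVertex x) (d : G.graph.Dart), d.fst = x →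
      W.ang d = i → H d = H (W.out hx (i + 1)) ∧
        H (G.rot.next.symm (W.out hx (i + 2))) = H (W.out hx (i + 1)) := by
    intro x hx d hd ha
    have s1 := W.sector_mono hx (i + 1) H (d := d) (by
      intro d _ hl; rw [e3] at hl; linarith [hstep d, inI d hl]) hd (by rw [e3, ha])
    have s2 := W.sector_mono hx (i + 1) (fun d => - H d) (d := d) (by
      intro d _ hl; rw [e3] at hl; linarith [hstep d, inI d hl]) hd (by rw [e3, ha])
    rw [e4] at s1 s2
    constructor <;> linarith
  -- The outgoing dart of color i + 1 serves as representative of the corners labelled i, being the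
  -- first of them. In each of the three kinds of ascending darts, the comparison uses a face at `d`
  -- and the signs of the flow in the adjacent sectors.
  have hmono : ∀ (d : G.graph.Dart) (hx : G.IsInternalVertex d.fst) (hy : G.IsInternalVertex d.snd),
      W.Ascends i d → H (W.out hy (i + 1)) ≤ H (W.out hx (i + 1)) := by
    intro d hx hy hd
    have s2 := fun {e} => W.sector_mono hx i H (d := e) (by
      intro d _ hl; linarith [hstep d, in2 d hl])
    have b1 : H (G.rot.next.symm (W.out hx (i + 1))) ≤ H (W.out hx (i + 1)) := by
      linarith [hstep (W.out hx (i + 1)), (W.flow_of_lab_add_one hP (W.lab_out hx (i + 1))).2]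
    rcases hd with hd | hd | hd
    · have h1 := (hconst hy (G.rot.facePerm d) (G.rot.facePerm_fst d) (by
        rw [W.ang_facePerm, W.ang_of_lab hd, e1])).1
      have h2 : H (G.rot.facePerm d) = H d := by simp only [hH, G.rot.leftFace_facePerm]
      have h3 := (s2 rfl (W.ang_of_lab hd)).2
      linarith
    · have h1 : W.out hy (i + 1) = d.symm := (W.eq_out hy rfl hd).symm
      have h2 : H d.symm = H (G.rot.next.symm d) := (hprev d).symm
      have h3 := W.sector_mono hx (i + 2) (fun d => - H d) (d := G.rot.next.symm d) (by
        intro d _ hl; rw [e2] at hl; linarith [hstep d, in1 d hl]) (G.rot.next_symm_fst d) (by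
        rw [ang_eq_of_next, Equiv.apply_symm_apply, W.ang_of_lab hd, add_assoc,
          show (2 : Fin 3) + 1 = 0 from rfl, add_zero, e2])
      have h4 := (hconst hx (W.out hx (i + 1)) (W.out_fst hx _) (by
        rw [W.ang_of_lab (W.lab_out hx _), e3])).2
      have h5 := hstep (W.out hx (i + 2))
      have h6 := W.flow_of_lab_add_two hP (W.lab_out hx (i + 2))
      rw [h1, h2]
      linarith [h3.1]
    · have h1 : W.out hy (i + 2) = d.symm := (W.eq_out hy rfl hd).symm
      have h2 := (hconst hy (W.out hy (i + 1)) (W.out_fst hy _) (by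
        rw [W.ang_of_lab (W.lab_out hy _), e3])).2
      rw [h1, hprev, SimpleGraph.Dart.symm_symm] at h2
      have h3 := (s2 (e := d) rfl (W.ang_of_lab_symm hd)).2
      linarith [show H d = χ (G.rot.leftFace d) from rfl]
  -- The face just clockwise of the first edge of the path of color i + 1 has its corner labelled i
  -- at the head of an ascending dart from w, hence strictly above w. So it is outside of the region
  -- with potential 0, and crossing the path edge adds at least 1.
  have hbase : 1 ≤ H (W.out hw (i + 1)) := by
    set e := W.out hw (i + 1) with he
    set d' := G.rot.next.symm e with hd'
    have hd'f : d'.fst = w := (G.rot.next_symm_fst e).trans (W.out_fst hw _)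
    have ha' : W.ang d' = i + 2 := by
      rw [ang_eq_of_next, hd', Equiv.apply_symm_apply,
        W.ang_of_lab_symm (d := e.symm) (by rw [SimpleGraph.Dart.symm_symm]; exact W.lab_out hw _),
        e4]
    have hout : G.rot.leftFace d' ∉ W.region i w := by
      rintro ⟨-, hle⟩
      have hc : W.corner (G.rot.leftFace d') i = G.rot.facePerm d' :=
        W.corner_eq (G.rot.leftFace_facePerm d') (by rw [W.ang_facePerm, ha', e1])
      rw [hc, G.rot.facePerm_fst] at hle
      have hasc : W.Ascends i d' := by
        rcases W.lab_eq_of_ang (hd'f ▸ hw) ha' with h | h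
        · exact .inl h
        · exact .inr (.inr h)
      exact W.ascends_acyclic i w (.head' ⟨d', hasc, hd'f, rfl⟩ hle)
    have h1 : H d' = 0 := eq_zero_of_reach h0 hχ (W.reach_of_notMem_region hP hout)
    have h2 := (W.flow_of_lab_add_one hP (W.lab_out hw (i + 1))).1
    have hmem : e ∈ (P (i + 1)).darts := by
      have hl := hP (i + 1)
      revert hl
      generalize P (i + 1) = p
      intro hl
      cases p with
      | nil => exact absurd rfl (hw (i + 1))
      | cons h p =>
        have := hl ⟨(w, _), h⟩ (by simp)
        rw [← W.eq_out hw rfl this] at he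
        rw [he]; simp
    have h3 := one_le_chain hmem (fun h' => by
      have := hP _ _ h'
      rw [W.lab_symm_of_lab (W.lab_out hw _)] at this; cases this)
    have := hstep e
    linarith
  -- Besides the bound, the induction carries that the outer vertex of color i is never below w;
  -- otherwise the representative dart would not exist.
  have hind : ∀ v, W.Le i v w → v ≠ G.outer i ∧ ∀ hv : G.IsInternalVertex v,
      1 ≤ H (W.out hv (i + 1)) := by
    intro v hv
    induction hv using Relation.ReflTransGen.head_induction_on with
    | refl => exact ⟨hw i, fun _ => hbase⟩
    | head hd _ ih =>
      obtain ⟨d, hd, rfl, rfl⟩ := hd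
      have hy : G.IsInternalVertex d.snd := by
        rcases hd with hd | hd | hd
        · intro j hj
          rw [W.lab_of_snd_outer hd hj] at ih
          exact ih.1 hj
        · exact W.fst_internal hd
        · exact W.fst_internal hd
      refine ⟨fun hx => ?_, fun hx => (ih.2 hy).trans (hmono d hx hy hd)⟩
      rcases hd with hd | hd | hd
      · exact W.fst_internal hd i hx
      · have := W.lab_of_snd_outer hd hx
        revert this; fin_cases i <;> simp
      · have := W.lab_of_snd_outer hd hx
        revert this; fin_cases i <;> simp
  obtain ⟨hf0, hf⟩ := hf
  have h1 := hind _ hf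
  rcases W.corner_fst_cases hf0 i with h | h
  · have h2 := (hconst h _ rfl (W.ang_corner f i)).1
    have h3 := h1.2 h
    rw [← h2] at h3
    simpa only [hH, leftFace_corner] using h3
  · exact absurd h h1.1

end Paths

end SchnyderWood

end Schnyder


namespace Schnyder

namespace SchnyderWood

variable {V : Type*} [Finite V] {G : MaximalPlaneGraph V} (W : SchnyderWood G)

/-! ### The regions partition the internal faces and are the interiors of the cycles -/

lemma le_outer_iff {i j : Fin 3} (hij : i ≠ j) {a : V} : W.Le i a (G.outer j) ↔ a = G.outer j := by
  constructor
  · intro h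
    rcases Relation.ReflTransGen.cases_tail h with h | ⟨b, -, d, hd, -, hj⟩
    · exact h.symm
    · rcases hd with hd | hd | hd
      · exact absurd (W.lab_of_snd_outer hd hj) hij
      · exact absurd hj (W.fst_internal hd j)
      · exact absurd hj (W.fst_internal hd j)
  · rintro rfl; exact .refl

lemma region_outer_ne {i j : Fin 3} (hij : i ≠ j) : W.region i (G.outer j) = ∅ := by
  ext f
  simp only [region, Set.mem_ofPred_eq, Set.mem_empty_iff_false, iff_false, not_and]
  intro hf h
  rw [W.le_outer_iff hij] at h
  rcases W.corner_fst_cases hf i with h' | h'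
  · exact h' j h
  · exact hij (G.outer_injective (h'.symm.trans h))

lemma region_outer_self (i : Fin 3) : W.region i (G.outer i) = {f | f ≠ G.outerFace} := by
  ext f
  simp only [region, Set.mem_ofPred_eq, and_iff_left_iff_imp]
  exact fun hf => W.le_of_anc (W.anc_corner_outer hf i)

/-- In the sum of the three flows each path occurs twice with opposite signs, so only the outer
triangle remains. Its potential is the indicator of the internal faces. -/
lemma exists_region_potentials (W : SchnyderWood G) {w : V} {P : (i : Fin 3) → G.graph.Walk w (G.outer i)} :
    ∃ χ : Fin 3 → G.rot.Face → ℚ, (∀ i, χ i G.outerFace = 0) ∧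
      (∀ i d, flow P i d = χ i (G.rot.leftFace d) - χ i (G.rot.leftFace d.symm)) ∧
      ∀ f, f ≠ G.outerFace → χ 0 f + χ 1 f + χ 2 f = 1 := by
  classical
  have := Fintype.ofFinite G.graph.Dart
  choose χ h0 hχ using fun i => W.exists_potential (flow P i) (flow_symm P i) (sum_flow P i)
  refine ⟨χ, h0, hχ, ?_⟩
  have hsum : ∀ d, flow P 0 d + flow P 1 d + flow P 2 d =
      (chain (.cons (G.outer_adj 0) .nil) d + chain (.cons (G.outer_adj 1) .nil) d +
        chain (.cons (G.outer_adj 2) .nil) d : ℚ) := by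
    intro d
    have hc : ∀ {j k : Fin 3}, j = k → chain (P j) d = chain (P k) d := by rintro j _ rfl; rfl
    have ho : ∀ {j k : Fin 3}, j = k → chain (.cons (G.outer_adj j) .nil) d =
        chain (.cons (G.outer_adj k) .nil) d := by rintro j _ rfl; rfl
    simp only [flow]
    rw [hc (show (0 : Fin 3) + 1 = 1 from rfl), hc (show (0 : Fin 3) + 2 = 2 from rfl),
      hc (show (1 : Fin 3) + 1 = 2 from rfl), hc (show (1 : Fin 3) + 2 = 0 from rfl),
      hc (show (2 : Fin 3) + 1 = 0 from rfl), hc (show (2 : Fin 3) + 2 = 1 from rfl),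
      ho (show (0 : Fin 3) + 1 = 1 from rfl), ho (show (1 : Fin 3) + 1 = 2 from rfl),
      ho (show (2 : Fin 3) + 1 = 0 from rfl)]
    ring
  have hind : ∀ d : G.graph.Dart, (chain (.cons (G.outer_adj 0) .nil) d +
      chain (.cons (G.outer_adj 1) .nil) d + chain (.cons (G.outer_adj 2) .nil) d : ℚ) =
      (if G.rot.leftFace d = G.outerFace then 0 else 1) -
        (if G.rot.leftFace d.symm = G.outerFace then 0 else 1) := by
    intro d
    simp only [chain_outer, W.leftFace_eq_outerFace_iff]
    have hs (j : Fin 3) : d.symm = (G.outerDart j).symm ↔ d = G.outerDart j :=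
      (SimpleGraph.Dart.symm_involutive (G := G.graph)).injective.eq_iff
    simp only [hs]
    by_cases h1 : ∃ i, d = G.outerDart i
    · obtain ⟨i, rfl⟩ := h1
      simp only [outerDart_injective.eq_iff, outerDart_ne_symm]
      fin_cases i <;> simp
    · by_cases h2 : ∃ i, d = (G.outerDart i).symm
      · obtain ⟨i, rfl⟩ := h2
        have hsy := (SimpleGraph.Dart.symm_involutive (G := G.graph)).injective
        simp only [hsy.eq_iff, outerDart_injective.eq_iff, (outerDart_ne_symm _ _).symm]
        fin_cases i <;> simp
      · rw [if_neg h1, if_neg h2]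
        push Not at h1 h2
        simp [h1, h2]
  -- The sum of the potentials and this indicator have the same jumps, and both vanish on the outer
  -- face.
  have hconst := W.face_const (fun f => χ 0 f + χ 1 f + χ 2 f -
    (if f = G.outerFace then 0 else 1)) (fun d => by
      linarith [hsum d, hind d, hχ 0 d, hχ 1 d, hχ 2 d])
  intro f hf
  have := hconst f G.outerFace
  simp only [if_neg hf, if_true, h0] at this
  linarith

/-- Each potential is at least 1 on its region and 0 elsewhere, and the three add up to 1. So
neither no region nor two of them can contain the face. At an outer vertex one region is everything
and the others are empty. -/
lemma region_cases (v : V) {f : G.rot.Face} (hf : f ≠ G.outerFace) :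
    (∃ i, f ∈ W.region i v) ∧ ∀ i j, f ∈ W.region i v → f ∈ W.region j v → i = j := by
  by_cases hv : G.IsInternalVertex v
  · choose P hP using W.exists_isTreePath hv
    have hP' : ∀ i, ∀ d ∈ (P i).darts, W.lab d = some i := fun i => (hP i).2
    obtain ⟨χ, h0, hχ, hsum⟩ := W.exists_region_potentials (P := P)
    have h1 : ∀ i, f ∈ W.region i v → 1 ≤ χ i f := fun i hi =>
      W.one_le_of_mem_region hP' hv (h0 i) (hχ i) hi
    have h2 : ∀ i, f ∉ W.region i v → χ i f = 0 := fun i hi =>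
      eq_zero_of_reach (h0 i) (hχ i) (W.reach_of_notMem_region hP' hi)
    have h3 : ∀ i, 0 ≤ χ i f := fun i => by
      by_cases h : f ∈ W.region i v
      · linarith [h1 i h]
      · rw [h2 i h]
    have hs := hsum f hf
    constructor
    · by_contra hcon
      push Not at hcon
      rw [h2 0 (hcon 0), h2 1 (hcon 1), h2 2 (hcon 2)] at hs
      norm_num at hs
    · intro i j hi hj
      have a := h1 i hi
      have b := h1 j hj
      have c0 := h3 0
      have c1 := h3 1
      have c2 := h3 2
      fin_cases i <;> fin_cases j <;> first | rfl | (exfalso; simp at a b; linarith)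
  · obtain ⟨j, rfl⟩ := G.not_isInternalVertex.1 hv
    have h : ∀ i, f ∈ W.region i (G.outer j) → i = j := by
      intro i hi
      by_contra hij
      rw [W.region_outer_ne hij] at hi
      exact hi
    exact ⟨⟨j, by rw [region_outer_self]; exact hf⟩, fun i k hi hk => (h i hi).trans (h k hk).symm⟩

/-- The potential separates the two sides: it is 0 on every reachable face and at least 1 on the
region. -/
lemma setOf_not_reach_eq_region {w : V} {P : (i : Fin 3) → G.graph.Walk w (G.outer i)}
    (hP : ∀ i, ∀ d ∈ (P i).darts, W.lab d = some i) (hw : G.IsInternalVertex w) (i : Fin 3) :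
    {f | ¬ Relation.ReflTransGen (G.DualAdj (boundary P i)) G.outerFace f} = W.region i w := by
  obtain ⟨χ, h0, hχ, -⟩ := W.exists_region_potentials (P := P)
  ext f
  constructor
  · intro h
    by_contra hf
    exact h (W.reach_of_notMem_region hP hf)
  · intro h hr
    have h1 := W.one_le_of_mem_region hP hw (h0 i) (hχ i) h
    rw [eq_zero_of_reach (h0 i) (hχ i) hr] at h1
    norm_num at h1

lemma facesInside_cycleX {w : V} {P : (i : Fin 3) → G.graph.Walk w (G.outer i)}
    (hP : ∀ i, ∀ d ∈ (P i).darts, W.lab d = some i) (hw : G.IsInternalVertex w) :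
    G.facesInside (cycleX (P 0) (P 2)) = (W.region 1 w).ncard := by
  have hE : {e | e ∈ (cycleX (P 0) (P 2)).edges} = boundary P 1 := by
    ext e
    have : e ∈ boundary P 1 ↔
        (e ∈ (P 2).edges ∨ e ∈ (P 0).edges ∨ e = s(G.outer 2, G.outer 0)) := Iff.rfl
    rw [this]
    simp only [cycleX, Set.mem_ofPred_eq, SimpleGraph.Walk.edges_cons, List.mem_cons,
      SimpleGraph.Walk.edges_append, SimpleGraph.Walk.edges_reverse, List.mem_append,
      List.mem_reverse]
    have : e = s(G.outer 2, G.outer (2 + 1)) ↔ e = s(G.outer 2, G.outer 0) := Iff.rfl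
    tauto
  rw [MaximalPlaneGraph.facesInside, hE, W.setOf_not_reach_eq_region hP hw]

lemma facesInside_cycleY {w : V} {P : (i : Fin 3) → G.graph.Walk w (G.outer i)}
    (hP : ∀ i, ∀ d ∈ (P i).darts, W.lab d = some i) (hw : G.IsInternalVertex w) :
    G.facesInside (cycleY (P 0) (P 1)) = (W.region 2 w).ncard := by
  have hE : {e | e ∈ (cycleY (P 0) (P 1)).edges} = boundary P 2 := by
    ext e
    have : e ∈ boundary P 2 ↔
        (e ∈ (P 0).edges ∨ e ∈ (P 1).edges ∨ e = s(G.outer 0, G.outer 1)) := Iff.rfl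
    rw [this]
    simp only [cycleY, Set.mem_ofPred_eq, SimpleGraph.Walk.edges_cons, List.mem_cons,
      SimpleGraph.Walk.edges_append, SimpleGraph.Walk.edges_reverse, List.mem_append,
      List.mem_reverse]
    have : e = s(G.outer (0 + 1), G.outer 0) ↔ e = s(G.outer 0, G.outer 1) := by
      rw [Sym2.eq_swap]; rfl
    tauto
  rw [MaximalPlaneGraph.facesInside, hE, W.setOf_not_reach_eq_region hP hw]

/-! ### The drawing -/

/-- The outcome of Schnyder's algorithm. -/
noncomputable def drawing : GridDrawing V :=
  fun v => (((W.region 1 v).ncard : ℤ), ((W.region 2 v).ncard : ℤ))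

lemma ncard_internal_faces (W : SchnyderWood G) :
    {f : G.rot.Face | f ≠ G.outerFace}.ncard + 5 = 2 * Nat.card V := by
  have h := Set.ncard_add_ncard_compl {G.outerFace}
  have h2 : ({G.outerFace} : Set G.rot.Face)ᶜ = {f | f ≠ G.outerFace} := rfl
  rw [Set.ncard_singleton, h2] at h
  have := W.card_face
  omega

/-- The third, invisible coordinate of the drawing: the size of region 0 is 2n - 5 minus the sum of
the two coordinates, so x + y grows exactly when region 0 shrinks. -/
lemma ncard_region_sum (v : V) :
    (W.region 0 v).ncard + (W.region 1 v).ncard + (W.region 2 v).ncard + 5 = 2 * Nat.card V := by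
  rw [← W.ncard_internal_faces]
  have hd : ∀ i j, i ≠ j → Disjoint (W.region i v) (W.region j v) := fun i j hij =>
    Set.disjoint_left.2 fun f hi hj => hij ((W.region_cases v hi.1).2 i j hi hj)
  have hU : {f : G.rot.Face | f ≠ G.outerFace} =
      W.region 0 v ∪ W.region 1 v ∪ W.region 2 v := by
    ext f
    constructor
    · intro hf
      obtain ⟨i, hi⟩ := (W.region_cases v hf).1
      fin_cases i
      · exact .inl (.inl hi)
      · exact .inl (.inr hi)
      · exact .inr hi
    · rintro ((h | h) | h) <;> exact h.1
  rw [hU, Set.ncard_union_eq _ (Set.toFinite _) (Set.toFinite _),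
    Set.ncard_union_eq (hd 0 1 (by simp)) (Set.toFinite _) (Set.toFinite _)]
  exact Set.disjoint_union_left.2 ⟨hd 0 2 (by simp), hd 1 2 (by simp)⟩

/-- The faces enclosed by the cycles do not depend on the paths chosen, as they are determined by
the order; so the outcome exists and is unique. -/
lemma draws_iff (Γ : GridDrawing V) : W.Draws Γ ↔ Γ = W.drawing := by
  have c0 : ((W.region 1 (G.outer 1)).ncard : ℤ) = 2 * (Nat.card V : ℤ) - 5 := by
    rw [region_outer_self]; have := W.ncard_internal_faces; omega
  have c1 : ((W.region 2 (G.outer 2)).ncard : ℤ) = 2 * (Nat.card V : ℤ) - 5 := by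
    rw [region_outer_self]; have := W.ncard_internal_faces; omega
  have o0 : W.drawing (G.outer 0) = (0, 0) := by
    simp [drawing, W.region_outer_ne (show (1 : Fin 3) ≠ 0 by simp),
      W.region_outer_ne (show (2 : Fin 3) ≠ 0 by simp)]
  have o1 : W.drawing (G.outer 1) = (2 * (Nat.card V : ℤ) - 5, 0) := by
    simp [drawing, c0, W.region_outer_ne (show (2 : Fin 3) ≠ 1 by simp)]
  have o2 : W.drawing (G.outer 2) = (0, 2 * (Nat.card V : ℤ) - 5) := by
    simp [drawing, c1, W.region_outer_ne (show (1 : Fin 3) ≠ 2 by simp)]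
  constructor
  · intro h
    funext w
    by_cases hw : G.IsInternalVertex w
    · obtain ⟨P, hP, -, -, hΓ⟩ := h.internal w hw
      rw [hΓ, W.facesInside_cycleX (fun i => (hP i).2) hw,
        W.facesInside_cycleY (fun i => (hP i).2) hw]
      rfl
    · obtain ⟨j, rfl⟩ := G.not_isInternalVertex.1 hw
      fin_cases j
      · exact h.outer₁.trans o0.symm
      · exact h.outer₂.trans o1.symm
      · exact h.outer₃.trans o2.symm
  · rintro rfl
    refine ⟨o0, o1, o2, fun w hw => ?_⟩
    choose P hP using W.exists_isTreePath hw
    refine ⟨P, hP, ?_, ?_, ?_⟩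
    · refine W.isCycle_cons (by simp) (hP 0) (hP 2) (G.outer_adj 2) ?_
      exact fun h => h.2 2 rfl
    · refine W.isCycle_cons (by simp) (hP 0) (hP 1) (G.outer_adj 0).symm ?_
      exact fun h => h.2 0 Sym2.eq_swap
    · rw [W.facesInside_cycleX (fun i => (hP i).2) hw, W.facesInside_cycleY (fun i => (hP i).2) hw]
      rfl

lemma region_subset_of_ascends {i : Fin 3} {d : G.graph.Dart} (h : W.Ascends i d) :
    W.region i d.fst ⊆ W.region i d.snd :=
  fun _ hf => ⟨hf.1, hf.2.tail ⟨d, h, rfl, rfl⟩⟩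

lemma mem_region_fst {d : G.graph.Dart} (hd : G.rot.leftFace d ≠ G.outerFace) {i : Fin 3}
    (h : W.ang d = i) : G.rot.leftFace d ∈ W.region i d.fst :=
  ⟨hd, by rw [W.corner_eq rfl h]⟩

/-- Along an edge of color `j` the region of color `j` grows, the others shrink. -/
lemma ncard_region_lt {j : Fin 3} {d : G.graph.Dart} (h : W.lab d = some j) :
    (W.region j d.fst).ncard < (W.region j d.snd).ncard ∧
      ∀ i, i ≠ j → (W.region i d.snd).ncard < (W.region i d.fst).ncard := by
  have hint := W.isInternalEdge_of_lab h
  have hL : G.rot.leftFace d ≠ G.outerFace := fun hc => by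
    obtain ⟨i, hi⟩ := W.leftFace_eq_outerFace_iff.1 hc
    exact ((G.isInternalEdge_iff _).1 hint i).2 hi
  have hR : G.rot.leftFace d.symm ≠ G.outerFace := fun hc => by
    obtain ⟨i, hi⟩ := W.leftFace_eq_outerFace_iff.1 hc
    exact ((G.isInternalEdge_iff _).1 (G.isInternalEdge_symm.2 hint) i).2 hi
  have e1 : j + 2 + 1 = j := by fin_cases j <;> rfl
  -- On either side of the edge, the face has its corner labelled j at the head, hence in region j
  -- of the head. Its corner at the tail has label j + 2 on the left and j + 1 on the right.
  have l1 : G.rot.leftFace d ∈ W.region (j + 2) d.fst := W.mem_region_fst hL (W.ang_of_lab h)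
  have l2 : G.rot.leftFace d ∈ W.region j d.snd := by
    rw [← G.rot.leftFace_facePerm, ← G.rot.facePerm_fst]
    refine W.mem_region_fst (by rwa [G.rot.leftFace_facePerm]) ?_
    rw [W.ang_facePerm, W.ang_of_lab h, e1]
  have r1 : G.rot.leftFace d.symm ∈ W.region j d.snd :=
    W.mem_region_fst (d := d.symm) hR
      (W.ang_of_lab_symm (by rw [SimpleGraph.Dart.symm_symm]; exact h))
  have r2 : G.rot.leftFace d.symm ∈ W.region (j + 1) d.fst := by
    have hf : (G.rot.facePerm d.symm).fst = d.fst := G.rot.facePerm_fst d.symm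
    rw [← G.rot.leftFace_facePerm, ← hf]
    refine W.mem_region_fst (by rwa [G.rot.leftFace_facePerm]) ?_
    rw [W.ang_facePerm, W.ang_of_lab_symm (by rw [SimpleGraph.Dart.symm_symm]; exact h)]
  -- A face that belongs to a different region at x cannot belong to region i there, which makes the
  -- inclusion proper.
  have hlt : ∀ {i k : Fin 3} {f : G.rot.Face} {x y : V}, W.region i x ⊆ W.region i y →
      f ∈ W.region i y → f ∈ W.region k x → i ≠ k →
      (W.region i x).ncard < (W.region i y).ncard := by
    intro i k f x y hsub h1 h2 hik
    exact Set.ncard_lt_ncard ⟨hsub, fun hc => hik ((W.region_cases x h1.1).2 i k (hc h1) h2)⟩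
      (Set.toFinite _)
  refine ⟨hlt (W.region_subset_of_ascends (.inl h)) l2 l1 (by fin_cases j <;> simp), ?_⟩
  intro i hij
  have hsub := W.region_subset_of_ascends (W.ascends_of_lab_ne h hij.symm)
  have hi : i = j + 1 ∨ i = j + 2 := by
    revert hij
    fin_cases i <;> fin_cases j <;> simp
  rcases hi with rfl | rfl
  · exact hlt hsub r2 r1 hij
  · exact hlt hsub l1 l2 hij

/-- The signs of the changes of the three region sizes are those of x + y reversed, of x, and of y.
-/
lemma inSector_of_lab {j : Fin 3} {d : G.graph.Dart} (h : W.lab d = some j) :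
    InSector j (W.drawing d.snd - W.drawing d.fst) := by
  have h1 := W.ncard_region_lt h
  have a := W.ncard_region_sum d.fst
  have b := W.ncard_region_sum d.snd
  have hlt := h1.1
  have h0 := h1.2 0
  have h1' := h1.2 1
  have h2 := h1.2 2
  fin_cases j
  · have x := h1' (by simp)
    have y := h2 (by simp)
    change (_ : ℤ) - _ < 0 ∧ (_ : ℤ) - _ < 0
    simp only [drawing]
    omega
  · have x := h0 (by simp)
    have y := h2 (by simp)
    change 0 < (_ : ℤ) - _ ∧ (_ : ℤ) - _ < 0 ∧ 0 < ((_ : ℤ) - _) + (_ - _)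
    simp only [drawing]
    simp at hlt
    omega
  · have x := h0 (by simp)
    have y := h1' (by simp)
    change (_ : ℤ) - _ < 0 ∧ 0 < (_ : ℤ) - _ ∧ 0 < ((_ : ℤ) - _) + (_ - _)
    simp only [drawing]
    simp at hlt
    omega

lemma inSector_unique {i j : Fin 3} {p : ℤ × ℤ} (hi : InSector i p) (hj : InSector j p) :
    i = j := by
  obtain ⟨x, y⟩ := p
  fin_cases i <;> fin_cases j <;> simp [InSector] at hi hj ⊢ <;> omega

lemma not_inSector_neg {i j : Fin 3} {p : ℤ × ℤ} (hi : InSector i p) : ¬ InSector j (-p) := by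
  obtain ⟨x, y⟩ := p
  intro hj
  rw [Prod.neg_mk] at hj
  fin_cases i <;> fin_cases j <;> simp [InSector] at hi hj <;> omega

/-- The three sectors and their opposites are pairwise disjoint, so the slope of an internal edge
admits one direction and one color only. -/
lemma lab_iff_inSector (d : G.graph.Dart) (i : Fin 3) :
    W.lab d = some i ↔ InSector i (W.drawing d.snd - W.drawing d.fst) := by
  refine ⟨W.inSector_of_lab, fun h => ?_⟩
  have hD := (W.draws_iff _).2 rfl
  -- Outer edges are horizontal, vertical or antidiagonal, and these directions only bound the open
  -- sectors.
  have hout : ∀ j k, ¬ InSector i (W.drawing (G.outer j) - W.drawing (G.outer k)) := by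
    have h1 := hD.outer₁
    have h2 := hD.outer₂
    have h3 := hD.outer₃
    intro j k
    fin_cases j <;> fin_cases k <;> simp only [Fin.zero_eta, Fin.mk_one, Fin.reduceFinMk, h1, h2,
      h3, Prod.mk_sub_mk] <;> fin_cases i <;> simp [InSector] <;> omega
  rcases W.dart_cases d with ⟨j, hj⟩ | ⟨j, hj⟩ | ⟨j, rfl⟩ | ⟨j, rfl⟩
  · rw [hj, inSector_unique h (W.inSector_of_lab hj)]
  · have h' := W.inSector_of_lab hj
    have : W.drawing d.symm.snd - W.drawing d.symm.fst =
        -(W.drawing d.snd - W.drawing d.fst) := by simp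
    rw [this] at h'
    exact absurd h' (not_inSector_neg h)
  · exact absurd h (hout _ _)
  · exact absurd h (hout _ _)

end SchnyderWood

end Schnyder


namespace Schnyder

namespace SchnyderWood

variable {V : Type*} [Finite V] {G : MaximalPlaneGraph V} (W : SchnyderWood G)

/-! ### Counting faces along the trees -/

open Classical in
/-- The parent of a vertex in the tree of color `i`. -/
noncomputable def parent (i : Fin 3) (v : V) : Option V :=
  if h : G.IsInternalVertex v then some (W.out h i).snd else none

lemma parent_of_internal {i : Fin 3} {v : V} (h : G.IsInternalVertex v) :
    W.parent i v = some (W.out h i).snd := dif_pos h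

lemma parent_outer (i j : Fin 3) : W.parent i (G.outer j) = none := dif_neg fun h => h j rfl

lemma parent_eq_some_iff {i : Fin 3} {c v : V} :
    W.parent i c = some v ↔ Via (fun d => W.lab d = some i) c v := by
  constructor
  · intro h
    by_cases hc : G.IsInternalVertex c
    · rw [W.parent_of_internal hc] at h
      exact ⟨_, W.lab_out hc i, W.out_fst hc i, Option.some.inj h⟩
    · rw [parent, dif_neg hc] at h; cases h
  · rintro ⟨d, hd, rfl, rfl⟩
    rw [W.parent_of_internal (W.fst_internal hd), ← W.eq_out _ rfl hd]

lemma parent_of_lab {i : Fin 3} {d : G.graph.Dart} (h : W.lab d = some i) :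
    W.parent i d.fst = some d.snd := W.parent_eq_some_iff.2 ⟨d, h, rfl, rfl⟩

lemma anc_acyclic {i : Fin 3} {c v : V} (h : Via (fun d => W.lab d = some i) c v) :
    ¬ W.Anc i v c := by
  intro hanc
  obtain ⟨d, hd, h⟩ := h
  exact W.ascends_acyclic i c (.head' ⟨d, .inl hd, h⟩ (W.le_of_anc hanc))

/-- The internal faces whose angle labelled `i` is at a descendant of `v` in the tree of color `i`. -/
def below (i : Fin 3) (v : V) : Set G.rot.Face :=
  {f | f ≠ G.outerFace ∧ W.Anc i (W.corner f i).fst v}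

lemma below_outer_ne {i j : Fin 3} (hij : i ≠ j) : W.below i (G.outer j) = ∅ := by
  rw [← W.region_outer_ne hij, Set.eq_empty_of_forall_notMem (s := W.below i (G.outer j)),
    W.region_outer_ne hij]
  intro f hf
  have : f ∈ W.region i (G.outer j) := ⟨hf.1, W.le_of_anc hf.2⟩
  rw [W.region_outer_ne hij] at this
  exact this

/-- There is one more angle labelled `i` at a vertex than there are incoming edges of color `i`. -/
lemma ncard_corner_fst {i : Fin 3} {v : V} (hv : ∀ j, j ≠ i → v ≠ G.outer j) :
    {f : G.rot.Face | f ≠ G.outerFace ∧ (W.corner f i).fst = v}.ncard =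
      {c | W.parent i c = some v}.ncard + 1 := by
  have e3 : i + 1 + 2 = i := by fin_cases i <;> rfl
  set A : Set G.graph.Dart := {d | d.fst = v ∧ W.lab d.symm = some i} with hA
  -- The corners labelled i open at the incoming darts of color i and at one further dart `b`: the
  -- outgoing one of color i + 1, or the outer dart if v is the root.
  have hb : ∃ b : G.graph.Dart, b ∉ A ∧ {f : G.rot.Face | f ≠ G.outerFace ∧
      (W.corner f i).fst = v} = G.rot.leftFace '' insert b A ∧
      ∀ d ∈ insert b A, W.ang d = i := by
    have hAang : ∀ d ∈ A, W.ang d = i := fun d hd => W.ang_of_lab_symm hd.2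
    have hAout : ∀ d ∈ A, G.rot.leftFace d ≠ G.outerFace := by
      rintro d hd h
      obtain ⟨j, rfl⟩ := W.leftFace_eq_outerFace_iff.1 h
      have := hd.2
      rw [SimpleGraph.Dart.symm_symm, lab_outerDart] at this
      cases this
    have main : ∀ b : G.graph.Dart, b ∉ A → b.fst = v → W.ang b = i →
        G.rot.leftFace b ≠ G.outerFace →
        (∀ d : G.graph.Dart, d.fst = v → W.ang d = i → G.rot.leftFace d ≠ G.outerFace →
          d = b ∨ d ∈ A) →
        ∃ b : G.graph.Dart, b ∉ A ∧ {f : G.rot.Face | f ≠ G.outerFace ∧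
          (W.corner f i).fst = v} = G.rot.leftFace '' insert b A ∧
          ∀ d ∈ insert b A, W.ang d = i := by
      intro b hbA hbv hba hbo hall
      refine ⟨b, hbA, ?_, ?_⟩
      · ext f
        constructor
        · rintro ⟨hf, hfv⟩
          exact ⟨W.corner f i, hall _ hfv (W.ang_corner f i) (by rwa [leftFace_corner]),
            W.leftFace_corner f i⟩
        · rintro ⟨d, rfl | hd, rfl⟩
          · exact ⟨hbo, by rw [W.corner_eq rfl hba, hbv]⟩
          · exact ⟨hAout d hd, by rw [W.corner_eq rfl (hAang d hd), hd.1]⟩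
      · rintro d (rfl | hd)
        · exact hba
        · exact hAang d hd
    by_cases hx : G.IsInternalVertex v
    · have hl := W.lab_out hx (i + 1)
      refine main (W.out hx (i + 1)) ?_ (W.out_fst hx _) ?_ ?_ ?_
      · intro h
        have := h.2
        rw [W.lab_symm_of_lab hl] at this
        cases this
      · rw [W.ang_of_lab hl, e3]
      · intro h
        obtain ⟨j, hj⟩ := W.leftFace_eq_outerFace_iff.1 h
        rw [hj, lab_outerDart_symm] at hl
        cases hl
      · intro d hd ha _
        rcases W.lab_eq_of_ang (hd ▸ hx) (ha.trans e3.symm) with h | h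
        · exact .inl (W.eq_out hx hd h)
        · exact .inr ⟨hd, by rw [h, e3]⟩
    · obtain ⟨j, rfl⟩ := G.not_isInternalVertex.1 hx
      have hj : j = i := by
        by_contra hji
        exact hv j hji rfl
      subst hj
      refine main (G.outerDart j) ?_ rfl (W.ang_outerDart j) ?_ ?_
      · intro h
        have := h.2
        rw [lab_outerDart_symm] at this
        cases this
      · intro h
        obtain ⟨k, hk⟩ := W.leftFace_eq_outerFace_iff.1 h
        exact outerDart_ne_symm _ _ hk
      · intro d hd ha ho
        rcases W.dart_cases_outer hd with h | h | h
        · exact .inr ⟨hd, h⟩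
        · exact .inl h
        · rw [h, G.leftFace_outerDart_symm] at ho
          exact absurd rfl ho
  obtain ⟨b, hbA, hS, hang⟩ := hb
  rw [hS, Set.InjOn.ncard_image, Set.ncard_insert_of_notMem hbA (Set.toFinite _)]
  · congr 1
    have : {c | W.parent i c = some v} = (fun d : G.graph.Dart => d.snd) '' A := by
      ext c
      constructor
      · intro hc
        obtain ⟨d, hd, rfl, rfl⟩ := W.parent_eq_some_iff.1 hc
        exact ⟨d.symm, ⟨rfl, by rw [SimpleGraph.Dart.symm_symm]; exact hd⟩, rfl⟩
      · rintro ⟨d, ⟨rfl, hd⟩, rfl⟩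
        exact W.parent_of_lab hd
    rw [this, Set.InjOn.ncard_image]
    rintro d ⟨hd, -⟩ d' ⟨hd', -⟩ h
    exact SimpleGraph.Dart.ext _ _ (Prod.ext (hd.trans hd'.symm) h)
  · intro d hd d' hd' h
    exact W.dart_eq_of_leftFace_of_ang h ((hang d hd).trans (hang d' hd').symm)

/-- The children of a vertex in the tree of color `i`. -/
noncomputable def children (i : Fin 3) (v : V) : Finset V :=
  (Set.toFinite {c | W.parent i c = some v}).toFinset

lemma mem_children {i : Fin 3} {c v : V} : c ∈ W.children i v ↔ W.parent i c = some v := by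
  simp [children]

/-- The path of color i from a corner ends at v itself or enters it through a unique child. A child
c accounts for the faces below c and for one corner at v, and one corner at v is left over. -/
lemma ncard_below {i : Fin 3} {v : V} (hv : ∀ j, j ≠ i → v ≠ G.outer j) :
    (W.below i v).ncard = 1 + ∑ c ∈ W.children i v, ((W.below i c).ncard + 1) := by
  classical
  have hU : W.below i v = {f : G.rot.Face | f ≠ G.outerFace ∧ (W.corner f i).fst = v} ∪
      ⋃ c ∈ W.children i v, W.below i c := by
    ext f
    simp only [below, Set.mem_ofPred_eq, Set.mem_union, Set.mem_iUnion, mem_children, exists_prop]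
    constructor
    · rintro ⟨hf, ha⟩
      rcases Relation.ReflTransGen.cases_tail ha with h | ⟨c, hac, hcv⟩
      · exact .inl ⟨hf, h.symm⟩
      · exact .inr ⟨c, W.parent_eq_some_iff.2 hcv, hf, hac⟩
    · rintro (⟨hf, rfl⟩ | ⟨c, hc, hf, ha⟩)
      · exact ⟨hf, .refl⟩
      · exact ⟨hf, ha.tail (W.parent_eq_some_iff.1 hc)⟩
  have hbU : ∀ s : Finset V, s ⊆ W.children i v →
      (⋃ c ∈ s, W.below i c).ncard = ∑ c ∈ s, (W.below i c).ncard := by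
    intro s
    induction s using Finset.induction_on with
    | empty => intro _; simp
    | insert a s ha ih =>
      intro hs
      rw [Finset.insert_subset_iff] at hs
      rw [Finset.sum_insert ha, ← ih hs.2, Finset.set_biUnion_insert,
        Set.ncard_union_eq _ (Set.toFinite _) (Set.toFinite _)]
      rw [Set.disjoint_left]
      intro f hf hf'
      simp only [Set.mem_iUnion, exists_prop] at hf'
      obtain ⟨c, hc, hf'⟩ := hf'
      have hne : a ≠ c := by rintro rfl; exact ha hc
      have pa := W.parent_eq_some_iff.1 (W.mem_children.1 hs.1)
      have pc := W.parent_eq_some_iff.1 (W.mem_children.1 (hs.2 hc))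
      have key : ∀ {a c : V}, Via (fun d => W.lab d = some i) a v →
          Via (fun d => W.lab d = some i) c v → a ≠ c → ¬ W.Anc i a c := by
        intro a c pa pc hne h
        rcases Relation.ReflTransGen.cases_head h with h | ⟨b, hb, hbc⟩
        · exact hne h
        · have : b = v := by
            have h1 := W.parent_eq_some_iff.2 hb
            have h2 := W.parent_eq_some_iff.2 pa
            rw [h1] at h2
            exact Option.some.inj h2
          rw [this] at hbc
          exact W.anc_acyclic pc hbc
      rcases W.anc_total hf.2 hf'.2 with h | h
      · exact key pa pc hne h
      · exact key pc pa hne.symm h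
  rw [hU, Set.ncard_union_eq _ (Set.toFinite _) (Set.toFinite _), W.ncard_corner_fst hv,
    hbU _ subset_rfl, Finset.sum_add_distrib]
  · have : {c | W.parent i c = some v}.ncard = (W.children i v).card :=
      Set.ncard_eq_toFinset_card _ _
    rw [this]
    simp
    ring
  · rw [Set.disjoint_left]
    rintro f ⟨-, rfl⟩ hf'
    simp only [Set.mem_iUnion, exists_prop] at hf'
    obtain ⟨c, hc, -, hf'⟩ := hf'
    exact W.anc_acyclic (W.parent_eq_some_iff.1 (W.mem_children.1 hc)) hf'

open Classical in
/-- The number of faces below `v` in the tree of color `i`, or `1` if `v` is another outer vertex. -/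
noncomputable def treeN (i : Fin 3) (v : V) : ℕ :=
  if ∃ j, j ≠ i ∧ v = G.outer j then 1 else (W.below i v).ncard

lemma treeN_of_internal {i : Fin 3} {v : V} (hv : G.IsInternalVertex v) :
    W.treeN i v = (W.below i v).ncard :=
  if_neg fun ⟨j, _, h⟩ => hv j h

lemma treeN_outer {i j : Fin 3} (hij : j ≠ i) : W.treeN i (G.outer j) = 1 :=
  if_pos ⟨j, hij, rfl⟩

/-- An outer vertex of another color has no children in the tree and no faces below it. The
conventional value 1 makes it obey the recursion of a leaf, so that the program needs no exception.
-/
lemma treeN_eq (i : Fin 3) (v : V) :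
    W.treeN i v = 1 + ∑ c ∈ W.children i v, (W.treeN i c + 1) := by
  by_cases h : ∃ j, j ≠ i ∧ v = G.outer j
  · obtain ⟨j, hj, rfl⟩ := h
    have : W.children i (G.outer j) = ∅ := by
      refine Finset.eq_empty_of_forall_notMem fun c hc => ?_
      obtain ⟨d, hd, -, h⟩ := W.parent_eq_some_iff.1 (W.mem_children.1 hc)
      exact hj (W.lab_of_snd_outer hd h).symm
    rw [this, W.treeN_outer hj]
    simp
  · rw [treeN, if_neg h, W.ncard_below (fun j hj hv => h ⟨j, hj, hv⟩)]
    congr 1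
    refine Finset.sum_congr rfl fun c hc => ?_
    obtain ⟨d, hd, rfl, -⟩ := W.parent_eq_some_iff.1 (W.mem_children.1 hc)
    rw [W.treeN_of_internal (W.fst_internal hd)]

lemma ncard_le (s : Set G.rot.Face) (W : SchnyderWood G) : s.ncard ≤ 2 * Nat.card V := by
  have h1 := Set.ncard_le_card s
  have h2 := W.card_face
  omega

lemma treeN_le (i : Fin 3) (v : V) : W.treeN i v ≤ 2 * Nat.card V + 1 := by
  rw [treeN]
  split
  · omega
  · exact (ncard_le _ W).trans (Nat.le_succ _)

/-- The internal faces below some vertex of the path of color `j` that starts at `w`. -/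
def belowPath (i j : Fin 3) (w : V) : Set G.rot.Face :=
  {f | f ≠ G.outerFace ∧ ∃ v, W.Anc i (W.corner f i).fst v ∧ W.Anc j w v}

/-- The sets below different vertices of a path are disjoint. Otherwise one of the two vertices
would be reached from the other along color i. Together with the path of color j this contradicts
antisymmetry in the order of color i or, in the opposite direction, of the third color. -/
lemma ncard_belowPath {i j : Fin 3} (hij : i ≠ j) {w p : V} (hp : W.parent j w = some p) :
    (W.belowPath i j w).ncard = (W.below i w).ncard + (W.belowPath i j p).ncard := by
  have hwp := W.parent_eq_some_iff.1 hp
  rw [← Set.ncard_union_eq _ (Set.toFinite _) (Set.toFinite _)]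
  · congr 1
    ext f
    constructor
    · rintro ⟨hf, v, ha, hv⟩
      rcases Relation.ReflTransGen.cases_head hv with rfl | ⟨q, hq, hqv⟩
      · exact .inl ⟨hf, ha⟩
      · have := W.parent_eq_some_iff.2 hq
        rw [hp] at this
        cases this
        exact .inr ⟨hf, v, ha, hqv⟩
    · rintro (⟨hf, ha⟩ | ⟨hf, v, ha, hv⟩)
      · exact ⟨hf, w, ha, .refl⟩
      · exact ⟨hf, v, ha, .head hwp hv⟩
  · rw [Set.disjoint_left]
    rintro f ⟨hf, ha⟩ ⟨-, v, ha', hv⟩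
    have hwv : W.Anc j w v := .head hwp hv
    have hne : v ≠ w := by
      rintro rfl
      exact W.anc_acyclic hwp hv
    obtain ⟨k, hki, hkj⟩ : ∃ k, i ≠ k ∧ j ≠ k := by
      revert hij; fin_cases i <;> fin_cases j <;> decide
    rcases W.anc_total ha ha' with h | h
    · exact hne (W.le_antisymm (W.le_of_anc_ne hij.symm hwv) (W.le_of_anc h))
    · exact hne (W.le_antisymm (W.le_of_anc_ne hkj hwv) (W.le_of_anc_ne hki h))

lemma belowPath_outer {i j : Fin 3} (hij : i ≠ j) : W.belowPath i j (G.outer j) = ∅ := by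
  refine Set.eq_empty_of_forall_notMem ?_
  rintro f ⟨hf, v, ha, hv⟩
  rcases Relation.ReflTransGen.cases_head hv with rfl | ⟨q, hq, -⟩
  · have : f ∈ W.below i (G.outer j) := ⟨hf, ha⟩
    rw [W.below_outer_ne hij] at this
    exact this
  · have := W.parent_eq_some_iff.2 hq
    rw [parent_outer] at this
    cases this

open Classical in
/-- The sum of `treeN i` along the path of color `j` that starts at `w`. -/
noncomputable def treeQ (i j : Fin 3) (w : V) : ℕ :=
  if ∃ k, k ≠ j ∧ w = G.outer k then W.treeN i w else (W.belowPath i j w).ncard + 1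

lemma treeQ_of_internal {i j : Fin 3} {w : V} (hw : G.IsInternalVertex w) :
    W.treeQ i j w = (W.belowPath i j w).ncard + 1 :=
  if_neg fun ⟨k, _, h⟩ => hw k h

lemma treeQ_outer_self {i j : Fin 3} (hij : i ≠ j) : W.treeQ i j (G.outer j) = 1 := by
  rw [treeQ, if_neg, W.belowPath_outer hij]
  · simp
  · rintro ⟨k, hk, h⟩
    exact hk (G.outer_injective h).symm

/-- The summand 1 in `treeQ` is the conventional `treeN` of the outer vertex at which the path ends.
-/
lemma treeQ_eq {i j : Fin 3} (hij : i ≠ j) (w : V) :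
    W.treeQ i j w = W.treeN i w + (W.parent j w).elim 0 (W.treeQ i j) := by
  by_cases hw : G.IsInternalVertex w
  · have hp := W.parent_of_internal (i := j) hw
    rw [W.treeQ_of_internal hw, W.treeN_of_internal hw, W.ncard_belowPath hij hp, hp,
      Option.elim_some, add_assoc]
    congr 1
    by_cases h : G.IsInternalVertex (W.out hw j).snd
    · rw [W.treeQ_of_internal h]
    · obtain ⟨k, hk⟩ := G.not_isInternalVertex.1 h
      have := W.lab_of_snd_outer (W.lab_out hw j) hk
      rw [hk, ← this, W.treeQ_outer_self hij, W.belowPath_outer hij]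
      simp
  · obtain ⟨k, rfl⟩ := G.not_isInternalVertex.1 hw
    rw [parent_outer, Option.elim_none]
    by_cases hk : k = j
    · subst hk
      rw [W.treeQ_outer_self hij, W.treeN_outer hij.symm]
    · rw [treeQ, if_pos ⟨k, hk, rfl⟩, add_zero]

lemma treeQ_le (i j : Fin 3) (v : V) : W.treeQ i j v ≤ 2 * Nat.card V + 1 := by
  rw [treeQ]
  split
  · exact W.treeN_le i v
  · exact Nat.succ_le_succ (ncard_le _ W)

/-- Inclusion and exclusion: a face is enclosed if and only if its path of color i meets one of the
two bounding paths. It meets both only through w. The 2 stems from the ends of the two paths. -/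
lemma treeQ_add_treeQ {i : Fin 3} {w : V} (hw : G.IsInternalVertex w) :
    W.treeQ i (i + 1) w + W.treeQ i (i + 2) w = (W.region i w).ncard + W.treeN i w + 2 := by
  have n1 : i + 1 ≠ i := by fin_cases i <;> simp
  have n2 : i + 2 ≠ i := by fin_cases i <;> simp
  have n12 : i + 1 ≠ i + 2 := by fin_cases i <;> simp
  rw [W.treeQ_of_internal hw, W.treeQ_of_internal hw, W.treeN_of_internal hw]
  have hU : W.region i w = W.belowPath i (i + 1) w ∪ W.belowPath i (i + 2) w := by
    ext f
    constructor
    · intro hf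
      choose P hP using W.exists_isTreePath hw
      have hP' : ∀ i, ∀ d ∈ (P i).darts, W.lab d = some i := fun i => (hP i).2
      by_contra hcon
      have hr := W.reach_of_forall hP' (i := i) hf.1 fun v hv =>
        ⟨fun h => hcon (.inl ⟨hf.1, v, hv, h⟩), fun h => hcon (.inr ⟨hf.1, v, hv, h⟩)⟩
      rw [← W.setOf_not_reach_eq_region hP' hw] at hf
      exact hf hr
    · rintro (⟨hf, v, ha, hv⟩ | ⟨hf, v, ha, hv⟩)
      · exact ⟨hf, W.le_of_anc_of_anc ha (.inl hv)⟩
      · exact ⟨hf, W.le_of_anc_of_anc ha (.inr hv)⟩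
  have hI : W.below i w = W.belowPath i (i + 1) w ∩ W.belowPath i (i + 2) w := by
    ext f
    constructor
    · rintro ⟨hf, ha⟩
      exact ⟨⟨hf, w, ha, .refl⟩, ⟨hf, w, ha, .refl⟩⟩
    · rintro ⟨⟨hf, v, ha, hv⟩, ⟨-, v', ha', hv'⟩⟩
      -- If color i led from a vertex v of one path to a vertex v' of the other, then in the order
      -- of the color of the latter v' ≤ v ≤ w ≤ v', so v' = w.
      have key : ∀ {j k : Fin 3} {v v' : V}, i ≠ j → i ≠ k → j ≠ k → W.Anc j w v → W.Anc k w v' →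
          W.Anc i v v' → v' = w := by
        intro j k v v' hij hik hjk hv hv' h
        exact W.le_antisymm (i := k) ((W.le_of_anc_ne hik h).trans (W.le_of_anc_ne hjk hv))
          (W.le_of_anc hv')
      rcases W.anc_total ha ha' with h | h
      · rw [key n1.symm n2.symm n12 hv hv' h] at ha'
        exact ⟨hf, ha'⟩
      · rw [key n2.symm n1.symm n12.symm hv' hv h] at ha
        exact ⟨hf, ha⟩
  have := Set.ncard_union_add_ncard_inter (W.belowPath i (i + 1) w) (W.belowPath i (i + 2) w)
  rw [← hU, ← hI] at this
  omega

end SchnyderWood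


/-! ### A structured language for the random access machine -/

/-- Registers and numbered arrays. -/
structure Data : Type where
  reg : ℕ → ℕ
  arr : ℕ → ℕ → ℕ

namespace Data

def set (σ : Data) (r v : ℕ) : Data := ⟨Function.update σ.reg r v, σ.arr⟩

def put (σ : Data) (s k v : ℕ) : Data :=
  ⟨σ.reg, Function.update σ.arr s (Function.update (σ.arr s) k v)⟩

end Data

/-- Commands; `load r s a` reads the entry of array `s` whose index is in register `a`, `store s a b`
writes register `b` there, and `loop k N c` executes `c` for all values of the counter `k` below the
value of register `N`. -/
inductive Cmd : Type
  | const (r : ℕ) (c : Fin 8)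
  | add (r a b : ℕ)
  | sub (r a b : ℕ)
  | load (r s a : ℕ)
  | store (s a b : ℕ)
  | seq (c d : Cmd)
  | ifLt (a b : ℕ) (c : Cmd)
  | loop (k N : ℕ) (c : Cmd)

namespace Cmd

/-- The state before the `n`-th execution of the body of a loop. -/
def iter (f : Data → Data) (k : ℕ) : ℕ → Data → Data
  | 0, σ => σ.set k 0
  | n + 1, σ => (f (iter f k n σ)).set k (n + 1)

/-- The effect of a command; sums are cut off at `cap`. -/
def eval (cap : ℕ) : Cmd → Data → Data
  | const r c, σ => σ.set r c
  | add r a b, σ => σ.set r (min (σ.reg a + σ.reg b) cap)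
  | sub r a b, σ => σ.set r (σ.reg a - σ.reg b)
  | load r s a, σ => σ.set r (σ.arr s (σ.reg a))
  | store s a b, σ => σ.put s (σ.reg a) (σ.reg b)
  | seq c d, σ => eval cap d (eval cap c σ)
  | ifLt a b c, σ => if σ.reg a < σ.reg b then eval cap c σ else σ
  | loop k N c, σ => iter (eval cap c) k (σ.reg N) σ

/-- The command may change register `r`. -/
def writes : Cmd → ℕ → Bool
  | const r _, q => r == q
  | add r _ _, q => r == q
  | sub r _ _, q => r == q
  | load r _ _, q => r == q
  | store _ _ _, _ => false
  | seq c d, q => c.writes q || d.writes q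
  | ifLt _ _ c, q => c.writes q
  | loop k _ c, q => k == q || c.writes q

/-- Few arrays, and loops do not change their counter and their bound. -/
def wf : Cmd → Bool
  | const _ _ => true
  | add _ _ _ => true
  | sub _ _ _ => true
  | load _ s _ => s < 32
  | store s _ _ => s < 32
  | seq c d => c.wf && d.wf
  | ifLt _ _ c => c.wf
  | loop k N c => c.wf && !c.writes k && !c.writes N && k != N

/-- No loops. -/
def flat : Cmd → Bool
  | seq c d => c.flat && d.flat
  | ifLt _ _ c => c.flat
  | loop _ _ _ => false
  | _ => true

/-- No nested loops. -/
def unnested : Cmd → Bool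
  | seq c d => c.unnested && d.unnested
  | ifLt _ _ c => c.unnested
  | loop _ _ c => c.flat
  | _ => true

/-- The length of the compiled code. -/
def size : Cmd → ℕ
  | const _ _ => 1
  | add _ _ _ => 3
  | sub _ _ _ => 1
  | load _ s _ => s + 2
  | store s _ _ => s + 2
  | seq c d => c.size + d.size
  | ifLt _ _ c => c.size + 2
  | loop _ _ c => c.size + 5

/-- A bound for the number of steps, if all numbers are at most `K`. -/
def cost (K : ℕ) : Cmd → ℕ
  | const _ _ => 1
  | add _ _ _ => 3
  | sub _ _ _ => 1
  | load _ s _ => s + 2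
  | store s _ _ => s + 2
  | seq c d => c.cost K + d.cost K
  | ifLt _ _ c => c.cost K + 2
  | loop _ _ c => K * (c.cost K + 3) + 3

/-- The code that puts the address of an array entry into register `0`. -/
def address (s a : ℕ) : Program := .add 0 (a + 5) 3 :: List.replicate s (.add 0 0 2)

/-- The compiled code, to be placed at line `o`. Register `0` holds addresses, registers `1` to `4`
hold `cap`, `cap + 1`, `0` and `1`, and register `r` of the command becomes register `r + 5`. -/
def compile : Cmd → ℕ → Program
  | const r c, _ => [.const (r + 5) c]
  | add r a b, o => [.add (r + 5) (a + 5) (b + 5), .jumpLt (r + 5) 1 (o + 3), .add (r + 5) 1 3]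
  | sub r a b, _ => [.sub (r + 5) (a + 5) (b + 5)]
  | load r s a, _ => address s a ++ [.load (r + 5) 0]
  | store s a b, _ => address s a ++ [.store 0 (b + 5)]
  | seq c d, o => c.compile o ++ d.compile (o + c.size)
  | ifLt a b c, o =>
      .jumpLt (a + 5) (b + 5) (o + 2) :: .jumpLt 3 4 (o + (c.size + 2)) :: c.compile (o + 2)
  | loop k N c, o =>
      .const (k + 5) 0 :: .jumpLt (k + 5) (N + 5) (o + 3) :: .jumpLt 3 4 (o + (c.size + 5)) ::
        (c.compile (o + 3) ++ [.add (k + 5) (k + 5) 4, .jumpLt 3 4 (o + 1)])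

lemma length_address (s a : ℕ) : (address s a).length = s + 1 := by simp [address]

lemma length_compile (c : Cmd) : ∀ o, (c.compile o).length = c.size := by
  induction c with
  | seq c d ihc ihd => intro o; simp [compile, size, ihc, ihd]
  | ifLt a b c ih => intro o; simp [compile, size, ih]
  | loop k N c ih => intro o; simp [compile, size, ih]
  | load r s a => intro o; simp [compile, size, length_address]
  | store s a b => intro o; simp [compile, size, length_address]
  | _ => intro o; rfl

lemma eval_reg_of_not_writes (cap : ℕ) {q : ℕ} (c : Cmd) : c.writes q = false →
    ∀ σ, (c.eval cap σ).reg q = σ.reg q := by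
  induction c with
  | seq c d ihc ihd =>
    intro h σ
    simp only [writes, Bool.or_eq_false_iff] at h
    rw [eval, ihd h.2, ihc h.1]
  | ifLt a b c ih =>
    intro h σ
    rw [eval]
    split
    · exact ih h σ
    · rfl
  | loop k N c ih =>
    intro h σ
    simp only [writes, Bool.or_eq_false_iff, beq_eq_false_iff_ne] at h
    have : ∀ n, (iter (eval cap c) k n σ).reg q = σ.reg q := by
      intro n
      induction n with
      | zero => simp [iter, Data.set, Function.update_of_ne h.1.symm]
      | succ n ihn =>
        simp only [iter, Data.set, Function.update_of_ne h.1.symm]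
        rw [ih h.2, ihn]
    exact this _
  | store s a b => intro _ σ; rfl
  | _ =>
    intro h σ
    simp only [writes, beq_eq_false_iff_ne] at h
    simp [eval, Data.set, Function.update_of_ne h.symm]

lemma cost_flat {c : Cmd} (h : c.flat = true) (K L : ℕ) : c.cost K = c.cost L := by
  induction c with
  | seq c d ihc ihd =>
    simp only [flat, Bool.and_eq_true] at h
    rw [cost, cost, ihc h.1, ihd h.2]
  | ifLt a b c ih => rw [cost, cost, ih h]
  | loop k N c ih => cases h
  | _ => rfl

/-- The body of a loop contains no loop, so its cost does not depend on K, and the total is affine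
in K. -/
lemma cost_le {c : Cmd} (h : c.unnested = true) (K : ℕ) : c.cost K ≤ c.cost 1 * (K + 1) := by
  induction c with
  | seq c d ihc ihd =>
    simp only [unnested, Bool.and_eq_true] at h
    have h1 := ihc h.1
    have h2 := ihd h.2
    simp only [cost]
    linarith
  | ifLt a b c ih =>
    have := ih h
    simp only [cost]
    nlinarith
  | loop k N c ih =>
    simp only [cost, cost_flat (c := c) h K 1]
    nlinarith [Nat.zero_le (cost 1 c), Nat.zero_le K]
  | _ => simp only [cost]; nlinarith

end Cmd

/-! ### Runs of the machine -/

namespace Program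

/-- All numbers in the state are at most `B`. -/
def Bounded (B : ℕ) (s : State) : Prop := ∀ a, s.reg a ≤ B ∧ s.mem a ≤ B

/-- The program gets from `s` to `s'` in `t` steps, and all numbers on the way are at most `B`. -/
def Runs (p : Program) (B : ℕ) (s : State) (t : ℕ) (s' : State) : Prop :=
  p.step^[t] s = s' ∧ ∀ t' ≤ t, Bounded B (p.step^[t'] s)

lemma Runs.trans {p : Program} {B t₁ t₂ : ℕ} {s s' s'' : State} (h : p.Runs B s t₁ s')
    (h' : p.Runs B s' t₂ s'') : p.Runs B s (t₁ + t₂) s'' := by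
  refine ⟨by rw [add_comm, Function.iterate_add_apply, h.1, h'.1], fun t' ht' => ?_⟩
  rcases Nat.le_total t' t₁ with h1 | h1
  · exact h.2 t' h1
  · obtain ⟨k, rfl⟩ := Nat.exists_eq_add_of_le h1
    rw [add_comm, Function.iterate_add_apply, h.1]
    exact h'.2 k (by omega)

lemma Runs.single {p : Program} {B : ℕ} {s : State} {ins : Instr} (hp : p[s.pc]? = some ins)
    (h : Bounded B s) (hex : Bounded B (ins.exec s)) : p.Runs B s 1 (ins.exec s) := by
  have hs : p.step s = ins.exec s := by rw [step, hp]
  refine ⟨hs, fun t' ht' => ?_⟩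
  interval_cases t'
  · exact h
  · rw [Function.iterate_one, hs]; exact hex

/-- The program has the code `l` from line `o` on. -/
def CodeAt (p : Program) (o : ℕ) (l : Program) : Prop := ∀ j < l.length, p[o + j]? = l[j]?

lemma codeAt_cons {p : Program} {o : ℕ} {i : Instr} {l : Program} :
    p.CodeAt o (i :: l) ↔ p[o]? = some i ∧ p.CodeAt (o + 1) l := by
  constructor
  · intro h
    refine ⟨by simpa using h 0 (by simp), fun j hj => ?_⟩
    have := h (j + 1) (by simpa using hj)
    rw [List.getElem?_cons_succ] at this
    rw [← this]; congr 1; omega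
  · rintro ⟨h0, h⟩ j hj
    cases j with
    | zero => simpa using h0
    | succ j =>
      rw [List.getElem?_cons_succ, ← h j (by simpa using hj)]
      congr 1; omega

lemma codeAt_append {p : Program} {o : ℕ} {l l' : Program} :
    p.CodeAt o (l ++ l') ↔ p.CodeAt o l ∧ p.CodeAt (o + l.length) l' := by
  induction l generalizing o with
  | nil =>
    have : p.CodeAt o [] := fun j hj => by simp at hj
    simp [this]
  | cons i l ih =>
    rw [List.cons_append, codeAt_cons, codeAt_cons, ih, and_assoc, List.length_cons]
    have : o + 1 + l.length = o + (l.length + 1) := by omega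
    rw [this]

end Program

/-! ### Correctness of the compilation -/

/-- The registers and the memory represent the data `σ`, with arrays of length `cap + 1`. -/
structure Represents (cap : ℕ) (σ : Data) (reg mem : ℕ → ℕ) : Prop where
  temp : reg 0 ≤ 33 * (cap + 1)
  cap_eq : reg 1 = cap
  cap_succ_eq : reg 2 = cap + 1
  zero_eq : reg 3 = 0
  one_eq : reg 4 = 1
  reg_eq : ∀ r, reg (r + 5) = σ.reg r
  mem_eq : ∀ s k, k ≤ cap → mem (s * (cap + 1) + k) = σ.arr s k
  reg_le : ∀ r, σ.reg r ≤ cap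
  arr_le : ∀ s k, k ≤ cap → σ.arr s k ≤ cap

namespace Represents

variable {cap : ℕ} {σ : Data} {reg mem : ℕ → ℕ}

lemma reg_le' (h : Represents cap σ reg mem) (a : ℕ) : reg a ≤ 33 * (cap + 1) := by
  match a with
  | 0 => exact h.temp
  | 1 => rw [h.cap_eq]; omega
  | 2 => rw [h.cap_succ_eq]; omega
  | 3 => rw [h.zero_eq]; omega
  | 4 => rw [h.one_eq]; omega
  | r + 5 => rw [h.reg_eq]; have := h.reg_le r; omega

lemma mem_le (h : Represents cap σ reg mem) (a : ℕ) : mem a ≤ 33 * (cap + 1) := by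
  have hk : a % (cap + 1) ≤ cap := Nat.lt_succ_iff.1 (Nat.mod_lt _ (Nat.succ_pos _))
  rw [← Nat.div_add_mod' a (cap + 1), h.mem_eq _ _ hk]
  exact (h.arr_le _ _ hk).trans (by omega)

lemma bounded (h : Represents cap σ reg mem) (pc : ℕ) :
    Program.Bounded (33 * (cap + 1)) ⟨pc, reg, mem⟩ := fun a => ⟨h.reg_le' a, h.mem_le a⟩

lemma bounded_update (h : Represents cap σ reg mem) (pc r : ℕ) {v : ℕ} (hv : v ≤ 33 * (cap + 1)) :
    Program.Bounded (33 * (cap + 1)) ⟨pc, Function.update reg r v, mem⟩ := by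
  intro a
  refine ⟨?_, h.mem_le a⟩
  by_cases ha : a = r
  · subst ha; simpa using hv
  · simpa [ha] using h.reg_le' a

lemma setTemp (h : Represents cap σ reg mem) {v : ℕ} (hv : v ≤ 33 * (cap + 1)) :
    Represents cap σ (Function.update reg 0 v) mem := by
  constructor
  · simpa using hv
  · simpa using h.cap_eq
  · simpa using h.cap_succ_eq
  · simpa using h.zero_eq
  · simpa using h.one_eq
  · intro r; simpa using h.reg_eq r
  · exact h.mem_eq
  · exact h.reg_le
  · exact h.arr_le

lemma set (h : Represents cap σ reg mem) (r : ℕ) {v : ℕ} (hv : v ≤ cap) :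
    Represents cap (σ.set r v) (Function.update reg (r + 5) v) mem := by
  constructor
  · simpa using h.temp
  · simpa using h.cap_eq
  · simpa using h.cap_succ_eq
  · simpa using h.zero_eq
  · simpa using h.one_eq
  · intro q
    by_cases hq : q = r
    · subst hq; simp [Data.set]
    · simpa [Data.set, hq] using h.reg_eq q
  · exact h.mem_eq
  · intro q
    by_cases hq : q = r
    · subst hq; simpa [Data.set] using hv
    · simpa [Data.set, hq] using h.reg_le q
  · exact h.arr_le

lemma put (h : Represents cap σ reg mem) (s : ℕ) {k v : ℕ} (hk : k ≤ cap) (hv : v ≤ cap) :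
    Represents cap (σ.put s k v) reg (Function.update mem (s * (cap + 1) + k) v) := by
  refine ⟨h.temp, h.cap_eq, h.cap_succ_eq, h.zero_eq, h.one_eq, h.reg_eq, ?_, h.reg_le, ?_⟩
  · intro s' k' hk'
    by_cases hs : s' = s
    · subst hs
      by_cases hkk : k' = k
      · subst hkk; simp [Data.put]
      · simpa [Data.put, hkk] using h.mem_eq s' k' hk'
    · have hne : s' * (cap + 1) + k' ≠ s * (cap + 1) + k := by
        intro he
        apply hs
        have h1 : (s' * (cap + 1) + k') / (cap + 1) = s' := by
          rw [mul_comm, Nat.mul_add_div (Nat.succ_pos _), Nat.div_eq_of_lt (by omega), add_zero]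
        have h2 : (s * (cap + 1) + k) / (cap + 1) = s := by
          rw [mul_comm, Nat.mul_add_div (Nat.succ_pos _), Nat.div_eq_of_lt (by omega), add_zero]
        rw [← h1, he, h2]
      simpa [Data.put, hs, hne] using h.mem_eq s' k' hk'
  · intro s' k' hk'
    by_cases hs : s' = s
    · subst hs
      by_cases hkk : k' = k
      · subst hkk; simpa [Data.put] using hv
      · simpa [Data.put, hkk] using h.arr_le s' k' hk'
    · simpa [Data.put, hs] using h.arr_le s' k' hk'

end Represents

namespace Cmd

open Program

/-- There is no multiplication: the offset s(cap + 1) is made by s additions. With at most 32 arrays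
this takes constant time, and the address stays below 33(cap + 1). -/
lemma runs_address {p : Program} {cap : ℕ} {σ : Data} {reg mem : ℕ → ℕ}
    (h : Represents cap σ reg mem) {s a o : ℕ} (hs : s < 32) (hp : p.CodeAt o (address s a)) :
    ∃ reg', p.Runs (33 * (cap + 1)) ⟨o, reg, mem⟩ (s + 1) ⟨o + s + 1, reg', mem⟩ ∧
      Represents cap σ reg' mem ∧ reg' 0 = s * (cap + 1) + σ.reg a := by
  rw [address, codeAt_cons] at hp
  have hle := h.reg_le a
  have hstep : ∀ j ≤ s, ∃ reg', p.Runs (33 * (cap + 1)) ⟨o, reg, mem⟩ (j + 1)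
      ⟨o + j + 1, reg', mem⟩ ∧
      Represents cap σ reg' mem ∧ reg' 0 = j * (cap + 1) + σ.reg a := by
    intro j
    induction j with
    | zero =>
      intro _
      have hv : reg (a + 5) + reg 3 = σ.reg a := by rw [h.reg_eq, h.zero_eq, add_zero]
      have h' := h.setTemp (v := reg (a + 5) + reg 3) (by rw [hv]; omega)
      exact ⟨_, Runs.single hp.1 (h.bounded _) (h'.bounded _), h', by simp [hv]⟩
    | succ j ih =>
      intro hj
      obtain ⟨reg', hr, h', h0⟩ := ih (by omega)
      have hv : reg' 0 + reg' 2 = (j + 1) * (cap + 1) + σ.reg a := by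
        rw [h0, h'.cap_succ_eq]; ring
      have hb : (j + 1) * (cap + 1) ≤ 32 * (cap + 1) := Nat.mul_le_mul_right _ (by omega)
      have h'' := h'.setTemp (v := reg' 0 + reg' 2) (by rw [hv]; omega)
      refine ⟨_, hr.trans (Runs.single (ins := .add 0 0 2) ?_ (h'.bounded _) (h''.bounded _)), h'',
        by simp [hv]⟩
      have := hp.2 j (by simpa using hj)
      rw [List.getElem?_replicate, if_pos (by omega)] at this
      rw [← this]
      change p[o + j + 1]? = p[o + 1 + j]?
      congr 1; omega
  exact hstep s le_rfl

/-- The compiled code does what the command says, within the stated time and space. -/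
theorem runs_compile {p : Program} {cap : ℕ} (hcap : 8 ≤ cap) (c : Cmd) : c.wf = true →
    ∀ (o : ℕ) (σ : Data) (reg mem : ℕ → ℕ), p.CodeAt o (c.compile o) →
    Represents cap σ reg mem →
    ∃ t ≤ c.cost cap, ∃ reg' mem', p.Runs (33 * (cap + 1)) ⟨o, reg, mem⟩ t
      ⟨o + c.size, reg', mem'⟩ ∧ Represents cap (c.eval cap σ) reg' mem' := by
  induction c with
  | const r c =>
    intro _ o σ reg mem hp h
    have h' := h.set r (v := c) (by have := c.2; omega)
    rw [compile, codeAt_cons] at hp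
    exact ⟨1, le_rfl, _, _, Runs.single hp.1 (h.bounded _) (h'.bounded _), h'⟩
  | sub r a b =>
    intro _ o σ reg mem hp h
    have h' := h.set r (v := reg (a + 5) - reg (b + 5)) (by
      rw [h.reg_eq, h.reg_eq]; have := h.reg_le a; omega)
    rw [compile, codeAt_cons] at hp
    refine ⟨1, le_rfl, _, _, Runs.single hp.1 (h.bounded _) (h'.bounded _), ?_⟩
    rw [eval, ← h.reg_eq a, ← h.reg_eq b]
    exact h'
  | add r a b =>
    intro _ o σ reg mem hp h
    rw [compile, codeAt_cons, codeAt_cons, codeAt_cons] at hp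
    obtain ⟨p1, p2, p3, -⟩ := hp
    have ha := h.reg_le a
    have hb := h.reg_le b
    have hb1 := h.bounded_update (o + 1) (r + 5) (v := reg (a + 5) + reg (b + 5))
      (by rw [h.reg_eq, h.reg_eq]; omega)
    have r1 := Runs.single (s := ⟨o, reg, mem⟩) p1 (h.bounded _) hb1
    set reg1 := Function.update reg (r + 5) (reg (a + 5) + reg (b + 5)) with hreg1
    have e1 : reg1 (r + 5) = σ.reg a + σ.reg b := by simp [hreg1, h.reg_eq]
    have e2 : reg1 1 = cap := by simp [hreg1, h.cap_eq]
    -- Cutting sums off at `cap` keeps all numbers small by construction; bounds on the computed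
    -- values are needed only where their exact values matter.
    by_cases hlt : σ.reg a + σ.reg b < cap
    · have hex : Instr.exec (.jumpLt (r + 5) 1 (o + 3)) ⟨o + 1, reg1, mem⟩ =
          ⟨o + 3, reg1, mem⟩ := by
        simp [Instr.exec, e1, e2, hlt]
      have h' := h.set r (v := reg (a + 5) + reg (b + 5)) (by rw [h.reg_eq, h.reg_eq]; omega)
      have r2 := Runs.single p2 hb1 (by rw [hex]; exact h'.bounded _)
      rw [hex] at r2
      refine ⟨1 + 1, by simp [cost], _, _, r1.trans r2, ?_⟩
      rw [eval, min_eq_left hlt.le, ← h.reg_eq a, ← h.reg_eq b]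
      exact h'
    · have hex : Instr.exec (.jumpLt (r + 5) 1 (o + 3)) ⟨o + 1, reg1, mem⟩ =
          ⟨o + 2, reg1, mem⟩ := by
        simp [Instr.exec, e1, e2, hlt]
      have hex3 : Instr.exec (.add (r + 5) 1 3) ⟨o + 2, reg1, mem⟩ =
          ⟨o + 3, Function.update reg (r + 5) cap, mem⟩ := by
        simp [Instr.exec, hreg1, h.cap_eq, h.zero_eq]
      have hb2 : Bounded (33 * (cap + 1)) ⟨o + 2, reg1, mem⟩ := hb1
      have h' := h.set r (v := cap) le_rfl
      have r2 := Runs.single p2 hb1 (by rw [hex]; exact hb2)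
      rw [hex] at r2
      have r3 := Runs.single p3 hb2 (by rw [hex3]; exact h'.bounded _)
      rw [hex3] at r3
      refine ⟨1 + 1 + 1, by simp [cost], _, _, (r1.trans r2).trans r3, ?_⟩
      rw [eval, min_eq_right (by omega)]
      exact h'
  | load r s a =>
    intro hwf o σ reg mem hp h
    simp only [wf, decide_eq_true_eq] at hwf
    rw [compile, codeAt_append, length_address, codeAt_cons] at hp
    obtain ⟨reg', hr, h', h0⟩ := runs_address h hwf hp.1
    have hk := h.reg_le a
    have h'' := h'.set r (v := mem (reg' 0)) (by
      rw [h0, h.mem_eq _ _ hk]; exact h.arr_le _ _ hk)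
    refine ⟨s + 1 + 1, le_rfl, _, _, hr.trans (Runs.single hp.2.1 (h'.bounded _) (h''.bounded _)),
      ?_⟩
    rw [eval, ← h.mem_eq _ _ hk, ← h0]
    exact h''
  | store s a b =>
    intro hwf o σ reg mem hp h
    simp only [wf, decide_eq_true_eq] at hwf
    rw [compile, codeAt_append, length_address, codeAt_cons] at hp
    obtain ⟨reg', hr, h', h0⟩ := runs_address h hwf hp.1
    have h'' := h'.put s (h.reg_le a) (h.reg_le b)
    have hex : Instr.exec (.store 0 (b + 5)) ⟨o + s + 1, reg', mem⟩ = ⟨o + s + 1 + 1, reg',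
        Function.update mem (s * (cap + 1) + σ.reg a) (σ.reg b)⟩ := by
      simp [Instr.exec, h0, h'.reg_eq]
    have r2 := Runs.single (s := ⟨o + s + 1, reg', mem⟩) hp.2.1 (h'.bounded _)
      (by rw [hex]; exact h''.bounded _)
    rw [hex] at r2
    exact ⟨s + 1 + 1, le_rfl, _, _, hr.trans r2, h''⟩
  | seq c d ihc ihd =>
    intro hwf o σ reg mem hp h
    simp only [wf, Bool.and_eq_true] at hwf
    rw [compile, codeAt_append, length_compile] at hp
    obtain ⟨t1, ht1, reg1, mem1, r1, h1⟩ := ihc hwf.1 o σ reg mem hp.1 h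
    obtain ⟨t2, ht2, reg2, mem2, r2, h2⟩ := ihd hwf.2 _ _ reg1 mem1 hp.2 h1
    refine ⟨t1 + t2, by simp only [cost]; omega, reg2, mem2, ?_, h2⟩
    have := r1.trans r2
    rwa [add_assoc] at this
  | ifLt a b c ih =>
    intro hwf o σ reg mem hp h
    rw [compile, codeAt_cons, codeAt_cons] at hp
    obtain ⟨p1, p2, p3⟩ := hp
    by_cases hlt : σ.reg a < σ.reg b
    · have hex : Instr.exec (.jumpLt (a + 5) (b + 5) (o + 2)) ⟨o, reg, mem⟩ =
          ⟨o + 2, reg, mem⟩ := by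
        simp [Instr.exec, h.reg_eq, hlt]
      have r1 := Runs.single (s := ⟨o, reg, mem⟩) p1 (h.bounded _)
        (by rw [hex]; exact h.bounded _)
      rw [hex] at r1
      obtain ⟨t, ht, reg', mem', r2, h'⟩ := ih hwf (o + 2) σ reg mem p3 h
      refine ⟨1 + t, by simp only [cost]; omega, reg', mem', ?_, ?_⟩
      · have := r1.trans r2
        rwa [add_assoc, add_comm 2] at this
      · rwa [eval, if_pos hlt]
    · have hex : Instr.exec (.jumpLt (a + 5) (b + 5) (o + 2)) ⟨o, reg, mem⟩ =
          ⟨o + 1, reg, mem⟩ := by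
        simp [Instr.exec, h.reg_eq, hlt]
      have hex2 : Instr.exec (.jumpLt 3 4 (o + (c.size + 2))) ⟨o + 1, reg, mem⟩ =
          ⟨o + (c.size + 2), reg, mem⟩ := by
        simp [Instr.exec, h.zero_eq, h.one_eq]
      have r1 := Runs.single (s := ⟨o, reg, mem⟩) p1 (h.bounded _)
        (by rw [hex]; exact h.bounded _)
      have r2 := Runs.single (s := ⟨o + 1, reg, mem⟩) p2 (h.bounded _)
        (by rw [hex2]; exact h.bounded _)
      rw [hex] at r1
      rw [hex2] at r2
      refine ⟨1 + 1, by simp only [cost]; omega, reg, mem, r1.trans r2, ?_⟩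
      rwa [eval, if_neg hlt]
  | loop k N c ih =>
    intro hwf o σ reg mem hp h
    simp only [wf, Bool.and_eq_true, Bool.not_eq_true', bne_iff_ne] at hwf
    obtain ⟨⟨⟨hwf, hwk⟩, hwN⟩, hkN⟩ := hwf
    rw [compile, codeAt_cons, codeAt_cons, codeAt_cons, codeAt_append, length_compile, codeAt_cons,
      codeAt_cons] at hp
    obtain ⟨p1, p2, p3, p4, p5, p6, -⟩ := hp
    have hN := h.reg_le N
    -- The body changes neither counter nor bound, so line o + 1 is reached with the counter equal
    -- to n. Each round costs the body and three further instructions.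
    have hiter : ∀ n ≤ σ.reg N, ∃ t ≤ n * (c.cost cap + 3) + 1, ∃ reg' mem',
        p.Runs (33 * (cap + 1)) ⟨o, reg, mem⟩ t ⟨o + 1, reg', mem'⟩ ∧
        Represents cap (iter (c.eval cap) k n σ) reg' mem' ∧
        (iter (c.eval cap) k n σ).reg k = n ∧ (iter (c.eval cap) k n σ).reg N = σ.reg N := by
      intro n
      induction n with
      | zero =>
        intro _
        have h' := h.set k (v := 0) (Nat.zero_le _)
        refine ⟨1, by omega, _, _, Runs.single p1 (h.bounded _) (h'.bounded _), h', ?_, ?_⟩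
        · simp [iter, Data.set]
        · simp [iter, Data.set, Function.update_of_ne hkN.symm]
      | succ n ihn =>
        intro hn
        obtain ⟨t, ht, reg', mem', r, h', hk, hN'⟩ := ihn (by omega)
        have hex : Instr.exec (.jumpLt (k + 5) (N + 5) (o + 3)) ⟨o + 1, reg', mem'⟩ =
            ⟨o + 3, reg', mem'⟩ := by
          simp [Instr.exec, h'.reg_eq, hk, hN', show n < σ.reg N by omega]
        have r1 := Runs.single (s := ⟨o + 1, reg', mem'⟩) p2 (h'.bounded _)
          (by rw [hex]; exact h'.bounded _)
        rw [hex] at r1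
        obtain ⟨t2, ht2, reg2, mem2, r2, h2⟩ := ih hwf (o + 3) _ reg' mem' p4 h'
        have hk2 := c.eval_reg_of_not_writes cap hwk (iter (c.eval cap) k n σ)
        have hN2 := c.eval_reg_of_not_writes cap hwN (iter (c.eval cap) k n σ)
        have h3 := h2.set k (v := n + 1) (by omega)
        have hex3 : Instr.exec (.add (k + 5) (k + 5) 4) ⟨o + 3 + c.size, reg2, mem2⟩ =
            ⟨o + 3 + c.size + 1, Function.update reg2 (k + 5) (n + 1), mem2⟩ := by
          simp [Instr.exec, h2.reg_eq, h2.one_eq, hk2, hk]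
        have r3 := Runs.single (s := ⟨o + 3 + c.size, reg2, mem2⟩) p5 (h2.bounded _)
          (by rw [hex3]; exact h3.bounded _)
        rw [hex3] at r3
        have hex4 : Instr.exec (.jumpLt 3 4 (o + 1)) ⟨o + 3 + c.size + 1,
            Function.update reg2 (k + 5) (n + 1), mem2⟩ =
            ⟨o + 1, Function.update reg2 (k + 5) (n + 1), mem2⟩ := by
          simp [Instr.exec, h2.zero_eq, h2.one_eq]
        have r4 := Runs.single (s := ⟨o + 3 + c.size + 1, Function.update reg2 (k + 5) (n + 1),
          mem2⟩) p6 (h3.bounded _) (by rw [hex4]; exact h3.bounded _)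
        rw [hex4] at r4
        refine ⟨t + (1 + (t2 + (1 + 1))), ?_, _, _, r.trans (r1.trans (r2.trans (r3.trans r4))),
          h3, ?_, ?_⟩
        · have : (n + 1) * (c.cost cap + 3) = n * (c.cost cap + 3) + (c.cost cap + 3) := by ring
          omega
        · simp [iter, Data.set]
        · simp only [iter, Data.set, Function.update_of_ne hkN.symm]
          rw [hN2, hN']
    obtain ⟨t, ht, reg', mem', r, h', hk, hN'⟩ := hiter _ le_rfl
    have hex : Instr.exec (.jumpLt (k + 5) (N + 5) (o + 3)) ⟨o + 1, reg', mem'⟩ =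
        ⟨o + 2, reg', mem'⟩ := by
      simp [Instr.exec, h'.reg_eq, hk, hN']
    have r1 := Runs.single (s := ⟨o + 1, reg', mem'⟩) p2 (h'.bounded _)
      (by rw [hex]; exact h'.bounded _)
    rw [hex] at r1
    have hex2 : Instr.exec (.jumpLt 3 4 (o + (c.size + 5))) ⟨o + 2, reg', mem'⟩ =
        ⟨o + (c.size + 5), reg', mem'⟩ := by
      simp [Instr.exec, h'.zero_eq, h'.one_eq]
    have r2 := Runs.single (s := ⟨o + 2, reg', mem'⟩) p3 (h'.bounded _)
      (by rw [hex2]; exact h'.bounded _)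
    rw [hex2] at r2
    refine ⟨t + (1 + 1), ?_, reg', mem', r.trans (r1.trans r2), h'⟩
    have := Nat.mul_le_mul_right (c.cost cap + 3) hN
    simp only [cost]
    omega

end Cmd


/-! ### Loop invariants -/

namespace Cmd

/-- The command may change array `s`. -/
def stores : Cmd → ℕ → Bool
  | store s _ _, q => s == q
  | seq c d, q => c.stores q || d.stores q
  | ifLt _ _ c, q => c.stores q
  | loop _ _ c, q => c.stores q
  | _, _ => false

lemma eval_arr_of_not_stores (cap : ℕ) {q : ℕ} (c : Cmd) : c.stores q = false →
    ∀ σ, (c.eval cap σ).arr q = σ.arr q := by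
  induction c with
  | seq c d ihc ihd =>
    intro h σ
    simp only [stores, Bool.or_eq_false_iff] at h
    rw [eval, ihd h.2, ihc h.1]
  | ifLt a b c ih =>
    intro h σ
    rw [eval]
    split
    · exact ih h σ
    · rfl
  | loop k N c ih =>
    intro h σ
    have : ∀ n, (iter (eval cap c) k n σ).arr q = σ.arr q := by
      intro n
      induction n with
      | zero => rfl
      | succ n ihn =>
        simp only [iter, Data.set]
        rw [ih h, ihn]
    exact this _
  | store s a b =>
    intro h σ
    simp only [stores, beq_eq_false_iff_ne] at h
    simp [eval, Data.put, Function.update_of_ne h.symm]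
  | _ => intro h σ; rfl

/-- The invariant rule for loops; the invariant is about arrays only. -/
lemma eval_loop_induction {cap k N : ℕ} {c : Cmd} {σ : Data} (P : ℕ → (ℕ → ℕ → ℕ) → Prop)
    (h0 : P 0 σ.arr)
    (hs : ∀ i < σ.reg N, ∀ τ : Data, τ.reg k = i →
      (∀ q, q ≠ k → c.writes q = false → τ.reg q = σ.reg q) →
      (∀ q, c.stores q = false → τ.arr q = σ.arr q) →
      P i τ.arr → P (i + 1) (c.eval cap τ).arr) :
    P (σ.reg N) ((loop k N c).eval cap σ).arr := by
  have key : ∀ n ≤ σ.reg N, P n (iter (eval cap c) k n σ).arr ∧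
      (iter (eval cap c) k n σ).reg k = n ∧
      (∀ q, q ≠ k → c.writes q = false → (iter (eval cap c) k n σ).reg q = σ.reg q) ∧
      (∀ q, c.stores q = false → (iter (eval cap c) k n σ).arr q = σ.arr q) := by
    intro n
    induction n with
    | zero =>
      intro _
      exact ⟨h0, by simp [iter, Data.set], fun q hq _ => by simp [iter, Data.set, hq],
        fun q _ => rfl⟩
    | succ n ih =>
      intro hn
      obtain ⟨h1, h2, h3, h4⟩ := ih (by omega)
      refine ⟨hs n (by omega) _ h2 h3 h4 h1, by simp [iter, Data.set], fun q hq hw => ?_,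
        fun q hw => ?_⟩
      · simp only [iter, Data.set, Function.update_of_ne hq]
        rw [eval_reg_of_not_writes cap c hw, h3 q hq hw]
      · simp only [iter, Data.set]
        rw [eval_arr_of_not_stores cap c hw, h4 q hw]
  exact (key _ le_rfl).1

end Cmd

/-! ### The initial state and linear running time -/

/-- The data at the start: array `0` holds the input. -/
def Data.start (input : List ℕ) : Data := ⟨fun _ => 0, fun s k => if s = 0 then input.getD k 0 else 0⟩

namespace Program

/-- Sets up the registers that compiled commands rely on, with `cap` being 64 times the first number
of the input. -/
def prologue : Program :=
  [.const 4 1, .load 1 3, .add 1 1 1, .add 1 1 1, .add 1 1 1, .add 1 1 1, .add 1 1 1, .add 1 1 1,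
    .add 2 1 4]

lemma Bounded.update {B pc pc' r v : ℕ} {reg mem : ℕ → ℕ} (h : Bounded B ⟨pc, reg, mem⟩)
    (hv : v ≤ B) : Bounded B ⟨pc', Function.update reg r v, mem⟩ := by
  intro a
  refine ⟨?_, (h a).2⟩
  by_cases ha : a = r
  · subst ha; simpa using hv
  · simpa [ha] using (h a).1

lemma runs_double {p : Program} {B o x : ℕ} {reg mem : ℕ → ℕ}
    (hp : p[o]? = some (.add 1 1 1)) (h : Bounded B ⟨o, Function.update reg 1 x, mem⟩)
    (hx : 2 * x ≤ B) :
    p.Runs B ⟨o, Function.update reg 1 x, mem⟩ 1 ⟨o + 1, Function.update reg 1 (2 * x), mem⟩ := by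
  have hex : Instr.exec (.add 1 1 1) ⟨o, Function.update reg 1 x, mem⟩ =
      ⟨o + 1, Function.update reg 1 (2 * x), mem⟩ := by
    simp [Instr.exec, two_mul]
  have h' : Bounded B ⟨o + 1, Function.update reg 1 (2 * x), mem⟩ := by
    rw [← Function.update_idem x]
    exact h.update hx
  have := Runs.single (s := ⟨o, Function.update reg 1 x, mem⟩) hp h (by rw [hex]; exact h')
  rwa [hex] at this

lemma runs_prologue {p : Program} {input : List ℕ} {n : ℕ} (hp : p.CodeAt 0 prologue)
    (hn : input.getD 0 0 = n) (h1 : 1 ≤ n) (hle : ∀ k, input.getD k 0 ≤ 64 * n) :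
    p.Runs (33 * (64 * n + 1)) (init input) 9 ⟨9, Function.update (Function.update
      (Function.update (fun _ => 0) 4 1) 1 (64 * n)) 2 (64 * n + 1), fun a => input.getD a 0⟩ := by
  simp only [prologue, codeAt_cons, Nat.zero_add, Nat.reduceAdd] at hp
  obtain ⟨p0, p1, p2, p3, p4, p5, p6, p7, p8, -⟩ := hp
  have b0 : Bounded (33 * (64 * n + 1)) (init input) := fun a =>
    ⟨Nat.zero_le _, (hle a).trans (by omega)⟩
  have b1 : Bounded (33 * (64 * n + 1)) ⟨1, Function.update (fun _ => 0) 4 1,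
    fun a => input.getD a 0⟩ := Bounded.update b0 (by omega)
  have bd : ∀ (o : ℕ) {x : ℕ}, x ≤ 64 * n → Bounded (33 * (64 * n + 1)) ⟨o, Function.update
      (Function.update (fun _ => 0) 4 1) 1 x, fun a => input.getD a 0⟩ :=
    fun o x hx => b1.update (by omega)
  have e1 : Instr.exec (.load 1 3) ⟨1, Function.update (fun _ => 0) 4 1,
      fun a => input.getD a 0⟩ = ⟨2, Function.update (Function.update (fun _ => 0) 4 1) 1 n,
      fun a => input.getD a 0⟩ := by
    have h3 : Function.update (fun _ => 0 : ℕ → ℕ) 4 1 3 = 0 := by simp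
    simp only [Instr.exec, h3, hn]
  have e8 : Instr.exec (.add 2 1 4) ⟨8, Function.update (Function.update (fun _ => 0) 4 1) 1
      (64 * n), fun a => input.getD a 0⟩ = ⟨9, Function.update (Function.update
      (Function.update (fun _ => 0) 4 1) 1 (64 * n)) 2 (64 * n + 1),
      fun a => input.getD a 0⟩ := by
    simp [Instr.exec]
  have r0 : p.Runs (33 * (64 * n + 1)) (init input) 1 ⟨1, Function.update (fun _ => 0) 4 1,
    fun a => input.getD a 0⟩ := Runs.single (ins := .const 4 1) p0 b0 b1
  have r1 := Runs.single (s := ⟨1, Function.update (fun _ => 0) 4 1, fun a => input.getD a 0⟩) p1 b1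
    (by rw [e1]; exact bd 2 (by omega))
  rw [e1] at r1
  have r2 := runs_double p2 (bd 2 (x := n) (by omega)) (by omega)
  have r3 := runs_double p3 (bd 3 (x := 2 * n) (by omega)) (by omega)
  have r4 := runs_double p4 (bd 4 (x := 2 * (2 * n)) (by omega)) (by omega)
  have r5 := runs_double p5 (bd 5 (x := 2 * (2 * (2 * n))) (by omega)) (by omega)
  have r6 := runs_double p6 (bd 6 (x := 2 * (2 * (2 * (2 * n)))) (by omega)) (by omega)
  have r7 := runs_double p7 (bd 7 (x := 2 * (2 * (2 * (2 * (2 * n))))) (by omega)) (by omega)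
  -- Six doublings multiply by 64.
  have e64 : 2 * (2 * (2 * (2 * (2 * (2 * n))))) = 64 * n := by omega
  rw [e64] at r7
  have r8 := Runs.single (s := ⟨8, Function.update (Function.update (fun _ => 0) 4 1) 1
      (64 * n), fun a => input.getD a 0⟩) p8 (bd 8 le_rfl)
    (by rw [e8]; exact (bd 8 le_rfl).update (by omega))
  rw [e8] at r8
  exact (((((((r0.trans r1).trans r2).trans r3).trans r4).trans r5).trans r6).trans r7).trans r8

/-- Commands without nested loops can be carried out in linear time on a random access machine. -/
theorem exists_computes {c : Cmd} (hwf : c.wf = true) (hun : c.unnested = true) :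
    ∃ C : ℕ, ∀ (input : List ℕ) (n : ℕ), input.getD 0 0 = n → 1 ≤ n →
      input.length ≤ 64 * n + 1 → (∀ k, input.getD k 0 ≤ 64 * n) → ∀ out : (ℕ → ℕ) → Prop,
      (∀ mem : ℕ → ℕ, (∀ k ≤ 64 * n,
        mem k = (c.eval (64 * n) (Data.start input)).arr 0 k) → out mem) →
      Computes (prologue ++ c.compile 9) input (C * n) (C * n) out := by
  -- Nine steps of the prologue, the cost of the command with 64n + 1 ≤ 65n, and 33(64n + 1) ≤ 33 ·
  -- 65 · n for the numbers held.
  refine ⟨9 + 65 * c.cost 1 + 33 * 65, fun input n hn h1 hlen hle out hout => ?_⟩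
  set p : Program := prologue ++ c.compile 9 with hp
  have hcode : p.CodeAt 0 p := fun j _ => by rw [Nat.zero_add]
  nth_rw 2 [hp] at hcode
  rw [codeAt_append] at hcode
  have hrep : Represents (64 * n) (Data.start input) (Function.update (Function.update
      (Function.update (fun _ => 0) 4 1) 1 (64 * n)) 2 (64 * n + 1)) (fun a => input.getD a 0) := by
    constructor
    · simp
    · simp
    · simp
    · simp
    · simp
    · intro r; simp [Data.start]
    · intro s k hk
      rcases Nat.eq_zero_or_pos s with rfl | hs
      · simp [Data.start]
      -- The input fits into array 0, so all other arrays start with zeros, as the algorithm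
      -- assumes.
      · have : 64 * n + 1 ≤ s * (64 * n + 1) := Nat.le_mul_of_pos_left _ hs
        rw [List.getD_eq_default _ _ (by omega)]
        simp [Data.start, hs.ne']
    · intro r; simp [Data.start]
    · intro s k _
      by_cases hs : s = 0
      · simpa [Data.start, hs] using hle k
      · simp [Data.start, hs]
  obtain ⟨t, ht, reg, mem, hr, hrep'⟩ := c.runs_compile (p := p) (by omega) hwf 9 _ _ _ hcode.2 hrep
  have hrun := (runs_prologue hcode.1 hn h1 hle).trans hr
  have hcost := Cmd.cost_le hun (64 * n)
  have hc1 : c.cost 1 * (64 * n + 1) ≤ 65 * c.cost 1 * n := by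
    calc c.cost 1 * (64 * n + 1) ≤ c.cost 1 * (65 * n) := Nat.mul_le_mul_left _ (by omega)
      _ = 65 * c.cost 1 * n := by ring
  have hC : (9 + 65 * c.cost 1 + 33 * 65) * n = 9 * n + 65 * c.cost 1 * n + 33 * 65 * n := by ring
  refine ⟨9 + t, by omega, ?_, ?_, fun t' ht' a => ?_⟩
  · rw [run, hrun.1, Halted, hp, List.length_append, Cmd.length_compile]
    exact le_rfl
  · rw [run, hrun.1]
    refine hout _ fun k hk => ?_
    simpa using hrep'.mem_eq 0 k hk
  · have := hrun.2 t' ht' a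
    have hB : 33 * (64 * n + 1) ≤ (9 + 65 * c.cost 1 + 33 * 65) * n := by omega
    exact ⟨this.1.trans hB, this.2.trans hB⟩

end Program


namespace Cmd

/-! ### Computations with forests -/

/-- For a dart with label strictly between `a` and `b`, note its head as the parent of its tail.
The vertices are numbered from `1` on. -/
def parentBody (a b : Fin 8) (par : ℕ) : Cmd :=
  .seq (.add 4 0 0) <| .seq (.add 4 4 4) <| .seq (.const 5 5) <| .seq (.add 4 4 5) <|
  .seq (.load 6 0 4) <| .seq (.add 4 4 3) <| .seq (.load 7 0 4) <| .seq (.add 4 4 3) <|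
  .seq (.add 4 4 3) <| .seq (.load 8 0 4) <| .seq (.add 7 7 7) <| .seq (.add 7 7 7) <|
  .seq (.add 7 7 5) <| .seq (.load 7 0 7) <| .seq (.add 6 6 3) <| .seq (.add 7 7 3) <|
  .seq (.const 9 a) <| .seq (.const 10 b) <| .ifLt 9 8 <| .ifLt 8 10 <| .store par 6 7

/-- The head of a dart is read as the tail in the record of its reverse. Two strict comparisons,
with a and a + 2, test whether the label is a + 1. -/
lemma eval_parentBody {cap : ℕ} {a b : Fin 8} {par : ℕ} {τ : Data} {i t r l h : ℕ}
    (hab : (b : ℕ) = a + 2) (h0 : τ.reg 0 = i) (h3 : τ.reg 3 = 1) (hi : 4 * i + 8 ≤ cap)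
    (ht : τ.arr 0 (4 * i + 5) = t) (hr : τ.arr 0 (4 * i + 6) = r) (hl : τ.arr 0 (4 * i + 8) = l)
    (hh : τ.arr 0 (4 * r + 5) = h) (ht' : t + 1 ≤ cap) (hr' : 4 * r + 5 ≤ cap)
    (hh' : h + 1 ≤ cap) :
    ((parentBody a b par).eval cap τ).arr =
      if l = a + 1 then (τ.put par (t + 1) (h + 1)).arr else τ.arr := by
  have e1 : i + i + (i + i) + 5 = 4 * i + 5 := by omega
  have e2 : r + r + (r + r) + 5 = 4 * r + 5 := by omega
  simp (disch := omega) [parentBody, eval, Data.set, Data.put, h0, h3, e1, ht, hr, hl, e2, hh]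
  split_ifs <;> first | rfl | (exfalso; omega)

/-- Find the parents. -/
def parentPass (a b : Fin 8) (par : ℕ) : Cmd := .loop 0 2 (parentBody a b par)

lemma eval_parentPass {cap : ℕ} {a b : Fin 8} {par m : ℕ} {σ : Data} {t r l : ℕ → ℕ} {f : ℕ → ℕ}
    (hab : (b : ℕ) = a + 2) (hpar : par ≠ 0) (h2 : σ.reg 2 = m) (h3 : σ.reg 3 = 1)
    (hm : 4 * m + 5 ≤ cap)
    (ht : ∀ i < m, σ.arr 0 (4 * i + 5) = t i) (hr : ∀ i < m, σ.arr 0 (4 * i + 6) = r i)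
    (hl : ∀ i < m, σ.arr 0 (4 * i + 8) = l i) (hrm : ∀ i < m, r i < m)
    (htc : ∀ i < m, t i + 1 ≤ cap) (h0 : σ.arr par = fun _ => 0)
    (hf : ∀ i < m, l i = a + 1 → f (t i + 1) = t (r i) + 1)
    (hf0 : ∀ v, (∀ i < m, l i = a + 1 → t i + 1 ≠ v) → f v = 0) :
    ((parentPass a b par).eval cap σ).arr par = f := by
  have key := eval_loop_induction (cap := cap) (k := 0) (N := 2) (c := parentBody a b par) (σ := σ)
    -- The darts come in arbitrary order, so an entry is only known to be final or still 0. It is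
    -- final once the outgoing dart of its vertex has been met.
    (fun i A => ∀ v, (A par v = f v ∨ A par v = 0) ∧
      ((∃ j < i, l j = a + 1 ∧ t j + 1 = v) → A par v = f v))
    (fun v => ⟨Or.inr (by rw [h0]), by rintro ⟨j, hj, -⟩; omega⟩) ?_
  · funext v
    rw [h2] at key
    obtain ⟨k1, k2⟩ := key v
    by_cases hv : ∃ j < m, l j = a + 1 ∧ t j + 1 = v
    · exact k2 hv
    · have : f v = 0 := hf0 v fun i hi hli hti => hv ⟨i, hi, hli, hti⟩
      rw [parentPass]
      rcases k1 with k | k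
      · exact k
      · rw [k, this]
  · intro i hi τ hτ0 hτr hτa ih v
    rw [h2] at hi
    have ha0 : τ.arr 0 = σ.arr 0 := hτa 0 (by simp [parentBody, stores, hpar])
    have hrr := hrm i hi
    rw [eval_parentBody hab hτ0 (by rw [hτr 3 (by omega) (by simp [parentBody, writes]), h3])
      (by omega) (by rw [ha0, ht i hi]) (by rw [ha0, hr i hi]) (by rw [ha0, hl i hi])
      (by rw [ha0, ht _ hrr]) (htc i hi) (by omega) (htc _ hrr)]
    obtain ⟨ih1, ih2⟩ := ih v
    split_ifs with hli
    · by_cases hv : v = t i + 1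
      · subst hv
        simp [Data.put, hf i hi hli]
      · have e : (τ.put par (t i + 1) (t (r i) + 1)).arr par v = τ.arr par v := by
          simp [Data.put, hv]
        rw [e]
        refine ⟨ih1, ?_⟩
        rintro ⟨j, hj, hlj, htj⟩
        rcases Nat.lt_succ_iff_lt_or_eq.1 hj with hj | rfl
        · exact ih2 ⟨j, hj, hlj, htj⟩
        · exact absurd htj.symm hv
    · refine ⟨ih1, ?_⟩
      rintro ⟨j, hj, hlj, htj⟩
      rcases Nat.lt_succ_iff_lt_or_eq.1 hj with hj | rfl
      · exact ih2 ⟨j, hj, hlj, htj⟩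
      · exact absurd hlj hli

/-- Count the children. -/
def degreePass (par deg : ℕ) : Cmd :=
  .loop 0 1 <| .seq (.add 4 0 3) <| .seq (.load 5 par 4) <| .seq (.load 6 deg 5) <|
    .seq (.add 6 6 3) <| .store deg 5 6

lemma eval_degreePass {cap par deg n : ℕ} {σ : Data} (hd : par ≠ deg) (h1 : σ.reg 1 = n)
    (h3 : σ.reg 3 = 1) (hn : n ≤ cap) (h0 : σ.arr deg = fun _ => 0) (v : ℕ) :
    ((degreePass par deg).eval cap σ).arr deg v =
      -- This covers v = 0 as well: the vertices without a parent are counted in the unused entry 0.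
      ((Finset.Icc 1 n).filter fun u => σ.arr par u = v).card := by
  have key := eval_loop_induction (cap := cap) (k := 0) (N := 1) (c := .seq (.add 4 0 3) <|
      .seq (.load 5 par 4) <| .seq (.load 6 deg 5) <| .seq (.add 6 6 3) <| .store deg 5 6) (σ := σ)
    (fun i A => ∀ v, A deg v = ((Finset.Icc 1 i).filter fun u => σ.arr par u = v).card)
    (fun v => by simp [h0]) ?_
  · rw [h1] at key
    exact key v
  · intro i hi τ hτ0 hτr hτa ih v
    rw [h1] at hi
    have ha : τ.arr par = σ.arr par := hτa par (by simp [stores, hd.symm])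
    have hr3 : τ.reg 3 = 1 := by rw [hτr 3 (by omega) (by simp [writes]), h3]
    have hins : Finset.Icc 1 (i + 1) = insert (i + 1) (Finset.Icc 1 i) := by ext; simp; omega
    have hle : τ.arr deg (σ.arr par (i + 1)) ≤ i := by
      rw [ih]
      exact (Finset.card_filter_le _ _).trans (by simp)
    simp (disch := omega) [eval, Data.set, Data.put, hτ0, hr3, ha]
    rw [hins, Finset.filter_insert]
    by_cases hv : v = σ.arr par (i + 1)
    · subst hv
      simp [ih]
    · rw [Function.update_of_ne hv, if_neg (fun h => hv h.symm), ih]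

/-- Collect the vertices without children in a queue. -/
def leafPass (deg ord tl : ℕ) : Cmd :=
  .loop 0 1 <| .seq (.add 4 0 3) <| .seq (.load 5 deg 4) <| .seq (.const 6 0) <|
    .seq (.load 7 tl 6) <| .ifLt 5 3 <| .seq (.store ord 7 4) <| .seq (.add 7 7 3) <| .store tl 6 7

lemma eval_leafPass {cap deg ord tl n : ℕ} {σ : Data} (hdo : deg ≠ ord) (hdt : deg ≠ tl)
    (hot : ord ≠ tl) (h1 : σ.reg 1 = n) (h3 : σ.reg 3 = 1) (hn : n ≤ cap) (h0 : σ.arr tl 0 = 0) :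
    ∃ q ≤ n, ((leafPass deg ord tl).eval cap σ).arr tl 0 = q ∧
      (∀ a < q, ∀ b < q, ((leafPass deg ord tl).eval cap σ).arr ord a =
        ((leafPass deg ord tl).eval cap σ).arr ord b → a = b) ∧
      (∀ a < q, ((leafPass deg ord tl).eval cap σ).arr ord a ∈ Finset.Icc 1 n) ∧
      ∀ v ∈ Finset.Icc 1 n,
        (σ.arr deg v = 0 ↔ ∃ a < q, ((leafPass deg ord tl).eval cap σ).arr ord a = v) := by
  have key := eval_loop_induction (cap := cap) (k := 0) (N := 1) (c := .seq (.add 4 0 3) <|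
      .seq (.load 5 deg 4) <| .seq (.const 6 0) <| .seq (.load 7 tl 6) <| .ifLt 5 3 <|
      .seq (.store ord 7 4) <| .seq (.add 7 7 3) <| .store tl 6 7) (σ := σ)
    (fun i A => ∃ q ≤ i, A tl 0 = q ∧ (∀ a < q, ∀ b < q, A ord a = A ord b → a = b) ∧
      (∀ a < q, A ord a ∈ Finset.Icc 1 i) ∧
      ∀ v ∈ Finset.Icc 1 i, (σ.arr deg v = 0 ↔ ∃ a < q, A ord a = v))
    ⟨0, le_rfl, h0, by simp, by simp, by simp⟩ ?_
  · rw [h1] at key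
    exact key
  · rintro i hi τ hτ0 hτr hτa ⟨q, hqi, hq, hinj, hmem, hiff⟩
    rw [h1] at hi
    have ha : τ.arr deg = σ.arr deg := hτa deg (by simp [stores, hdo.symm, hdt.symm])
    have hr3 : τ.reg 3 = 1 := by rw [hτr 3 (by omega) (by simp [writes]), h3]
    simp only [Finset.mem_Icc] at hmem hiff ⊢
    by_cases hdeg : σ.arr deg (i + 1) = 0
    · have htl : ((seq (.add 4 0 3) <| .seq (.load 5 deg 4) <| .seq (.const 6 0) <|
          .seq (.load 7 tl 6) <| .ifLt 5 3 <| .seq (.store ord 7 4) <| .seq (.add 7 7 3) <|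
          .store tl 6 7).eval cap τ).arr = Function.update (Function.update τ.arr ord
            (Function.update (τ.arr ord) q (i + 1))) tl (Function.update (τ.arr tl) 0 (q + 1)) := by
        simp (disch := omega) [eval, Data.set, Data.put, hτ0, hr3, ha, hdeg, hq]
      rw [htl]
      have eo : ∀ a, (Function.update (Function.update τ.arr ord
            (Function.update (τ.arr ord) q (i + 1))) tl (Function.update (τ.arr tl) 0 (q + 1))) ord a
            = if a = q then i + 1 else τ.arr ord a := by
        intro a; simp [hot, Function.update_apply]
      simp only [eo]
      refine ⟨q + 1, by omega, by simp, ?_, ?_, ?_⟩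
      · intro a haq b hbq hab
        split_ifs at hab with h h' h'
        · omega
        · have := (hmem b (by omega)).2; omega
        · have := (hmem a (by omega)).2; omega
        · exact hinj a (by omega) b (by omega) hab
      · intro a haq
        split_ifs with h
        · omega
        · have := hmem a (by omega); omega
      · intro v hv
        by_cases hvi : v = i + 1
        · subst hvi
          exact ⟨fun _ => ⟨q, by omega, by simp⟩, fun _ => hdeg⟩
        · rw [hiff v (by omega)]
          constructor
          · rintro ⟨a, haq, e⟩
            exact ⟨a, by omega, by rw [if_neg (by omega), e]⟩
          · rintro ⟨a, haq, e⟩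
            split_ifs at e with h
            · omega
            · exact ⟨a, by omega, e⟩
    · have htl : ((seq (.add 4 0 3) <| .seq (.load 5 deg 4) <| .seq (.const 6 0) <|
          .seq (.load 7 tl 6) <| .ifLt 5 3 <| .seq (.store ord 7 4) <| .seq (.add 7 7 3) <|
          .store tl 6 7).eval cap τ).arr = τ.arr := by
        simp (disch := omega) [eval, Data.set, hτ0, hr3, ha, hdeg]
      rw [htl]
      refine ⟨q, by omega, hq, hinj, fun a haq => ?_, fun v hv => ?_⟩
      · have := hmem a haq; omega
      · by_cases hvi : v = i + 1
        · subst hvi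
          refine ⟨fun h => absurd h hdeg, ?_⟩
          rintro ⟨a, haq, e⟩
          have := hmem a haq; omega
        · exact hiff v (by omega)

end Cmd


/-! ### Ordering a forest by a queue -/

/-- The first `n` entries of `ord` list the numbers from `1` to `n`, children before parents. -/
structure IsChildrenFirst (n : ℕ) (par ord : ℕ → ℕ) : Prop where
  mem : ∀ a < n, ord a ∈ Finset.Icc 1 n
  inj : ∀ a < n, ∀ b < n, ord a = ord b → a = b
  child : ∀ b < n, ∀ u ∈ Finset.Icc 1 n, par u = ord b → ∃ a < b, ord a = u

lemma IsChildrenFirst.exists_eq {n : ℕ} {par ord : ℕ → ℕ} (h : IsChildrenFirst n par ord) {v : ℕ}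
    (hv : v ∈ Finset.Icc 1 n) : ∃ a < n, ord a = v := by
  have := Finset.surj_on_of_inj_on_of_card_le (s := Finset.range n) (t := Finset.Icc 1 n)
    (fun a _ => ord a) (fun a ha => h.mem a (Finset.mem_range.1 ha))
    (fun a b ha hb e => h.inj a (Finset.mem_range.1 ha) b (Finset.mem_range.1 hb) e) (by simp) v hv
  obtain ⟨a, ha, e⟩ := this
  exact ⟨a, Finset.mem_range.1 ha, e.symm⟩

/-- The state of the queue after `k` vertices have been taken from it: `q` vertices have entered, and
`deg` counts the children that have not been taken. -/
structure QueueState (n : ℕ) (par : ℕ → ℕ) (k : ℕ) (deg ord : ℕ → ℕ) (q : ℕ) : Prop where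
  le_q : k ≤ q
  q_le : q ≤ n
  mem : ∀ a < q, ord a ∈ Finset.Icc 1 n
  inj : ∀ a < q, ∀ b < q, ord a = ord b → a = b
  deg_eq : ∀ v ∈ Finset.Icc 1 n,
    deg v = ((Finset.Icc 1 n).filter fun u => par u = v ∧ ∀ a < k, ord a ≠ u).card
  deg_iff : ∀ v ∈ Finset.Icc 1 n, (deg v = 0 ↔ ∃ a < q, ord a = v)
  child : ∀ b < q, ∀ u ∈ Finset.Icc 1 n, par u = ord b → ∃ a < b, ord a = u

namespace QueueState

variable {n : ℕ} {par : ℕ → ℕ} {k : ℕ} {deg ord : ℕ → ℕ} {q : ℕ}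

/-- The queue never runs dry: among the vertices not yet taken choose one of least rank. If it had
not entered, it would have a child that is not taken, of still smaller rank. -/
lemma lt_q (h : QueueState n par k deg ord q) (hk : k < n) {rk : ℕ → ℕ}
    (hrk : ∀ u ∈ Finset.Icc 1 n, par u ∈ Finset.Icc 1 n → rk u < rk (par u)) : k < q := by
  by_contra hq
  have hqk : q = k := le_antisymm (not_lt.1 hq) h.le_q
  have hne : ((Finset.Icc 1 n).filter fun u => ∀ a < k, ord a ≠ u).Nonempty := by
    by_contra hemp
    rw [Finset.not_nonempty_iff_eq_empty, Finset.filter_eq_empty_iff] at hemp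
    have hsub : Finset.Icc 1 n ⊆ (Finset.range k).image ord := by
      intro u hu
      have := hemp hu
      push Not at this
      obtain ⟨a, ha, e⟩ := this
      exact Finset.mem_image.2 ⟨a, Finset.mem_range.2 ha, e⟩
    have := (Finset.card_le_card hsub).trans Finset.card_image_le
    simp at this
    omega
  obtain ⟨v, hv, hmin⟩ := Finset.exists_min_image _ rk hne
  rw [Finset.mem_filter] at hv
  have hd : deg v ≠ 0 := by
    rw [Ne, h.deg_iff v hv.1, hqk]
    rintro ⟨a, ha, e⟩
    exact hv.2 a ha e
  rw [h.deg_eq v hv.1, ← Nat.pos_iff_ne_zero, Finset.card_pos] at hd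
  obtain ⟨u, hu⟩ := hd
  rw [Finset.mem_filter] at hu
  have h1 := hmin u (Finset.mem_filter.2 ⟨hu.1, hu.2.2⟩)
  have h2 := hrk u hu.1 (by rw [hu.2.1]; exact hv.1)
  rw [hu.2.1] at h2
  omega

lemma filter_succ (h : QueueState n par k deg ord q) (hkq : k < q) {v : ℕ} :
    ((Finset.Icc 1 n).filter fun u => par u = v ∧ ∀ a < k + 1, ord a ≠ u) =
      ((Finset.Icc 1 n).filter fun u => par u = v ∧ ∀ a < k, ord a ≠ u).erase (ord k) := by
  ext u
  simp only [Finset.mem_filter, Finset.mem_erase]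
  constructor
  · rintro ⟨h1, h2, h3⟩
    exact ⟨(h3 k (by omega)).symm, h1, h2, fun a ha => h3 a (by omega)⟩
  · rintro ⟨h0, h1, h2, h3⟩
    refine ⟨h1, h2, fun a ha => ?_⟩
    rcases Nat.lt_succ_iff_lt_or_eq.1 ha with ha | rfl
    · exact h3 a ha
    · exact h0.symm

lemma card_filter_of_ne (h : QueueState n par k deg ord q) (hkq : k < q) {v : ℕ}
    (hv : par (ord k) ≠ v) :
    ((Finset.Icc 1 n).filter fun u => par u = v ∧ ∀ a < k + 1, ord a ≠ u).card =
      ((Finset.Icc 1 n).filter fun u => par u = v ∧ ∀ a < k, ord a ≠ u).card := by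
  rw [h.filter_succ hkq, Finset.erase_eq_of_notMem]
  rw [Finset.mem_filter]
  exact fun hm => hv hm.2.1

lemma mem_filter (h : QueueState n par k deg ord q) (hkq : k < q) :
    ord k ∈ (Finset.Icc 1 n).filter fun u => par u = par (ord k) ∧ ∀ a < k, ord a ≠ u := by
  rw [Finset.mem_filter]
  refine ⟨h.mem k hkq, rfl, fun a ha e => ?_⟩
  have := h.inj a (by omega) k hkq e
  omega

/-- Taking a root. -/
lemma succ_root (h : QueueState n par k deg ord q) (hkq : k < q) (hp : par (ord k) = 0) :
    QueueState n par (k + 1) deg ord q := by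
  refine ⟨hkq, h.q_le, h.mem, h.inj, fun v hv => ?_, h.deg_iff, h.child⟩
  rw [h.card_filter_of_ne hkq (by rw [hp]; rintro rfl; simp at hv), h.deg_eq v hv]

/-- Taking a vertex whose parent has further children. -/
lemma succ_wait (h : QueueState n par k deg ord q) (hkq : k < q)
    (hd : 1 < deg (par (ord k))) :
    QueueState n par (k + 1) (Function.update deg (par (ord k)) (deg (par (ord k)) - 1)) ord q := by
  refine ⟨hkq, h.q_le, h.mem, h.inj, fun v hv => ?_, fun v hv => ?_, h.child⟩
  · by_cases he : v = par (ord k)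
    · subst he
      rw [Function.update_self, h.filter_succ hkq, Finset.card_erase_of_mem (h.mem_filter hkq),
        h.deg_eq _ hv]
    · rw [Function.update_of_ne he, h.card_filter_of_ne hkq (Ne.symm he), h.deg_eq v hv]
  · rw [← h.deg_iff v hv]
    by_cases he : v = par (ord k)
    · subst he
      rw [Function.update_self]
      omega
    · rw [Function.update_of_ne he]

/-- Taking the last child of a vertex. -/
lemma succ_push (h : QueueState n par k deg ord q) (hkq : k < q)
    (hp : par (ord k) ∈ Finset.Icc 1 n) (hd : deg (par (ord k)) ≤ 1) :
    q < n ∧ QueueState n par (k + 1) (Function.update deg (par (ord k)) (deg (par (ord k)) - 1))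
      (Function.update ord q (par (ord k))) (q + 1) := by
  have hcard := h.deg_eq _ hp
  have hpos : 0 < deg (par (ord k)) := by
    rw [hcard]
    exact Finset.card_pos.2 ⟨_, h.mem_filter hkq⟩
  have hnot : ∀ a < q, ord a ≠ par (ord k) := fun a ha e =>
    hpos.ne' ((h.deg_iff _ hp).2 ⟨a, ha, e⟩)
  have hlt : q < n := by
    have hsub : insert (par (ord k)) ((Finset.range q).image ord) ⊆ Finset.Icc 1 n := by
      intro x hx
      rcases Finset.mem_insert.1 hx with rfl | hx
      · exact hp
      · obtain ⟨a, ha, rfl⟩ := Finset.mem_image.1 hx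
        exact h.mem a (Finset.mem_range.1 ha)
    have := Finset.card_le_card hsub
    rw [Finset.card_insert_of_notMem, Finset.card_image_of_injOn] at this
    · simp at this; omega
    · intro a ha b hb e
      exact h.inj a (by simpa using ha) b (by simpa using hb) e
    · intro hx
      obtain ⟨a, ha, e⟩ := Finset.mem_image.1 hx
      exact hnot a (Finset.mem_range.1 ha) e
  have eo : ∀ a < q, Function.update ord q (par (ord k)) a = ord a := fun a ha =>
    Function.update_of_ne (by omega) _ _
  have eq : Function.update ord q (par (ord k)) q = par (ord k) := Function.update_self _ _ _
  have efil : ∀ v, ((Finset.Icc 1 n).filter fun u => par u = v ∧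
      ∀ a < k + 1, Function.update ord q (par (ord k)) a ≠ u) =
      ((Finset.Icc 1 n).filter fun u => par u = v ∧ ∀ a < k + 1, ord a ≠ u) := by
    intro v
    refine Finset.filter_congr fun u _ => and_congr_right fun _ => ?_
    refine forall_congr' fun a => imp_congr_right fun ha => ?_
    rw [eo a (by omega)]
  -- The counter says that the vertex just taken was the last missing child. So all children of the
  -- entering vertex precede it in `ord`.
  have hdeg0 : ((Finset.Icc 1 n).filter fun u => par u = par (ord k) ∧
      ∀ a < k + 1, ord a ≠ u).card = 0 := by
    rw [h.filter_succ hkq, Finset.card_erase_of_mem (h.mem_filter hkq), ← hcard]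
    omega
  refine ⟨hlt, by omega, hlt, fun a ha => ?_, fun a ha b hb e => ?_, fun v hv => ?_, fun v hv => ?_,
    fun b hb u hu e => ?_⟩
  · rcases Nat.lt_succ_iff_lt_or_eq.1 ha with ha | rfl
    · rw [eo a ha]; exact h.mem a ha
    · rw [eq]; exact hp
  · rcases Nat.lt_succ_iff_lt_or_eq.1 ha with ha | rfl <;>
      rcases Nat.lt_succ_iff_lt_or_eq.1 hb with hb | rfl
    · rw [eo a ha, eo b hb] at e; exact h.inj a ha b hb e
    · rw [eo a ha, eq] at e; exact absurd e (hnot a ha)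
    · rw [eo b hb, eq] at e; exact absurd e.symm (hnot b hb)
    · rfl
  · rw [efil]
    by_cases he : v = par (ord k)
    · subst he
      rw [Function.update_self, hdeg0]
      omega
    · rw [Function.update_of_ne he, h.card_filter_of_ne hkq (Ne.symm he), h.deg_eq v hv]
  · by_cases he : v = par (ord k)
    · subst he
      rw [Function.update_self]
      exact ⟨fun _ => ⟨q, by omega, eq⟩, fun _ => by omega⟩
    · rw [Function.update_of_ne he, h.deg_iff v hv]
      constructor
      · rintro ⟨a, ha, e⟩
        exact ⟨a, by omega, by rw [eo a ha, e]⟩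
      · rintro ⟨a, ha, e⟩
        rcases Nat.lt_succ_iff_lt_or_eq.1 ha with ha | rfl
        · exact ⟨a, ha, by rw [← eo a ha, e]⟩
        · rw [eq] at e; exact absurd e.symm he
  · rcases Nat.lt_succ_iff_lt_or_eq.1 hb with hb | rfl
    · rw [eo b hb] at e
      obtain ⟨a, ha, e'⟩ := h.child b hb u hu e
      exact ⟨a, ha, by rw [eo a (by omega), e']⟩
    · rw [eq] at e
      rw [Finset.card_eq_zero, Finset.filter_eq_empty_iff] at hdeg0
      have := hdeg0 hu
      push Not at this
      obtain ⟨a, ha, e'⟩ := this e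
      exact ⟨a, by omega, by rw [eo a (by omega), e']⟩

end QueueState

namespace Cmd

/-- The queue is processed: every vertex taken from it reduces the counter of its parent, which
enters when the counter gets zero. -/
def queuePass (par deg ord tl : ℕ) : Cmd :=
  .loop 0 1 <| .seq (.load 4 ord 0) <| .seq (.load 5 par 4) <| .seq (.const 6 0) <| .ifLt 6 5 <|
    .seq (.load 7 deg 5) <| .seq (.sub 7 7 3) <| .seq (.store deg 5 7) <| .ifLt 7 3 <|
    .seq (.load 8 tl 6) <| .seq (.store ord 8 5) <| .seq (.add 8 8 3) <| .store tl 6 8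

lemma eval_queuePass {cap par deg ord tl n : ℕ} {σ : Data} (hpd : par ≠ deg) (hpo : par ≠ ord)
    (hpt : par ≠ tl) (hdo : deg ≠ ord) (hdt : deg ≠ tl) (hot : ord ≠ tl)
    (h1 : σ.reg 1 = n) (h3 : σ.reg 3 = 1) (hn : n ≤ cap)
    (hpar : ∀ u ∈ Finset.Icc 1 n, σ.arr par u ≤ n)
    {rk : ℕ → ℕ} (hrk : ∀ u ∈ Finset.Icc 1 n, σ.arr par u ∈ Finset.Icc 1 n →
      rk u < rk (σ.arr par u))
    (h : QueueState n (σ.arr par) 0 (σ.arr deg) (σ.arr ord) (σ.arr tl 0)) :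
    IsChildrenFirst n (σ.arr par) (((queuePass par deg ord tl).eval cap σ).arr ord) := by
  have key := eval_loop_induction (cap := cap) (k := 0) (N := 1) (c := .seq (.load 4 ord 0) <|
      .seq (.load 5 par 4) <| .seq (.const 6 0) <| .ifLt 6 5 <| .seq (.load 7 deg 5) <|
      .seq (.sub 7 7 3) <| .seq (.store deg 5 7) <| .ifLt 7 3 <| .seq (.load 8 tl 6) <|
      .seq (.store ord 8 5) <| .seq (.add 8 8 3) <| .store tl 6 8) (σ := σ)
    (fun i A => QueueState n (σ.arr par) i (A deg) (A ord) (A tl 0)) h ?_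
  -- After n rounds k ≤ q ≤ n forces q = n, so every vertex has entered.
  · rw [h1] at key
    have hq := le_antisymm key.q_le key.le_q
    have hm := key.mem
    have hi := key.inj
    have hc := key.child
    rw [hq] at hm hi hc
    exact ⟨hm, hi, hc⟩
  · intro i hi τ hτ0 hτr hτa ih
    rw [h1] at hi
    have ha : τ.arr par = σ.arr par := hτa par (by simp [stores, hpd.symm, hpo.symm, hpt.symm])
    have hr3 : τ.reg 3 = 1 := by rw [hτr 3 (by omega) (by simp [writes]), h3]
    have hkq := ih.lt_q hi hrk
    have hmem := ih.mem i hkq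
    have hple := hpar _ hmem
    rcases Nat.eq_zero_or_pos (σ.arr par (τ.arr ord i)) with hp | hp
    · have e : ((seq (.load 4 ord 0) <|
        .seq (.load 5 par 4) <| .seq (.const 6 0) <| .ifLt 6 5 <| .seq (.load 7 deg 5) <|
        .seq (.sub 7 7 3) <| .seq (.store deg 5 7) <| .ifLt 7 3 <| .seq (.load 8 tl 6) <|
        .seq (.store ord 8 5) <| .seq (.add 8 8 3) <| .store tl 6 8).eval cap τ).arr = τ.arr := by
        simp [eval, Data.set, hτ0, ha, hp]
      rw [e]
      exact ih.succ_root hkq hp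
    · rcases Nat.lt_or_ge 1 (τ.arr deg (σ.arr par (τ.arr ord i))) with hd | hd
      · have e : ((seq (.load 4 ord 0) <|
          .seq (.load 5 par 4) <| .seq (.const 6 0) <| .ifLt 6 5 <| .seq (.load 7 deg 5) <|
          .seq (.sub 7 7 3) <| .seq (.store deg 5 7) <| .ifLt 7 3 <| .seq (.load 8 tl 6) <|
          .seq (.store ord 8 5) <| .seq (.add 8 8 3) <| .store tl 6 8).eval cap τ).arr =
            Function.update τ.arr deg (Function.update (τ.arr deg) (σ.arr par (τ.arr ord i))
              (τ.arr deg (σ.arr par (τ.arr ord i)) - 1)) := by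
          have : τ.arr deg (σ.arr par (τ.arr ord i)) - 1 ≠ 0 := by omega
          simp [eval, Data.set, Data.put, hτ0, ha, hp, hr3, this]
        rw [e, Function.update_self, Function.update_of_ne hdo.symm, Function.update_of_ne hdt.symm]
        exact ih.succ_wait hkq hd
      · obtain ⟨hqn, hst⟩ := ih.succ_push hkq (Finset.mem_Icc.2 ⟨hp, hple⟩) hd
        have e : ((seq (.load 4 ord 0) <|
          .seq (.load 5 par 4) <| .seq (.const 6 0) <| .ifLt 6 5 <| .seq (.load 7 deg 5) <|
          .seq (.sub 7 7 3) <| .seq (.store deg 5 7) <| .ifLt 7 3 <| .seq (.load 8 tl 6) <|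
          .seq (.store ord 8 5) <| .seq (.add 8 8 3) <| .store tl 6 8).eval cap τ).arr =
            Function.update (Function.update (Function.update τ.arr deg (Function.update (τ.arr deg)
              (σ.arr par (τ.arr ord i)) (τ.arr deg (σ.arr par (τ.arr ord i)) - 1))) ord
              (Function.update (τ.arr ord) (τ.arr tl 0) (σ.arr par (τ.arr ord i)))) tl
              (Function.update (τ.arr tl) 0 (τ.arr tl 0 + 1)) := by
          have : τ.arr deg (σ.arr par (τ.arr ord i)) - 1 = 0 := by omega
          simp (disch := omega) [eval, Data.set, Data.put, hτ0, ha, hp, hr3, this]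
        rw [e]
        simpa [hdo, hdt, hot] using hst

/-! ### Sums over subtrees and along paths -/

/-- Sum up, over the subtree of each vertex, `1` for each vertex and `1` for each edge. -/
def subtreePass (par ord N : ℕ) : Cmd :=
  .loop 0 1 <| .seq (.load 4 ord 0) <| .seq (.load 5 N 4) <| .seq (.add 5 5 3) <|
    .seq (.store N 4 5) <| .seq (.add 5 5 3) <| .seq (.load 6 par 4) <| .seq (.load 7 N 6) <|
    .seq (.add 7 7 5) <| .store N 6 7

lemma eval_subtreePass {cap par ord N n : ℕ} {σ : Data} (hpN : par ≠ N) (hoN : ord ≠ N)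
    (h1 : σ.reg 1 = n) (h3 : σ.reg 3 = 1) (h0 : σ.arr N = fun _ => 0)
    (hord : IsChildrenFirst n (σ.arr par) (σ.arr ord))
    {f : ℕ → ℕ} (hf : ∀ v ∈ Finset.Icc 1 n,
      f v = 1 + ∑ u ∈ (Finset.Icc 1 n).filter (fun u => σ.arr par u = v), (f u + 1))
    (hcap : ∀ v ∈ Finset.Icc 1 n, f v + 1 ≤ cap) :
    ∀ v ∈ Finset.Icc 1 n, ((subtreePass par ord N).eval cap σ).arr N v = f v := by
  have key := eval_loop_induction (cap := cap) (k := 0) (N := 1) (c := .seq (.load 4 ord 0) <|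
      .seq (.load 5 N 4) <| .seq (.add 5 5 3) <| .seq (.store N 4 5) <| .seq (.add 5 5 3) <|
      .seq (.load 6 par 4) <| .seq (.load 7 N 6) <| .seq (.add 7 7 5) <| .store N 6 7) (σ := σ)
    -- An entry collects the contributions of the children already taken, and its own 1 when its
    -- turn comes.
    (fun i A => ∀ v ∈ Finset.Icc 1 n, A N v = (if ∃ a < i, σ.arr ord a = v then 1 else 0) +
      ∑ u ∈ (Finset.Icc 1 n).filter (fun u => σ.arr par u = v ∧ ∃ a < i, σ.arr ord a = u),
        (f u + 1)) (fun v _ => by simp [h0]) ?_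
  · intro v hv
    rw [h1] at key
    rw [subtreePass, key v hv, hf v hv, if_pos (hord.exists_eq hv)]
    congr 2
    refine Finset.filter_congr fun u hu => and_iff_left (hord.exists_eq hu)
  · intro i hi τ hτ0 hτr hτa ih
    rw [h1] at hi
    have hap : τ.arr par = σ.arr par := hτa par (by simp [stores, hpN.symm])
    have hao : τ.arr ord = σ.arr ord := hτa ord (by simp [stores, hoN.symm])
    have hr3 : τ.reg 3 = 1 := by rw [hτr 3 (by omega) (by simp [writes]), h3]
    have hv := hord.mem i hi
    have hnot : ¬ ∃ a < i, σ.arr ord a = σ.arr ord i := by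
      rintro ⟨a, ha, e⟩
      have := hord.inj a (by omega) i hi e
      omega
    -- When a vertex is taken, all its children have been taken, so its entry is complete up to its
    -- own 1.
    have hNv : τ.arr N (σ.arr ord i) + 1 = f (σ.arr ord i) := by
      rw [ih _ hv, hf _ hv, if_neg hnot, zero_add, add_comm]
      congr 2
      refine Finset.filter_congr fun u hu => ⟨fun h => h.1, fun h => ⟨h, ?_⟩⟩
      exact hord.child i hi u hu h
    have hcv := hcap _ hv
    have hpv : σ.arr par (σ.arr ord i) ≠ σ.arr ord i := by
      intro e
      exact hnot (hord.child i hi _ hv e)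
    have hev : ((seq (.load 4 ord 0) <|
      .seq (.load 5 N 4) <| .seq (.add 5 5 3) <| .seq (.store N 4 5) <| .seq (.add 5 5 3) <|
      .seq (.load 6 par 4) <| .seq (.load 7 N 6) <| .seq (.add 7 7 5) <|
      .store N 6 7).eval cap τ).arr N = Function.update (Function.update (τ.arr N) (σ.arr ord i)
        (f (σ.arr ord i))) (σ.arr par (σ.arr ord i))
        (min (τ.arr N (σ.arr par (σ.arr ord i)) + (f (σ.arr ord i) + 1)) cap) := by
      simp (disch := omega) [eval, Data.set, Data.put, hτ0, hap, hao, hr3, hNv]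
    have hsplit : ∀ v, σ.arr par (σ.arr ord i) ≠ v →
        ((Finset.Icc 1 n).filter fun u => σ.arr par u = v ∧ ∃ a < i + 1, σ.arr ord a = u) =
        ((Finset.Icc 1 n).filter fun u => σ.arr par u = v ∧ ∃ a < i, σ.arr ord a = u) := by
      intro v hne
      refine Finset.filter_congr fun u _ => and_congr_right fun hu => ⟨?_, ?_⟩
      · rintro ⟨a, ha, e⟩
        rcases Nat.lt_succ_iff_lt_or_eq.1 ha with ha | rfl
        · exact ⟨a, ha, e⟩
        · subst e; exact absurd hu hne
      · rintro ⟨a, ha, e⟩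
        exact ⟨a, by omega, e⟩
    intro v hvm
    rw [hev]
    by_cases hvp : v = σ.arr par (σ.arr ord i)
    · have hvo : (∃ a < i + 1, σ.arr ord a = v) ↔ ∃ a < i, σ.arr ord a = v := by
        constructor
        · rintro ⟨a, ha, e⟩
          rcases Nat.lt_succ_iff_lt_or_eq.1 ha with ha | rfl
          · exact ⟨a, ha, e⟩
          · rw [e] at hvp hpv; exact absurd hvp.symm hpv
        · rintro ⟨a, ha, e⟩
          exact ⟨a, by omega, e⟩
      have hins : ((Finset.Icc 1 n).filter fun u => σ.arr par u = v ∧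
          ∃ a < i + 1, σ.arr ord a = u) = insert (σ.arr ord i) ((Finset.Icc 1 n).filter fun u =>
            σ.arr par u = v ∧ ∃ a < i, σ.arr ord a = u) := by
        ext u
        simp only [Finset.mem_filter, Finset.mem_insert]
        constructor
        · rintro ⟨hu, hu', a, ha, e⟩
          rcases Nat.lt_succ_iff_lt_or_eq.1 ha with ha | rfl
          · exact Or.inr ⟨hu, hu', a, ha, e⟩
          · exact Or.inl e.symm
        · rintro (rfl | ⟨hu, hu', a, ha, e⟩)
          · exact ⟨hv, hvp.symm, i, by omega, rfl⟩
          · exact ⟨hu, hu', a, by omega, e⟩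
      have hval : τ.arr N v + (f (σ.arr ord i) + 1) =
          (if ∃ a < i + 1, σ.arr ord a = v then 1 else 0) +
          ∑ u ∈ (Finset.Icc 1 n).filter (fun u => σ.arr par u = v ∧ ∃ a < i + 1, σ.arr ord a = u),
            (f u + 1) := by
        rw [hins, Finset.sum_insert, ih v hvm]
        · simp only [hvo]; ring
        · rw [Finset.mem_filter]; exact fun h => hnot h.2.2
      -- Partial sums are bounded by the final value, so the cut-off at `cap` has no effect.
      have hle : τ.arr N v + (f (σ.arr ord i) + 1) ≤ cap := by
        refine le_trans ?_ ((Nat.le_succ _).trans (hcap v hvm))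
        rw [hval, hf v hvm]
        refine Nat.add_le_add (by split_ifs <;> omega) (Finset.sum_le_sum_of_subset ?_)
        intro u hu
        rw [Finset.mem_filter] at hu ⊢
        exact ⟨hu.1, hu.2.1⟩
      rw [hvp, Function.update_self, ← hvp, min_eq_left hle, hval]
    · rw [Function.update_of_ne hvp, hsplit v (Ne.symm hvp)]
      by_cases hvo : v = σ.arr ord i
      · rw [hvo, Function.update_self, if_pos ⟨i, by omega, rfl⟩, ← hNv, ih _ hv, if_neg hnot]
        ring
      · rw [Function.update_of_ne hvo, ih v hvm]
        congr 1
        have : (∃ a < i + 1, σ.arr ord a = v) ↔ ∃ a < i, σ.arr ord a = v := by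
          constructor
          · rintro ⟨a, ha, e⟩
            rcases Nat.lt_succ_iff_lt_or_eq.1 ha with ha | rfl
            · exact ⟨a, ha, e⟩
            · exact absurd e.symm hvo
          · rintro ⟨a, ha, e⟩
            exact ⟨a, by omega, e⟩
        simp only [this]

/-- Sum up `N` over the path from each vertex to its root. -/
def pathPass (par ord N Q : ℕ) : Cmd :=
  .loop 0 1 <| .seq (.sub 4 1 0) <| .seq (.sub 4 4 3) <| .seq (.load 5 ord 4) <|
    .seq (.load 6 par 5) <| .seq (.load 7 Q 6) <| .seq (.load 8 N 5) <| .seq (.add 7 8 7) <|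
    .store Q 5 7

lemma eval_pathPass {cap par ord N Q n : ℕ} {σ : Data} (hpQ : par ≠ Q) (hoQ : ord ≠ Q)
    (hNQ : N ≠ Q) (h1 : σ.reg 1 = n) (h3 : σ.reg 3 = 1) (h0 : σ.arr Q 0 = 0)
    (hord : IsChildrenFirst n (σ.arr par) (σ.arr ord)) (hpar : ∀ u ∈ Finset.Icc 1 n, σ.arr par u ≤ n)
    {f : ℕ → ℕ} (hf0 : f 0 = 0)
    (hf : ∀ v ∈ Finset.Icc 1 n, f v = σ.arr N v + f (σ.arr par v))
    (hcap : ∀ v ∈ Finset.Icc 1 n, f v ≤ cap) :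
    ∀ v ∈ Finset.Icc 1 n, ((pathPass par ord N Q).eval cap σ).arr Q v = f v := by
  have key := eval_loop_induction (cap := cap) (k := 0) (N := 1) (c := .seq (.sub 4 1 0) <|
      .seq (.sub 4 4 3) <| .seq (.load 5 ord 4) <| .seq (.load 6 par 5) <| .seq (.load 7 Q 6) <|
      .seq (.load 8 N 5) <| .seq (.add 7 8 7) <| .store Q 5 7) (σ := σ)
    (fun i A => A Q 0 = 0 ∧ ∀ a < n, n ≤ a + i → A Q (σ.arr ord a) = f (σ.arr ord a))
    ⟨h0, fun a ha hn => by omega⟩ ?_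
  · intro v hv
    rw [h1] at key
    obtain ⟨a, ha, rfl⟩ := hord.exists_eq hv
    exact key.2 a ha (by omega)
  · rintro i hi τ hτ0 hτr hτa ⟨ih0, ih⟩
    rw [h1] at hi
    have hap : τ.arr par = σ.arr par := hτa par (by simp [stores, hpQ.symm])
    have hao : τ.arr ord = σ.arr ord := hτa ord (by simp [stores, hoQ.symm])
    have haN : τ.arr N = σ.arr N := hτa N (by simp [stores, hNQ.symm])
    have hr3 : τ.reg 3 = 1 := by rw [hτr 3 (by omega) (by simp [writes]), h3]
    have hr1 : τ.reg 1 = n := by rw [hτr 1 (by omega) (by simp [writes]), h1]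
    -- The order is traversed backwards, so that parents come first.
    set b := n - i - 1 with hb
    have hbn : b < n := by omega
    have hv := hord.mem b hbn
    -- The entry of the parent is final: for a root it is the 0 in entry 0, and otherwise the parent
    -- stands at a later place of `ord` and has been treated before.
    have hQp : τ.arr Q (σ.arr par (σ.arr ord b)) = f (σ.arr par (σ.arr ord b)) := by
      rcases Nat.eq_zero_or_pos (σ.arr par (σ.arr ord b)) with hp | hp
      · rw [hp, ih0, hf0]
      · obtain ⟨a, ha, e⟩ := hord.exists_eq (Finset.mem_Icc.2 ⟨hp, hpar _ hv⟩)
        obtain ⟨b', hb', e'⟩ := hord.child a ha _ hv e.symm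
        have := hord.inj b' (by omega) b hbn e'
        rw [← e]
        exact ih a ha (by omega)
    have hle := hcap _ hv
    have hfv := hf _ hv
    have e : ((seq (.sub 4 1 0) <| .seq (.sub 4 4 3) <| .seq (.load 5 ord 4) <|
        .seq (.load 6 par 5) <| .seq (.load 7 Q 6) <| .seq (.load 8 N 5) <| .seq (.add 7 8 7) <|
        .store Q 5 7).eval cap τ).arr Q =
        Function.update (τ.arr Q) (σ.arr ord b) (f (σ.arr ord b)) := by
      have hle' : σ.arr N (σ.arr ord b) + f (σ.arr par (σ.arr ord b)) ≤ cap := by omega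
      simp [eval, Data.set, Data.put, hτ0, hap, hao, haN, hr1, hr3, ← hb, hQp, hfv, hle']
    rw [e]
    constructor
    · rw [Function.update_of_ne, ih0]
      intro h
      rw [← h] at hv
      simp at hv
    · intro a ha hai
      by_cases hab : σ.arr ord a = σ.arr ord b
      · rw [hab, Function.update_self]
      · rw [Function.update_of_ne hab]
        refine ih a ha ?_
        have : a ≠ b := fun h => hab (by rw [h])
        omega

/-- Write one of the coordinates. -/
def outputPass (Qa Qb N : ℕ) (x : Fin 8) : Cmd :=
  .loop 0 1 <| .seq (.add 4 0 3) <| .seq (.load 5 Qa 4) <| .seq (.load 6 Qb 4) <|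
    .seq (.add 5 5 6) <| .seq (.load 6 N 4) <| .seq (.sub 5 5 6) <| .seq (.const 6 2) <|
    .seq (.sub 5 5 6) <| .seq (.add 7 0 0) <| .seq (.const 8 x) <| .seq (.add 7 7 8) <|
    .store 0 7 5

/-- The coordinates overwrite the input in array 0, which is no longer needed by then. The constant
2 is the one in `treeQ_add_treeQ`. -/
lemma eval_outputPass {cap Qa Qb N n : ℕ} {x : Fin 8} {σ : Data} (ha : Qa ≠ 0) (hb : Qb ≠ 0)
    (hN : N ≠ 0) (h1 : σ.reg 1 = n) (h3 : σ.reg 3 = 1) (hn : 2 * n + 8 ≤ cap)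
    (hcap : ∀ v ∈ Finset.Icc 1 n, σ.arr Qa v + σ.arr Qb v ≤ cap) :
    (∀ i < n, ((outputPass Qa Qb N x).eval cap σ).arr 0 (2 * i + x) =
      σ.arr Qa (i + 1) + σ.arr Qb (i + 1) - σ.arr N (i + 1) - 2) ∧
    ∀ y, (∀ i < n, y ≠ 2 * i + x) → ((outputPass Qa Qb N x).eval cap σ).arr 0 y = σ.arr 0 y := by
  have key := eval_loop_induction (cap := cap) (k := 0) (N := 1) (c := .seq (.add 4 0 3) <|
      .seq (.load 5 Qa 4) <| .seq (.load 6 Qb 4) <| .seq (.add 5 5 6) <| .seq (.load 6 N 4) <|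
      .seq (.sub 5 5 6) <| .seq (.const 6 2) <| .seq (.sub 5 5 6) <| .seq (.add 7 0 0) <|
      .seq (.const 8 x) <| .seq (.add 7 7 8) <| .store 0 7 5) (σ := σ)
    (fun i A => (∀ j < i, A 0 (2 * j + x) =
      σ.arr Qa (j + 1) + σ.arr Qb (j + 1) - σ.arr N (j + 1) - 2) ∧
      ∀ y, (∀ j < i, y ≠ 2 * j + x) → A 0 y = σ.arr 0 y) ⟨by simp, by simp⟩ ?_
  · rw [h1] at key
    exact key
  · rintro i hi τ hτ0 hτr hτa ⟨ih, ih'⟩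
    rw [h1] at hi
    have hea : τ.arr Qa = σ.arr Qa := hτa Qa (by simp [stores, ha.symm])
    have heb : τ.arr Qb = σ.arr Qb := hτa Qb (by simp [stores, hb.symm])
    have heN : τ.arr N = σ.arr N := hτa N (by simp [stores, hN.symm])
    have hr3 : τ.reg 3 = 1 := by rw [hτr 3 (by omega) (by simp [writes]), h3]
    have hc := hcap (i + 1) (Finset.mem_Icc.2 ⟨by omega, by omega⟩)
    have hx := x.2
    have hx' : i + i + (x : ℕ) ≤ cap := by omega
    have e : ((seq (.add 4 0 3) <|
      .seq (.load 5 Qa 4) <| .seq (.load 6 Qb 4) <| .seq (.add 5 5 6) <| .seq (.load 6 N 4) <|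
      .seq (.sub 5 5 6) <| .seq (.const 6 2) <| .seq (.sub 5 5 6) <| .seq (.add 7 0 0) <|
      .seq (.const 8 x) <| .seq (.add 7 7 8) <| .store 0 7 5).eval cap τ).arr 0 =
        Function.update (τ.arr 0) (2 * i + x)
          (σ.arr Qa (i + 1) + σ.arr Qb (i + 1) - σ.arr N (i + 1) - 2) := by
      simp (disch := omega) [eval, Data.set, Data.put, hτ0, hea, heb, heN, hr3, two_mul]
    rw [e]
    constructor
    · intro j hj
      by_cases hij : j = i
      · rw [hij, Function.update_self]
      · rw [Function.update_of_ne (by omega), ih j (by omega)]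
    · intro y hy
      rw [Function.update_of_ne (hy i (by omega)), ih' y fun j hj => hy j (by omega)]

end Cmd


namespace Cmd

/-! ### The complete algorithm -/

/-- Parents, and an order with children before parents, for one of the trees. -/
def forestPass (a b : Fin 8) (par deg ord tl : ℕ) : Cmd :=
  .seq (parentPass a b par) <| .seq (degreePass par deg) <| .seq (leafPass deg ord tl) <|
    queuePass par deg ord tl

lemma eval_forestPass {cap : ℕ} {a b : Fin 8} {par deg ord tl n m : ℕ} {σ : Data}
    {t r l f : ℕ → ℕ} (hab : (b : ℕ) = a + 2) (hpar : par ≠ 0)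
    (hpd : par ≠ deg) (hpo : par ≠ ord) (hpt : par ≠ tl) (hdo : deg ≠ ord) (hdt : deg ≠ tl)
    (hot : ord ≠ tl) (h1 : σ.reg 1 = n) (h2 : σ.reg 2 = m) (h3 : σ.reg 3 = 1) (hn : n ≤ cap)
    (hm : 4 * m + 5 ≤ cap)
    (ht : ∀ i < m, σ.arr 0 (4 * i + 5) = t i) (hr : ∀ i < m, σ.arr 0 (4 * i + 6) = r i)
    (hl : ∀ i < m, σ.arr 0 (4 * i + 8) = l i) (hrm : ∀ i < m, r i < m)
    (htc : ∀ i < m, t i + 1 ≤ cap)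
    (h0 : σ.arr par = fun _ => 0) (h0' : σ.arr deg = fun _ => 0) (h0'' : σ.arr tl = fun _ => 0)
    (hf : ∀ i < m, l i = a + 1 → f (t i + 1) = t (r i) + 1)
    (hf0 : ∀ v, (∀ i < m, l i = a + 1 → t i + 1 ≠ v) → f v = 0)
    (hfn : ∀ u ∈ Finset.Icc 1 n, f u ≤ n)
    {rk : ℕ → ℕ} (hrk : ∀ u ∈ Finset.Icc 1 n, f u ∈ Finset.Icc 1 n → rk u < rk (f u)) :
    ((forestPass a b par deg ord tl).eval cap σ).arr par = f ∧
      IsChildrenFirst n f (((forestPass a b par deg ord tl).eval cap σ).arr ord) := by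
  set σ₁ := (parentPass a b par).eval cap σ with hσ₁
  set σ₂ := (degreePass par deg).eval cap σ₁ with hσ₂
  set σ₃ := (leafPass deg ord tl).eval cap σ₂ with hσ₃
  have e : (forestPass a b par deg ord tl).eval cap σ = (queuePass par deg ord tl).eval cap σ₃ := rfl
  have p1 : σ₁.arr par = f := eval_parentPass hab hpar h2 h3 hm ht hr hl hrm htc h0 hf hf0
  have p2 : σ₂.arr par = f := by
    rw [hσ₂, eval_arr_of_not_stores cap _ (by simp [degreePass, stores, hpd.symm]), p1]
  have p3 : σ₃.arr par = f := by
    rw [hσ₃, eval_arr_of_not_stores cap _ (by simp [leafPass, stores, hpo.symm, hpt.symm]), p2]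
  have r1 : σ₁.reg 1 = n ∧ σ₁.reg 3 = 1 :=
    ⟨(eval_reg_of_not_writes cap _ rfl _).trans h1, (eval_reg_of_not_writes cap _ rfl _).trans h3⟩
  have r2 : σ₂.reg 1 = n ∧ σ₂.reg 3 = 1 :=
    ⟨(eval_reg_of_not_writes cap _ rfl _).trans r1.1, (eval_reg_of_not_writes cap _ rfl _).trans r1.2⟩
  have r3 : σ₃.reg 1 = n ∧ σ₃.reg 3 = 1 :=
    ⟨(eval_reg_of_not_writes cap _ rfl _).trans r2.1, (eval_reg_of_not_writes cap _ rfl _).trans r2.2⟩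
  have d1 : σ₁.arr deg = fun _ => 0 := by
    rw [hσ₁, eval_arr_of_not_stores cap _ (by simp [parentPass, parentBody, stores, hpd]), h0']
  have d2 : ∀ v, σ₂.arr deg v = ((Finset.Icc 1 n).filter fun u => f u = v).card := by
    intro v
    rw [hσ₂, eval_degreePass hpd r1.1 r1.2 hn d1, p1]
  have d3 : σ₃.arr deg = σ₂.arr deg :=
    eval_arr_of_not_stores cap _ (by simp [leafPass, stores, hdo.symm, hdt.symm]) _
  have t2 : σ₂.arr tl 0 = 0 := by
    rw [hσ₂, eval_arr_of_not_stores cap _ (by simp [degreePass, stores, hdt]), hσ₁,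
      eval_arr_of_not_stores cap _ (by simp [parentPass, parentBody, stores, hpt]), h0'']
  obtain ⟨q, hqn, hq, hinj, hmem, hiff⟩ := eval_leafPass hdo hdt hot r2.1 r2.2 hn t2
  rw [← hσ₃] at hq hinj hmem hiff
  rw [← d3] at hiff
  -- Before any vertex is taken, the counters are the full numbers of children and the queue
  -- consists of the leaves.
  have hst : QueueState n (σ₃.arr par) 0 (σ₃.arr deg) (σ₃.arr ord) (σ₃.arr tl 0) := by
    rw [p3, hq]
    refine ⟨Nat.zero_le _, hqn, hmem, hinj, fun v _ => ?_, hiff, fun b hb u hu hub => ?_⟩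
    · rw [d3, d2]
      congr 1
      exact Finset.filter_congr fun u _ => by simp
    · have := (hiff _ (hmem b hb)).2 ⟨b, hb, rfl⟩
      rw [d3, d2, Finset.card_eq_zero, Finset.filter_eq_empty_iff] at this
      exact absurd hub (this hu)
  rw [e]
  refine ⟨?_, ?_⟩
  · rw [eval_arr_of_not_stores cap _ (by simp [queuePass, stores, hpd.symm, hpo.symm, hpt.symm]), p3]
  · have := eval_queuePass hpd hpo hpt hdo hdt hot r3.1 r3.2 hn (by rw [p3]; exact hfn)
      (by rw [p3]; exact hrk) hst
    rwa [p3] at this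

/-- Read the numbers of vertices and darts and the outer vertices. -/
def setup : Cmd :=
  .seq (.const 3 1) <| .seq (.const 4 0) <| .seq (.load 1 0 4) <| .seq (.load 2 0 3) <|
  .seq (.const 4 2) <| .seq (.load 11 0 4) <| .seq (.const 4 3) <| .seq (.load 12 0 4) <|
  .seq (.const 4 4) <| .load 13 0 4

/-- Write the coordinates of the outer vertices. -/
def finish : Cmd :=
  .seq (.const 5 0) <| .seq (.add 6 1 1) <| .seq (.const 7 5) <| .seq (.sub 6 6 7) <|
  .seq (.add 4 11 11) <| .seq (.store 0 4 5) <| .seq (.add 4 4 3) <| .seq (.store 0 4 5) <|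
  .seq (.add 4 12 12) <| .seq (.store 0 4 6) <| .seq (.add 4 4 3) <| .seq (.store 0 4 5) <|
  .seq (.add 4 13 13) <| .seq (.store 0 4 5) <| .seq (.add 4 4 3) <| .store 0 4 6

/-- The algorithm. For color `j` the arrays `1 + j`, `4 + j`, `7 + j`, `10 + j` hold parents, numbers
of children, the order and the length of the queue. -/
def schnyder : Cmd :=
  .seq setup <| .seq (forestPass 0 2 1 4 7 10) <| .seq (forestPass 1 3 2 5 8 11) <|
  .seq (forestPass 2 4 3 6 9 12) <| .seq (subtreePass 2 8 13) <| .seq (subtreePass 3 9 14) <|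
  .seq (pathPass 3 9 13 15) <| .seq (pathPass 1 7 13 16) <| .seq (pathPass 1 7 14 17) <|
  .seq (pathPass 2 8 14 18) <| .seq (outputPass 15 16 13 0) <| .seq (outputPass 17 18 14 1) finish

lemma wf_schnyder : schnyder.wf = true := by decide

lemma unnested_schnyder : schnyder.unnested = true := by decide

/-- Outer vertices are corrected at the end, since the general formula does not apply to them. Their
numbers have been kept in registers because the input is overwritten. -/
lemma eval_finish {cap n u₀ u₁ u₂ : ℕ} {σ : Data} (h1 : σ.reg 1 = n) (h3 : σ.reg 3 = 1)
    (h11 : σ.reg 11 = u₀) (h12 : σ.reg 12 = u₁) (h13 : σ.reg 13 = u₂) (hn : 2 * n ≤ cap)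
    (hu₀ : u₀ < n) (hu₁ : u₁ < n) (hu₂ : u₂ < n) (h01 : u₀ ≠ u₁) (h02 : u₀ ≠ u₂) (h12' : u₁ ≠ u₂) :
    ((finish.eval cap σ).arr 0 (2 * u₀) = 0 ∧ (finish.eval cap σ).arr 0 (2 * u₀ + 1) = 0) ∧
    ((finish.eval cap σ).arr 0 (2 * u₁) = 2 * n - 5 ∧
      (finish.eval cap σ).arr 0 (2 * u₁ + 1) = 0) ∧
    ((finish.eval cap σ).arr 0 (2 * u₂) = 0 ∧
      (finish.eval cap σ).arr 0 (2 * u₂ + 1) = 2 * n - 5) ∧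
    ∀ i, i ≠ u₀ → i ≠ u₁ → i ≠ u₂ → (finish.eval cap σ).arr 0 (2 * i) = σ.arr 0 (2 * i) ∧
      (finish.eval cap σ).arr 0 (2 * i + 1) = σ.arr 0 (2 * i + 1) := by
  have e : (finish.eval cap σ).arr 0 = Function.update (Function.update (Function.update
      (Function.update (Function.update (Function.update (σ.arr 0) (2 * u₀) 0) (2 * u₀ + 1) 0)
        (2 * u₁) (2 * n - 5)) (2 * u₁ + 1) 0) (2 * u₂) 0) (2 * u₂ + 1) (2 * n - 5) := by
    simp (disch := omega) [finish, eval, Data.set, Data.put, h1, h3, h11, h12, h13, two_mul]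
  rw [e]
  refine ⟨⟨?_, ?_⟩, ⟨?_, ?_⟩, ⟨?_, ?_⟩, fun i hi hi' hi'' => ⟨?_, ?_⟩⟩ <;>
    simp (disch := omega) only [Function.update_self, Function.update_of_ne]

lemma eval_setup {cap : ℕ} (σ : Data) :
    (setup.eval cap σ).arr = σ.arr ∧ (setup.eval cap σ).reg 1 = σ.arr 0 0 ∧
      (setup.eval cap σ).reg 2 = σ.arr 0 1 ∧ (setup.eval cap σ).reg 3 = 1 ∧
      (setup.eval cap σ).reg 11 = σ.arr 0 2 ∧ (setup.eval cap σ).reg 12 = σ.arr 0 3 ∧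
      (setup.eval cap σ).reg 13 = σ.arr 0 4 := by
  simp [setup, eval, Data.set]

/-- The registers hold the data read at the start. -/
structure IsSetUp (n m u₀ u₁ u₂ : ℕ) (σ : Data) : Prop where
  n_eq : σ.reg 1 = n
  m_eq : σ.reg 2 = m
  one_eq : σ.reg 3 = 1
  outer₀ : σ.reg 11 = u₀
  outer₁ : σ.reg 12 = u₁
  outer₂ : σ.reg 13 = u₂

lemma IsSetUp.eval {n m u₀ u₁ u₂ : ℕ} {σ : Data} (h : IsSetUp n m u₀ u₁ u₂ σ) (cap : ℕ) (c : Cmd)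
    (hc : ∀ q ∈ [1, 2, 3, 11, 12, 13], c.writes q = false) :
    IsSetUp n m u₀ u₁ u₂ (c.eval cap σ) := by
  simp only [List.forall_mem_cons] at hc
  obtain ⟨c1, c2, c3, c4, c5, c6, -⟩ := hc
  exact ⟨(eval_reg_of_not_writes cap c c1 σ).trans h.n_eq,
    (eval_reg_of_not_writes cap c c2 σ).trans h.m_eq,
    (eval_reg_of_not_writes cap c c3 σ).trans h.one_eq,
    (eval_reg_of_not_writes cap c c4 σ).trans h.outer₀,
    (eval_reg_of_not_writes cap c c5 σ).trans h.outer₁,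
    (eval_reg_of_not_writes cap c c6 σ).trans h.outer₂⟩

/-- Only arithmetic on arrays is left here; the graph enters through the recursions assumed for `N`
and `Q`. -/
lemma eval_schnyder {cap n m u₀ u₁ u₂ : ℕ} {σ : Data} {t r l : ℕ → ℕ} {p N : Fin 3 → ℕ → ℕ}
    {Q : Fin 3 → Fin 3 → ℕ → ℕ} (hσ : ∀ s ≠ 0, σ.arr s = fun _ => 0)
    (h0 : σ.arr 0 0 = n) (h1 : σ.arr 0 1 = m) (h2 : σ.arr 0 2 = u₀) (h3 : σ.arr 0 3 = u₁)
    (h4 : σ.arr 0 4 = u₂) (hu₀ : u₀ < n) (hu₁ : u₁ < n) (hu₂ : u₂ < n) (h01 : u₀ ≠ u₁)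
    (h02 : u₀ ≠ u₂) (h12 : u₁ ≠ u₂) (hn : 2 * n + 8 ≤ cap) (hm : 4 * m + 5 ≤ cap)
    (ht : ∀ i < m, σ.arr 0 (4 * i + 5) = t i) (hr : ∀ i < m, σ.arr 0 (4 * i + 6) = r i)
    (hl : ∀ i < m, σ.arr 0 (4 * i + 8) = l i) (hrm : ∀ i < m, r i < m)
    (htc : ∀ i < m, t i + 1 ≤ cap)
    (hp : ∀ j : Fin 3, ∀ i < m, l i = (j : ℕ) + 1 → p j (t i + 1) = t (r i) + 1)
    (hp0 : ∀ j : Fin 3, ∀ v, (∀ i < m, l i = (j : ℕ) + 1 → t i + 1 ≠ v) → p j v = 0)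
    (hpn : ∀ j, ∀ u ∈ Finset.Icc 1 n, p j u ≤ n)
    (hN : ∀ j, ∀ v ∈ Finset.Icc 1 n,
      N j v = 1 + ∑ u ∈ (Finset.Icc 1 n).filter (fun u => p j u = v), (N j u + 1))
    (hNc : ∀ j, ∀ v ∈ Finset.Icc 1 n, N j v + 1 ≤ cap) (hQ0 : ∀ i j, Q i j 0 = 0)
    (hQ : ∀ i j, i ≠ j → ∀ v ∈ Finset.Icc 1 n, Q i j v = N i v + Q i j (p j v))
    (hQc : ∀ i j, ∀ v ∈ Finset.Icc 1 n, 2 * Q i j v ≤ cap) :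
    ((schnyder.eval cap σ).arr 0 (2 * u₀) = 0 ∧ (schnyder.eval cap σ).arr 0 (2 * u₀ + 1) = 0) ∧
    ((schnyder.eval cap σ).arr 0 (2 * u₁) = 2 * n - 5 ∧
      (schnyder.eval cap σ).arr 0 (2 * u₁ + 1) = 0) ∧
    ((schnyder.eval cap σ).arr 0 (2 * u₂) = 0 ∧
      (schnyder.eval cap σ).arr 0 (2 * u₂ + 1) = 2 * n - 5) ∧
    ∀ i < n, i ≠ u₀ → i ≠ u₁ → i ≠ u₂ →
      (schnyder.eval cap σ).arr 0 (2 * i) =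
        Q 1 2 (i + 1) + Q 1 0 (i + 1) - N 1 (i + 1) - 2 ∧
      (schnyder.eval cap σ).arr 0 (2 * i + 1) =
        Q 2 0 (i + 1) + Q 2 1 (i + 1) - N 2 (i + 1) - 2 := by
  -- By its recursion, `N` grows strictly from child to parent, so it serves as the rank that keeps
  -- the queue from running dry.
  have hrk : ∀ j, ∀ u ∈ Finset.Icc 1 n, p j u ∈ Finset.Icc 1 n → N j u < N j (p j u) := by
    intro j u hu hpu
    have := Finset.single_le_sum (f := fun u => N j u + 1) (fun _ _ => Nat.zero_le _)
      (Finset.mem_filter.2 ⟨hu, rfl⟩ : u ∈ (Finset.Icc 1 n).filter fun u' => p j u' = p j u)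
    rw [hN j _ hpu]
    omega
  obtain ⟨a0, b1, b2, b3, b11, b12, b13⟩ := eval_setup (cap := cap) σ
  have s0 : IsSetUp n m u₀ u₁ u₂ (setup.eval cap σ) :=
    ⟨b1.trans h0, b2.trans h1, b3, b11.trans h2, b12.trans h3, b13.trans h4⟩
  set σ₀ := setup.eval cap σ with hσ₀
  clear_value σ₀
  rw [← a0] at ht hr hl hσ
  set σ₁ := (forestPass 0 2 1 4 7 10).eval cap σ₀ with hσ₁
  have s1 : IsSetUp n m u₀ u₁ u₂ σ₁ := s0.eval cap _ (by decide)
  have f1 : ∀ q, (forestPass 0 2 1 4 7 10).stores q = false → σ₁.arr q = σ₀.arr q :=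
    fun q hq => eval_arr_of_not_stores cap _ hq _
  have P0 : σ₁.arr 1 = p 0 ∧ IsChildrenFirst n (p 0) (σ₁.arr 7) :=
    eval_forestPass rfl (by decide) (by decide) (by decide) (by decide) (by decide) (by decide)
      (by decide) s0.n_eq s0.m_eq s0.one_eq (by omega) hm ht hr hl hrm htc (hσ 1 (by decide))
      (hσ 4 (by decide)) (hσ 10 (by decide)) (hp 0) (hp0 0) (hpn 0) (hrk 0)
  clear_value σ₁
  set σ₂ := (forestPass 1 3 2 5 8 11).eval cap σ₁ with hσ₂
  have s2 : IsSetUp n m u₀ u₁ u₂ σ₂ := s1.eval cap _ (by decide)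
  have f2 : ∀ q, (forestPass 1 3 2 5 8 11).stores q = false → σ₂.arr q = σ₁.arr q :=
    fun q hq => eval_arr_of_not_stores cap _ hq _
  have P1 : σ₂.arr 2 = p 1 ∧ IsChildrenFirst n (p 1) (σ₂.arr 8) :=
    eval_forestPass rfl (by decide) (by decide) (by decide) (by decide) (by decide) (by decide)
      (by decide) s1.n_eq s1.m_eq s1.one_eq (by omega) hm (by rw [f1 0 rfl]; exact ht)
      (by rw [f1 0 rfl]; exact hr) (by rw [f1 0 rfl]; exact hl) hrm htc
      (by rw [f1 2 rfl]; exact hσ 2 (by decide)) (by rw [f1 5 rfl]; exact hσ 5 (by decide))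
      (by rw [f1 11 rfl]; exact hσ 11 (by decide)) (hp 1) (hp0 1) (hpn 1) (hrk 1)
  clear_value σ₂
  set σ₃ := (forestPass 2 4 3 6 9 12).eval cap σ₂ with hσ₃
  have s3 : IsSetUp n m u₀ u₁ u₂ σ₃ := s2.eval cap _ (by decide)
  have f3 : ∀ q, (forestPass 2 4 3 6 9 12).stores q = false → σ₃.arr q = σ₂.arr q :=
    fun q hq => eval_arr_of_not_stores cap _ hq _
  have P2 : σ₃.arr 3 = p 2 ∧ IsChildrenFirst n (p 2) (σ₃.arr 9) :=
    eval_forestPass rfl (by decide) (by decide) (by decide) (by decide) (by decide) (by decide)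
      (by decide) s2.n_eq s2.m_eq s2.one_eq (by omega) hm (by rw [f2 0 rfl, f1 0 rfl]; exact ht)
      (by rw [f2 0 rfl, f1 0 rfl]; exact hr) (by rw [f2 0 rfl, f1 0 rfl]; exact hl) hrm htc
      (by rw [f2 3 rfl, f1 3 rfl]; exact hσ 3 (by decide))
      (by rw [f2 6 rfl, f1 6 rfl]; exact hσ 6 (by decide))
      (by rw [f2 12 rfl, f1 12 rfl]; exact hσ 12 (by decide)) (hp 2) (hp0 2) (hpn 2) (hrk 2)
  clear_value σ₃
  have p0 : σ₃.arr 1 = p 0 := by rw [f3 1 rfl, f2 1 rfl, P0.1]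
  have p1 : σ₃.arr 2 = p 1 := by rw [f3 2 rfl, P1.1]
  have p2 : σ₃.arr 3 = p 2 := P2.1
  have o0 : IsChildrenFirst n (p 0) (σ₃.arr 7) := by rw [f3 7 rfl, f2 7 rfl]; exact P0.2
  have o1 : IsChildrenFirst n (p 1) (σ₃.arr 8) := by rw [f3 8 rfl]; exact P1.2
  have o2 : IsChildrenFirst n (p 2) (σ₃.arr 9) := P2.2
  have z : ∀ s ∈ [13, 14, 15, 16, 17, 18], σ₃.arr s = fun _ => 0 := by
    intro s hs
    fin_cases hs <;> rw [f3 _ rfl, f2 _ rfl, f1 _ rfl] <;> exact hσ _ (by decide)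
  set σ₄ := (subtreePass 2 8 13).eval cap σ₃ with hσ₄
  have s4 : IsSetUp n m u₀ u₁ u₂ σ₄ := s3.eval cap _ (by decide)
  have f4 : ∀ q, q ≠ 13 → σ₄.arr q = σ₃.arr q :=
    fun q hq => eval_arr_of_not_stores cap _ (by simp [subtreePass, stores, hq.symm]) _
  have N1 : ∀ v ∈ Finset.Icc 1 n, σ₄.arr 13 v = N 1 v :=
    eval_subtreePass (by decide) (by decide) s3.n_eq s3.one_eq (z 13 (by decide))
      (by rw [p1]; exact o1) (by rw [p1]; exact hN 1) (hNc 1)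
  clear_value σ₄
  set σ₅ := (subtreePass 3 9 14).eval cap σ₄ with hσ₅
  have s5 : IsSetUp n m u₀ u₁ u₂ σ₅ := s4.eval cap _ (by decide)
  have f5 : ∀ q, q ≠ 14 → σ₅.arr q = σ₄.arr q :=
    fun q hq => eval_arr_of_not_stores cap _ (by simp [subtreePass, stores, hq.symm]) _
  have N2 : ∀ v ∈ Finset.Icc 1 n, σ₅.arr 14 v = N 2 v :=
    eval_subtreePass (by decide) (by decide) s4.n_eq s4.one_eq
      (by rw [f4 _ (by decide)]; exact z 14 (by decide))
      (by rw [f4 _ (by decide), f4 _ (by decide), p2]; exact o2)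
      (by rw [f4 _ (by decide), p2]; exact hN 2) (hNc 2)
  clear_value σ₅
  have f53 : ∀ q, q ≠ 13 → q ≠ 14 → σ₅.arr q = σ₃.arr q := fun q h h' => by rw [f5 q h', f4 q h]
  have hQc' : ∀ i j, ∀ v ∈ Finset.Icc 1 n, Q i j v ≤ cap := fun i j v hv => by
    have := hQc i j v hv; omega
  set σ₆ := (pathPass 3 9 13 15).eval cap σ₅ with hσ₆
  have s6 : IsSetUp n m u₀ u₁ u₂ σ₆ := s5.eval cap _ (by decide)
  have f6 : ∀ q, q ≠ 15 → σ₆.arr q = σ₅.arr q :=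
    fun q hq => eval_arr_of_not_stores cap _ (by simp [pathPass, stores, hq.symm]) _
  have Q12 : ∀ v ∈ Finset.Icc 1 n, σ₆.arr 15 v = Q 1 2 v := by
    have e3 : σ₅.arr 3 = p 2 := by rw [f53 _ (by decide) (by decide), p2]
    refine eval_pathPass (by decide) (by decide) (by decide) s5.n_eq s5.one_eq ?_ ?_ ?_ (hQ0 1 2) ?_
      (hQc' 1 2)
    · rw [f53 _ (by decide) (by decide), z 15 (by decide)]
    · rw [e3, f53 _ (by decide) (by decide)]; exact o2
    · rw [e3]; exact hpn 2
    · intro v hv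
      rw [e3, f5 _ (by decide), N1 v hv]; exact hQ 1 2 (by decide) v hv
  clear_value σ₆
  set σ₇ := (pathPass 1 7 13 16).eval cap σ₆ with hσ₇
  have s7 : IsSetUp n m u₀ u₁ u₂ σ₇ := s6.eval cap _ (by decide)
  have f7 : ∀ q, q ≠ 16 → σ₇.arr q = σ₆.arr q :=
    fun q hq => eval_arr_of_not_stores cap _ (by simp [pathPass, stores, hq.symm]) _
  have Q10 : ∀ v ∈ Finset.Icc 1 n, σ₇.arr 16 v = Q 1 0 v := by
    have e3 : σ₆.arr 1 = p 0 := by rw [f6 _ (by decide), f53 _ (by decide) (by decide), p0]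
    refine eval_pathPass (by decide) (by decide) (by decide) s6.n_eq s6.one_eq ?_ ?_ ?_ (hQ0 1 0) ?_
      (hQc' 1 0)
    · rw [f6 _ (by decide), f53 _ (by decide) (by decide), z 16 (by decide)]
    · rw [e3, f6 _ (by decide), f53 _ (by decide) (by decide)]; exact o0
    · rw [e3]; exact hpn 0
    · intro v hv
      rw [e3, f6 _ (by decide), f5 _ (by decide), N1 v hv]; exact hQ 1 0 (by decide) v hv
  clear_value σ₇
  set σ₈ := (pathPass 1 7 14 17).eval cap σ₇ with hσ₈
  have s8 : IsSetUp n m u₀ u₁ u₂ σ₈ := s7.eval cap _ (by decide)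
  have f8 : ∀ q, q ≠ 17 → σ₈.arr q = σ₇.arr q :=
    fun q hq => eval_arr_of_not_stores cap _ (by simp [pathPass, stores, hq.symm]) _
  have Q20 : ∀ v ∈ Finset.Icc 1 n, σ₈.arr 17 v = Q 2 0 v := by
    have e3 : σ₇.arr 1 = p 0 := by
      rw [f7 _ (by decide), f6 _ (by decide), f53 _ (by decide) (by decide), p0]
    refine eval_pathPass (by decide) (by decide) (by decide) s7.n_eq s7.one_eq ?_ ?_ ?_ (hQ0 2 0) ?_
      (hQc' 2 0)
    · rw [f7 _ (by decide), f6 _ (by decide), f53 _ (by decide) (by decide), z 17 (by decide)]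
    · rw [e3, f7 _ (by decide), f6 _ (by decide), f53 _ (by decide) (by decide)]; exact o0
    · rw [e3]; exact hpn 0
    · intro v hv
      rw [e3, f7 _ (by decide), f6 _ (by decide), N2 v hv]; exact hQ 2 0 (by decide) v hv
  clear_value σ₈
  set σ₉ := (pathPass 2 8 14 18).eval cap σ₈ with hσ₉
  have s9 : IsSetUp n m u₀ u₁ u₂ σ₉ := s8.eval cap _ (by decide)
  have f9 : ∀ q, q ≠ 18 → σ₉.arr q = σ₈.arr q :=
    fun q hq => eval_arr_of_not_stores cap _ (by simp [pathPass, stores, hq.symm]) _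
  have Q21 : ∀ v ∈ Finset.Icc 1 n, σ₉.arr 18 v = Q 2 1 v := by
    have e3 : σ₈.arr 2 = p 1 := by
      rw [f8 _ (by decide), f7 _ (by decide), f6 _ (by decide), f53 _ (by decide) (by decide), p1]
    refine eval_pathPass (by decide) (by decide) (by decide) s8.n_eq s8.one_eq ?_ ?_ ?_ (hQ0 2 1) ?_
      (hQc' 2 1)
    · rw [f8 _ (by decide), f7 _ (by decide), f6 _ (by decide), f53 _ (by decide) (by decide),
        z 18 (by decide)]
    · rw [e3, f8 _ (by decide), f7 _ (by decide), f6 _ (by decide), f53 _ (by decide) (by decide)]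
      exact o1
    · rw [e3]; exact hpn 1
    · intro v hv
      rw [e3, f8 _ (by decide), f7 _ (by decide), f6 _ (by decide), N2 v hv]
      exact hQ 2 1 (by decide) v hv
  clear_value σ₉
  have N1' : ∀ v ∈ Finset.Icc 1 n, σ₉.arr 13 v = N 1 v := fun v hv => by
    rw [f9 _ (by decide), f8 _ (by decide), f7 _ (by decide), f6 _ (by decide), f5 _ (by decide),
      N1 v hv]
  have N2' : ∀ v ∈ Finset.Icc 1 n, σ₉.arr 14 v = N 2 v := fun v hv => by
    rw [f9 _ (by decide), f8 _ (by decide), f7 _ (by decide), f6 _ (by decide), N2 v hv]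
  have Q12' : ∀ v ∈ Finset.Icc 1 n, σ₉.arr 15 v = Q 1 2 v := fun v hv => by
    rw [f9 _ (by decide), f8 _ (by decide), f7 _ (by decide), Q12 v hv]
  have Q10' : ∀ v ∈ Finset.Icc 1 n, σ₉.arr 16 v = Q 1 0 v := fun v hv => by
    rw [f9 _ (by decide), f8 _ (by decide), Q10 v hv]
  have Q20' : ∀ v ∈ Finset.Icc 1 n, σ₉.arr 17 v = Q 2 0 v := fun v hv => by
    rw [f9 _ (by decide), Q20 v hv]
  set σ₁₀ := (outputPass 15 16 13 0).eval cap σ₉ with hσ₁₀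
  have s10 : IsSetUp n m u₀ u₁ u₂ σ₁₀ := s9.eval cap _ (by decide)
  have f10 : ∀ q, q ≠ 0 → σ₁₀.arr q = σ₉.arr q :=
    fun q hq => eval_arr_of_not_stores cap _ (by simp [outputPass, stores, hq.symm]) _
  have X := eval_outputPass (cap := cap) (x := 0) (Qa := 15) (Qb := 16) (N := 13) (by decide)
    (by decide) (by decide) s9.n_eq s9.one_eq hn (fun v hv => by
      rw [Q12' v hv, Q10' v hv]
      have := hQc 1 2 v hv; have := hQc 1 0 v hv; omega)
  rw [← hσ₁₀] at X
  clear_value σ₁₀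
  set σ₁₁ := (outputPass 17 18 14 1).eval cap σ₁₀ with hσ₁₁
  have s11 : IsSetUp n m u₀ u₁ u₂ σ₁₁ := s10.eval cap _ (by decide)
  have Y := eval_outputPass (cap := cap) (x := 1) (Qa := 17) (Qb := 18) (N := 14) (σ := σ₁₀)
    (by decide) (by decide) (by decide) s10.n_eq s10.one_eq hn (fun v hv => by
      rw [f10 _ (by decide), f10 _ (by decide), Q20' v hv, Q21 v hv]
      have := hQc 2 0 v hv; have := hQc 2 1 v hv; omega)
  rw [← hσ₁₁] at Y
  clear_value σ₁₁
  have F := eval_finish (cap := cap) s11.n_eq s11.one_eq s11.outer₀ s11.outer₁ s11.outer₂ (by omega)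
    hu₀ hu₁ hu₂ h01 h02 h12
  have e : schnyder.eval cap σ = finish.eval cap σ₁₁ := by
    rw [hσ₁₁, hσ₁₀, hσ₉, hσ₈, hσ₇, hσ₆, hσ₅, hσ₄, hσ₃, hσ₂, hσ₁, hσ₀]
    rfl
  rw [e]
  refine ⟨F.1, F.2.1, F.2.2.1, fun i hi hi0 hi1 hi2 => ?_⟩
  have hi' : i + 1 ∈ Finset.Icc 1 n := Finset.mem_Icc.2 ⟨by omega, by omega⟩
  obtain ⟨F1, F2⟩ := F.2.2.2 i hi0 hi1 hi2
  rw [F1, F2]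
  constructor
  · have h1 := Y.2 (2 * i) (fun j _ => by rw [show ((1 : Fin 8) : ℕ) = 1 from rfl]; omega)
    have h2 := X.1 i hi
    rw [show ((0 : Fin 8) : ℕ) = 0 from rfl, add_zero] at h2
    rw [h1, h2, Q12' _ hi', Q10' _ hi', N1' _ hi']
  · have h2 := Y.1 i hi
    rw [show ((1 : Fin 8) : ℕ) = 1 from rfl] at h2
    rw [h2, f10 _ (by decide), f10 _ (by decide), f10 _ (by decide), Q20' _ hi', Q21 _ hi',
      N2' _ hi']

end Cmd


/-! ### The input -/

lemma getD_flatten_ofFn {m c : ℕ} (f : Fin m → List ℕ) (hf : ∀ i, (f i).length = c) (i : Fin m)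
    {r : ℕ} (hr : r < c) : ((List.ofFn f).flatten).getD (c * i + r) 0 = (f i).getD r 0 := by
  induction m with
  | zero => exact i.elim0
  | succ m ih =>
    rw [List.ofFn_succ, List.flatten_cons]
    induction i using Fin.cases with
    | zero =>
      rw [List.getD_append _ _ _ _ (by rw [hf]; simpa using hr)]
      simp
    | succ i =>
      rw [List.getD_append_right _ _ _ _ (by rw [hf, Fin.val_succ]; nlinarith), hf]
      have := ih (fun i => f i.succ) (fun i => hf _) i
      rw [← this]
      congr 1
      rw [Fin.val_succ, mul_add, mul_one]
      omega

lemma length_flatten_ofFn {m c : ℕ} (f : Fin m → List ℕ) (hf : ∀ i, (f i).length = c) :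
    (List.ofFn f).flatten.length = c * m := by
  induction m with
  | zero => simp
  | succ m ih =>
    rw [List.ofFn_succ, List.flatten_cons, List.length_append, hf, ih _ fun i => hf _]
    ring

section Encode

variable {V : Type*} {G : MaximalPlaneGraph V} (W : SchnyderWood G) {n m : ℕ} (ν : V ≃ Fin n)
  (δ : G.graph.Dart ≃ Fin m)

/-- Five header cells are followed by records of four cells. -/
lemma encode_getD (d : G.graph.Dart) {r : ℕ} (hr : r < 4) :
    (encode W ν δ).getD (4 * (δ d : ℕ) + (5 + r)) 0 =
      [(ν d.fst : ℕ), (δ d.symm : ℕ), (δ (G.rot.next d) : ℕ), labelCode (W.lab d)].getD r 0 := by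
  rw [encode, List.getD_append_right _ _ _ _ (by simp; omega)]
  have e : 4 * (δ d : ℕ) + (5 + r) - [n, m, (ν (G.outer 0) : ℕ), (ν (G.outer 1) : ℕ),
    (ν (G.outer 2) : ℕ)].length = 4 * (δ d : ℕ) + r := by simp; omega
  rw [e, getD_flatten_ofFn _ (by simp) _ hr]
  simp

lemma length_encode : (encode W ν δ).length = 4 * m + 5 := by
  rw [encode, List.length_append, length_flatten_ofFn _ (c := 4) (by simp)]
  simp
  omega

lemma encode_getD_le {B : ℕ} (hn : n ≤ B) (hm : m ≤ B) (hB : 3 ≤ B) (k : ℕ) :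
    (encode W ν δ).getD k 0 ≤ B := by
  have hν : ∀ v, (ν v : ℕ) ≤ B := fun v => (ν v).2.le.trans hn
  have hδ : ∀ d, (δ d : ℕ) ≤ B := fun d => (δ d).2.le.trans hm
  have hl : ∀ o, labelCode o ≤ B := by
    rintro (_ | i)
    · exact Nat.zero_le _
    · have := i.2
      simp only [labelCode]
      omega
  have hall : ∀ x ∈ encode W ν δ, x ≤ B := by
    intro x hx
    rw [encode, List.mem_append] at hx
    rcases hx with hx | hx
    · simp only [List.mem_cons, List.not_mem_nil, or_false] at hx
      rcases hx with rfl | rfl | rfl | rfl | rfl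
      exacts [hn, hm, hν _, hν _, hν _]
    · obtain ⟨l, hl', hx⟩ := List.mem_flatten.1 hx
      obtain ⟨i, rfl⟩ := (List.mem_ofFn' _ _).1 hl'
      simp only [List.mem_cons, List.not_mem_nil, or_false] at hx
      rcases hx with rfl | rfl | rfl | rfl
      exacts [hν _, hδ _, hδ _, hl _]
  rcases Nat.lt_or_ge k (encode W ν δ).length with hk | hk
  · rw [List.getD_eq_getElem _ _ hk]
    exact hall _ (List.getElem_mem _)
  · rw [List.getD_eq_default _ _ hk]
    exact Nat.zero_le _

end Encode

lemma labelCode_eq_succ {o : Option (Fin 3)} {j : Fin 3} :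
    labelCode o = (j : ℕ) + 1 ↔ o = some j := by
  cases o with
  | none => simp [labelCode]
  | some i => simp [labelCode, Fin.val_inj]

/-- A function on the vertices as a function of their numbers, where the numbers start at `1`, with
the value `0` at other numbers. -/
def numbered {V : Type*} {n : ℕ} (ν : V ≃ Fin n) (F : V → ℕ) (k : ℕ) : ℕ :=
  if h : k - 1 < n ∧ k ≠ 0 then F (ν.symm ⟨k - 1, h.1⟩) else 0

section Numbered

variable {V : Type*} {n : ℕ} (ν : V ≃ Fin n) (F : V → ℕ)

/-- The number of a vertex. -/
def number : V ↪ ℕ where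
  toFun v := (ν v : ℕ) + 1
  inj' _ _ h := ν.injective (Fin.ext (Nat.succ.inj h))

lemma number_apply (v : V) : number ν v = (ν v : ℕ) + 1 := rfl

lemma numbered_succ (v : V) : numbered ν F ((ν v : ℕ) + 1) = F v := by
  rw [numbered, dif_pos ⟨by simp, by omega⟩]
  simp

lemma numbered_zero : numbered ν F 0 = 0 := dif_neg (by simp)

lemma exists_number {k : ℕ} (hk : k ∈ Finset.Icc 1 n) : ∃ v, k = (ν v : ℕ) + 1 := by
  rw [Finset.mem_Icc] at hk
  refine ⟨ν.symm ⟨k - 1, by omega⟩, ?_⟩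
  simp
  omega

lemma number_mem (v : V) : (ν v : ℕ) + 1 ∈ Finset.Icc 1 n := by
  have := (ν v).2
  rw [Finset.mem_Icc]
  omega

end Numbered

/-! ### From the wood to the arrays of the algorithm -/

namespace SchnyderWood

variable {V : Type*} [Finite V] {G : MaximalPlaneGraph V} (W : SchnyderWood G)

lemma filter_parent_eq {n : ℕ} (ν : V ≃ Fin n) (i : Fin 3) (v : V) :
    (Finset.Icc 1 n).filter (fun u => numbered ν
      (fun c => (W.parent i c).elim 0 fun p => (ν p : ℕ) + 1) u = (ν v : ℕ) + 1) =
      (W.children i v).map (number ν) := by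
  ext u
  simp only [Finset.mem_filter, Finset.mem_map, number_apply, W.mem_children]
  constructor
  · rintro ⟨hu, h⟩
    obtain ⟨c, rfl⟩ := exists_number ν hu
    refine ⟨c, ?_, rfl⟩
    rw [numbered_succ] at h
    cases hc : W.parent i c with
    | none => rw [hc] at h; simp at h
    | some p =>
      rw [hc] at h
      simp only [Option.elim_some, add_left_inj, Fin.val_inj, EmbeddingLike.apply_eq_iff_eq] at h
      rw [h]
  · rintro ⟨c, hc, rfl⟩
    refine ⟨number_mem ν c, ?_⟩
    rw [numbered_succ, hc]
    rfl

lemma holds_drawing {n m : ℕ} (ν : V ≃ Fin n) (δ : G.graph.Dart ≃ Fin m) {mem : ℕ → ℕ}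
    (hmem : ∀ k ≤ 64 * n,
      mem k = (Cmd.schnyder.eval (64 * n) (Data.start (encode W ν δ))).arr 0 k) :
    Holds ν W.drawing mem := by
  have hcn : Nat.card V = n := by rw [Nat.card_congr ν, Nat.card_fin]
  have hcm : Nat.card G.graph.Dart = m := by rw [Nat.card_congr δ, Nat.card_fin]
  have h6 := W.card_dart_add
  rw [hcn, hcm] at h6
  have h3 : 3 ≤ n := by
    have := Nat.card_le_card_of_injective _ G.outer_injective
    rwa [Nat.card_fin, hcn] at this
  have hne : ∀ i j, i ≠ j → (ν (G.outer i) : ℕ) ≠ ν (G.outer j) := fun i j hij h =>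
    hij (G.outer_injective (ν.injective (Fin.ext h)))
  have ht : ∀ d, (encode W ν δ).getD (4 * (δ d : ℕ) + 5) 0 = ν d.fst := fun d =>
    encode_getD W ν δ d (r := 0) (by omega)
  have hr : ∀ d, (encode W ν δ).getD (4 * (δ d : ℕ) + 6) 0 = δ d.symm := fun d =>
    encode_getD W ν δ d (r := 1) (by omega)
  have hl : ∀ d, (encode W ν δ).getD (4 * (δ d : ℕ) + 8) 0 = labelCode (W.lab d) := fun d =>
    encode_getD W ν δ d (r := 3) (by omega)
  have hdart : ∀ i < m, ∃ d, i = (δ d : ℕ) := fun i hi => ⟨δ.symm ⟨i, hi⟩, by simp⟩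
  -- The capacity 64n suffices: there are m = 6n - 12 darts, hence 4m + 5 input cells, and all the
  -- sums are at most 2n + 1.
  have key := Cmd.eval_schnyder (cap := 64 * n) (n := n) (m := m) (u₀ := ν (G.outer 0))
    (u₁ := ν (G.outer 1)) (u₂ := ν (G.outer 2)) (σ := Data.start (encode W ν δ))
    (t := fun i => (encode W ν δ).getD (4 * i + 5) 0)
    (r := fun i => (encode W ν δ).getD (4 * i + 6) 0)
    (l := fun i => (encode W ν δ).getD (4 * i + 8) 0)
    (p := fun j => numbered ν fun c => (W.parent j c).elim 0 fun p => (ν p : ℕ) + 1)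
    (N := fun i => numbered ν (W.treeN i)) (Q := fun i j => numbered ν (W.treeQ i j))
    (fun s hs => by funext k; simp [Data.start, hs])
    rfl rfl rfl rfl rfl (ν _).2 (ν _).2 (ν _).2 (hne _ _ (by decide)) (hne _ _ (by decide))
    (hne _ _ (by decide)) (by omega) (by omega) (fun i _ => rfl) (fun i _ => rfl) (fun i _ => rfl)
    ?_ ?_ ?_ ?_ ?_ ?_ ?_ (fun i j => numbered_zero ν _) ?_ ?_
  · generalize (Cmd.schnyder.eval (64 * n) (Data.start (encode W ν δ))).arr 0 = A at key hmem
    obtain ⟨⟨x0, y0⟩, ⟨x1, y1⟩, ⟨x2, y2⟩, hint⟩ := key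
    have hlt : ∀ w, (ν w : ℕ) < n := fun w => (ν w).2
    have hD := (W.draws_iff W.drawing).2 rfl
    have hmem' : ∀ w, mem (2 * (ν w : ℕ)) = A (2 * (ν w : ℕ)) ∧
        mem (2 * (ν w : ℕ) + 1) = A (2 * (ν w : ℕ) + 1) :=
      fun w => ⟨hmem _ (by have := hlt w; omega), hmem _ (by have := hlt w; omega)⟩
    have hcast : ((2 * n - 5 : ℕ) : ℤ) = 2 * (Nat.card V : ℤ) - 5 := by rw [hcn]; omega
    intro w
    rw [(hmem' w).1, (hmem' w).2]
    by_cases hw : G.IsInternalVertex w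
    · have hnw : ∀ i, (ν w : ℕ) ≠ ν (G.outer i) := fun i h => hw i (ν.injective (Fin.ext h))
      obtain ⟨hx, hy⟩ := hint _ (hlt w) (hnw 0) (hnw 1) (hnw 2)
      rw [hx, hy]
      simp only [numbered_succ]
      -- For i = 1 and i = 2 the two other colors are i + 1 and i + 2 modulo 3, which are the path
      -- sums that the program computes.
      have e1 := W.treeQ_add_treeQ (i := 1) hw
      have e2 := W.treeQ_add_treeQ (i := 2) hw
      change W.treeQ 1 2 w + W.treeQ 1 0 w = _ at e1
      change W.treeQ 2 0 w + W.treeQ 2 1 w = _ at e2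
      rw [e1, e2]
      simp only [drawing]
      congr 2 <;> omega
    · rw [MaximalPlaneGraph.IsInternalVertex] at hw
      push Not at hw
      obtain ⟨i, rfl⟩ := hw
      fin_cases i
      · change W.drawing (G.outer 0) = _
        rw [hD.outer₁]
        simp [x0, y0]
      · change W.drawing (G.outer 1) = _
        rw [hD.outer₂, ← hcast]
        simp [x1, y1]
      · change W.drawing (G.outer 2) = _
        rw [hD.outer₃, ← hcast]
        simp [x2, y2]
  · intro i hi
    obtain ⟨d, rfl⟩ := hdart i hi
    rw [hr]
    exact (δ _).2
  · intro i hi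
    obtain ⟨d, rfl⟩ := hdart i hi
    rw [ht]
    have := (ν d.fst).2
    omega
  · intro j i hi hli
    obtain ⟨d, rfl⟩ := hdart i hi
    rw [hl, labelCode_eq_succ] at hli
    rw [hr, ht, ht, numbered_succ, W.parent_of_lab hli]
    rfl
  · intro j v hv
    by_cases hk : v ∈ Finset.Icc 1 n
    · obtain ⟨c, rfl⟩ := exists_number ν hk
      rw [numbered_succ]
      cases hc : W.parent j c with
      | none => rfl
      | some p =>
        obtain ⟨d, hd, rfl, rfl⟩ := W.parent_eq_some_iff.1 hc
        refine absurd ?_ (hv (δ d) (δ d).2 ?_)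
        · rw [ht]
        · rw [hl, labelCode_eq_succ]; exact hd
    · rw [Finset.mem_Icc] at hk
      exact dif_neg (by omega)
  · intro j u hu
    obtain ⟨c, rfl⟩ := exists_number ν hu
    rw [numbered_succ]
    cases W.parent j c with
    | none => exact Nat.zero_le _
    | some p => exact (ν p).2
  · intro j v hv
    obtain ⟨c, rfl⟩ := exists_number ν hv
    rw [numbered_succ, W.filter_parent_eq, Finset.sum_map, W.treeN_eq]
    simp only [number_apply, numbered_succ]
  · intro j v hv
    obtain ⟨c, rfl⟩ := exists_number ν hv
    rw [numbered_succ]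
    have := W.treeN_le j c
    omega
  · intro i j hij v hv
    obtain ⟨c, rfl⟩ := exists_number ν hv
    rw [numbered_succ, numbered_succ, numbered_succ, W.treeQ_eq hij]
    congr 1
    cases W.parent j c with
    | none => exact (numbered_zero ν _).symm
    | some p => exact (numbered_succ ν (W.treeQ i j) p).symm
  · intro i j v hv
    obtain ⟨c, rfl⟩ := exists_number ν hv
    rw [numbered_succ]
    have := W.treeQ_le i j c
    omega

/-- The slopes determine every label, and a wood consists of its labels. -/
lemma drawing_injective : Function.Injective fun W : SchnyderWood G => W.drawing := by
  intro W W' h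
  ext d i
  dsimp only at h
  rw [W.lab_iff_inSector, W'.lab_iff_inSector, h]

end SchnyderWood

end Schnyder

theorem mainTheorem4 :
    ∃ (p : Schnyder.Program) (c : ℕ),
      ∀ (V : Type*) [Finite V] (G : Schnyder.MaximalPlaneGraph V),
        ∃ s : Schnyder.SchnyderWood G → Schnyder.SchnyderDrawing G,
          Function.Bijective s ∧
          (∀ (W : Schnyder.SchnyderWood G) (Γ : Schnyder.GridDrawing V),
            W.Draws Γ ↔ Γ = (s W).val) ∧
          (∀ (W : Schnyder.SchnyderWood G) (d : G.graph.Dart) (i : Fin 3),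
            W.lab d = some i ↔ Schnyder.InSector i ((s W).val d.snd - (s W).val d.fst)) ∧
          (∀ (W : Schnyder.SchnyderWood G) (n m : ℕ) (ν : V ≃ Fin n) (δ : G.graph.Dart ≃ Fin m),
            p.Computes (Schnyder.encode W ν δ) (c * n) (c * n) (Schnyder.Holds ν (s W).val)) := by
  obtain ⟨c, hc⟩ :=
    Schnyder.Program.exists_computes Schnyder.Cmd.wf_schnyder Schnyder.Cmd.unnested_schnyder
  refine ⟨Schnyder.Program.prologue ++ Schnyder.Cmd.schnyder.compile 9, c, fun V _ G =>
    ⟨fun W => ⟨W.drawing, W, (W.draws_iff _).2 rfl⟩, ⟨fun W W' h => ?_, ?_⟩,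
    fun W Γ => W.draws_iff Γ, fun W d i => W.lab_iff_inSector d i, fun W n m ν δ => ?_⟩⟩
  · exact Schnyder.SchnyderWood.drawing_injective (congrArg Subtype.val h)
  · rintro ⟨Γ, W, hW⟩
    exact ⟨W, Subtype.ext ((W.draws_iff Γ).1 hW).symm⟩
  · have hcn : Nat.card V = n := by rw [Nat.card_congr ν, Nat.card_fin]
    have hcm : Nat.card G.graph.Dart = m := by rw [Nat.card_congr δ, Nat.card_fin]
    have h6 := W.card_dart_add
    rw [hcn, hcm] at h6
    refine hc _ n rfl (by omega) ?_ (Schnyder.encode_getD_le W ν δ (by omega) (by omega) (by omega))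
      _ fun mem hmem => W.holds_drawing ν δ hmem
    rw [Schnyder.length_encode]
    omega
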